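/- Let $F$ be a non-archimedean local field of characteristic $0$ with odd residual characteristic, with ring of integers $\mathcal O$, maximal ideal $\mathfrak p$, residue field of cardinality $q$ and normalized absolute value $|\cdot|$. Let $\widetilde G=\mathrm{SL}_2(F)\times\{\pm1\}$ be the metaplectic group, with group law $(g_1,\epsilon_1)(g_2,\epsilon_2)=(g_1g_2,\epsilon_1\epsilon_2\boldsymbol c(g_1,g_2))$, where $\boldsymbol c(g_1,g_2)=\left(\frac{\boldsymbol x(g_1)}{\boldsymbol x(g_1g_2)},\frac{\boldsymbol x(g_2)}{\boldsymbol x(g_1g_2)}\right)_2$ is the Kubota cocycle: $(\cdot,\cdot)_2$ is the quadratic Hilbert symbol, and $\boldsymbol x\begin{pmatrix}a&b\\c&d\end{pmatrix}$ is $c$ if $c\neq0$ and $d$ if $c=0$. Let $\varepsilon\in\{0,1\}$, and let $\psi$ be a (continuous) additive character of $F$ of conductor $-\varepsilon$, i.e. $-\varepsilon$ is the minimal integer $c$ such that $\psi$ is trivial on $\mathfrak p^{c}$. For $m\ge0$ let $K_m=K^\varepsilon_m$ be the group of all $\begin{pmatrix}a&b\\c&d\end{pmatrix}\in\mathrm{SL}_2(F)$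 with $a,d\in\mathcal O$, $b\in\mathfrak p^{-\varepsilon}$, $c\in\mathfrak p^{m+\varepsilon}$, regarded as a subgroup of $\widetilde G$ via the unique splitting of the covering over $K^\varepsilon_0$. Let $\gamma_F(\psi)$ be the Weil index of $x\mapsto\psi(x^2)$ and $\gamma_F(a,\psi)=\gamma_F(\psi_a)/\gamma_F(\psi)$, where $\psi_a(x)=\psi(ax)$. Write $t(a)=\mathrm{diag}(a,a^{-1})$, $n(b)=\begin{pmatrix}1&b\\0&1\end{pmatrix}$. For a character (continuous homomorphism to $\mathbb C^\times$) $\mu$ of $F^\times$, let $\pi_\psi(\mu)$ be the representation of $\widetilde G$ by right translation on the space of locally constant functions $f:\widetilde G\to\mathbb C$ with $$f\big((t(a),\epsilon)(n(b),1)g\big)=\epsilon\,|a|\,\mu(a)\,\gamma_F(a,\psi)^{-1}f(g)\qquad(a\in F^\times,\ \epsilon\in\{\pm1\},\ b\in F,\ g\in\widetilde G).$$ For a character $\eta$ of $\mathcal O^\times$ let $c(\eta)$ be its conductor: $c(1)=0$, and otherwise the minimal $c\ge1$ such that $\eta$ is trivial on $1+\mathfrak p^c$. Put $c(\mu)=c(\mu|_{\mathcal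 O^\times})$, and write $\eta\mu^{\pm1}$ for the product of $\eta$ and $\mu^{\pm1}|_{\mathcal O^\times}$. For a representation $\pi$ of $\widetilde G$ on $V$ let $\pi^{K_m}_\eta=\{v\in V:\pi(k)v=\eta(d)v\text{ for all }k=\begin{pmatrix}a&b\\c&d\end{pmatrix}\in K_m\}$ if $m\ge c(\eta)$ (where $\eta(d)$ means $1$ if $m=0$), and $\pi^{K_m}_\eta=\{0\}$ if $m<c(\eta)$. Let $c^\varepsilon_\eta(\pi)$ be the minimal $m\ge 0$ with $\pi^{K_m}_\eta\neq\{0\}$ ($+\infty$ if there is none), and let $c^\varepsilon_{\min}(\pi)$ be the minimum of $c^\varepsilon_\eta(\pi)$ over the characters $\eta$ of $\mathcal O^\times$ such that the central element $(-1_2,\gamma_F(-1,\psi))$ of $\widetilde G$ acts on $\pi$ by $\eta(-1)$. **Theorem.** Let $\mu$ be a character of $F^\times$ and $\eta$ a character of $\mathcal O^\times$. 1. If $\eta(-1)\ne\mu(-1)$, then $\pi_\psi(\mu)^{K_m}_\eta=\{0\}$ for all $m\ge0$. 2. Suppose $\eta(-1)=\mu(-1)$ and $m\ge0$. If $c(\mu)=c(\eta)=m=0$,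 then $\pi_\psi(\mu)^{K_m}_\eta=\pi_\psi(\mu)^{K_0}_1$ is $1$-dimensional. Otherwise $\pi_\psi(\mu)^{K_m}_\eta$ is finite-dimensional, and its dimension is $$\begin{cases}0,&m<c(\mu),\\ 2\big((m-c(\mu)-c(\eta\mu)+1)^++(m-c(\mu)-c(\eta\mu^{-1})+1)^+\big)-\delta_{c(\eta\mu)}-\delta_{c(\eta\mu^{-1})},&c(\mu)\le m<2c(\mu),\\ 2\,(m-c(\eta\mu)-c(\eta\mu^{-1})+1)^+-\delta_{c(\eta\mu)}-\delta_{c(\eta\mu^{-1})},&2c(\mu)\le m,\end{cases}$$ where $r^+=\max(0,r)$, and $\delta_s$ is $1$ if $s=0$ and $0$ otherwise. In particular, $c^\varepsilon_{\min}(\pi_\psi(\mu))=c(\mu)$, and $c^\varepsilon_{\min}(\pi_\psi(\mu))=c^\varepsilon_\eta(\pi_\psi(\mu))$ if and only if $\eta=\mu|_{\mathcal O^\times}$ or $\eta=\mu^{-1}|_{\mathcal O^\times}$. -/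

import Mathlib

open Matrix Filter Topology ValuativeRel IsNonarchimedeanLocalField
open scoped WithZero MatrixGroups

noncomputable section

namespace Metaplectic

/-! ## The field -/

section LocalField

variable (F : Type*) [Field F] [ValuativeRel F] [TopologicalSpace F]
  [IsNonarchimedeanLocalField F]

/-- The valuation of `F` in multiplicative notation, `x ↦ exp (-ord x)`, normalized so that a
prime element is sent to `exp (-1)`. -/
def val : Valuation F ℤᵐ⁰ :=
  (valuation F).map (valueGroupWithZeroIsoInt F).toMonoidWithZeroHom
    (OrderHomClass.mono (valueGroupWithZeroIsoInt F))

variable {F}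

/-- The fractional ideal `𝔭 ^ n = {x | n ≤ ord x}` for an integer `n`. -/
def fracIdeal (n : ℤ) : Set F := {x | val F x ≤ WithZero.exp (-n)}

/-- The normalized absolute value `|a| = q ^ (-ord a)` of `a ∈ Fˣ`, where `q` is the cardinality
of the residue field. -/
def normAbs (a : Fˣ) : ℝ := (Nat.card 𝓀[F] : ℝ) ^ (WithZero.log (val F (a : F)))

open Classical in
/-- The quadratic Hilbert symbol `(a, b)_2` (used for nonzero `a`, `b`). -/
def hilbert (a b : F) : ℤˣ :=
  if ∃ x y z : F, (x, y, z) ≠ (0, 0, 0) ∧ z ^ 2 = a * x ^ 2 + b * y ^ 2 then 1 else -1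

/-! ## Additive characters and Weil indices -/

/-- `c` is the conductor of `ψ`: the minimal integer `c` such that `ψ` is trivial on `𝔭 ^ c`. -/
def HasConductor (ψ : AddChar F ℂ) (c : ℤ) : Prop :=
  IsLeast {c : ℤ | ∀ x ∈ fracIdeal (F := F) c, ψ x = 1} c

/-- `∫ ψ(x²) dx` over `𝔭 ^ (-n)`, for some Haar measure on `F`. -/
def quadIntegral (ψ : AddChar F ℂ) (n : ℕ) : ℂ :=
  letI : MeasurableSpace F := borel F
  haveI : BorelSpace F := ⟨rfl⟩
  ∫ x in fracIdeal (F := F) (-(n : ℤ)), ψ (x ^ 2) ∂(MeasureTheory.Measure.addHaar : MeasureTheory.Measure F)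

/-- The Weil index `γ_F(ψ)` of the character of second degree `x ↦ ψ(x²)`: the phase of the
(eventually constant) integrals of `ψ(x²)` over `𝔭 ^ (-n)` as `n` grows. It does not depend on
the Haar measure. -/
def weilIndex (ψ : AddChar F ℂ) : ℂ :=
  limUnder atTop fun n : ℕ => quadIntegral ψ n / (‖quadIntegral ψ n‖ : ℂ)

/-- The normalized Weil index `γ_F(a, ψ) = γ_F(ψ_a) / γ_F(ψ)`, where `ψ_a(x) = ψ(a x)`. -/
def weilRatio (a : F) (ψ : AddChar F ℂ) : ℂ :=
  weilIndex (ψ.mulShift a) / weilIndex ψ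

/-! ## Multiplicative characters -/

/-- The restriction to `𝒪ˣ` of a character of `Fˣ`. -/
def resUnits (μ : Fˣ →ₜ* ℂˣ) : 𝒪[F]ˣ →ₜ* ℂˣ where
  toMonoidHom := μ.toMonoidHom.comp (Units.map (𝒪[F].subtype : 𝒪[F] →* F))
  continuous_toFun := μ.continuous_toFun.comp
    (Continuous.units_map _ continuous_subtype_val)

/-- The conductor of a character `η` of `𝒪ˣ`: the minimal `c ≥ 0` such that `η` is trivial on
the units congruent to `1` modulo `𝔭 ^ c`. For `c = 0` the condition is that `η` is trivial, so
the conductor is `0` for the trivial character and is positive for all other characters. -/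
def cond (η : 𝒪[F]ˣ →ₜ* ℂˣ) : ℕ :=
  sInf {c : ℕ | ∀ u : 𝒪[F]ˣ, (u : 𝒪[F]) - 1 ∈ 𝓂[F] ^ c → η u = 1}

open Classical in
/-- `η(d)` for `d ∈ F`, read as `1` when `d` is not a unit of `𝒪`. A lower right entry `d` of an
element of `K_m` can fail to be a unit only if `m = 0`; then `η` is relevant only if it is
trivial. -/
def evalUnit (η : 𝒪[F]ˣ →ₜ* ℂˣ) (d : F) : ℂ :=
  if h : ∃ u : 𝒪[F]ˣ, ((u : 𝒪[F]) : F) = d then ((η h.choose : ℂˣ) : ℂ) else 1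

end LocalField

/-! ## The metaplectic group -/

section Group

/-- The matrix `t(a) = diag(a, a⁻¹)`. -/
def torus {F : Type*} [Field F] (a : Fˣ) : SL(2, F) :=
  ⟨!![(a : F), 0; 0, ((a⁻¹ : Fˣ) : F)], by simp [Matrix.det_fin_two]⟩

/-- The matrix `n(b)`, upper triangular unipotent. -/
def unip {F : Type*} [Field F] (b : F) : SL(2, F) :=
  ⟨!![1, b; 0, 1], by simp [Matrix.det_fin_two]⟩

open Classical in
/-- The function `𝐱` on `SL₂(F)`: the lower left entry if it is nonzero, and the lower right
entry otherwise. -/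
def kubotaX {F : Type*} [Field F] (g : SL(2, F)) : F :=
  if g 1 0 ≠ 0 then g 1 0 else g 1 1

/-- The underlying set `SL₂(F) × {±1}` of the metaplectic group. -/
@[ext]
structure Mp (F : Type*) [Field F] where
  mat : SL(2, F)
  sgn : ℤˣ

variable {F : Type*} [Field F] [ValuativeRel F] [TopologicalSpace F]
  [IsNonarchimedeanLocalField F]

/-- The Kubota cocycle. -/
def kubota (g₁ g₂ : SL(2, F)) : ℤˣ :=
  hilbert (kubotaX g₁ / kubotaX (g₁ * g₂)) (kubotaX g₂ / kubotaX (g₁ * g₂))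

/-- The group law of the metaplectic group. -/
instance : Mul (Mp F) :=
  ⟨fun x y => ⟨x.mat * y.mat, x.sgn * y.sgn * kubota x.mat y.mat⟩⟩

/-- The topology of the metaplectic group: a basis of neighbourhoods of `g` is given by the sets
`{g · (u, 1) | u ∈ U}`, where `U` runs over the neighbourhoods of `1` in `SL₂(F)`. (The section
`u ↦ (u, 1)` is a homomorphism near `1`. This is not the product topology on `SL₂(F) × {±1}`,
because the Kubota cocycle is not continuous everywhere.) -/
instance : TopologicalSpace (Mp F) where
  IsOpen S := ∀ g ∈ S, ∃ U ∈ 𝓝 (1 : SL(2, F)), ∀ u ∈ U, g * ⟨u, 1⟩ ∈ S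
  isOpen_univ := fun _ _ => ⟨Set.univ, univ_mem, fun _ _ => trivial⟩
  isOpen_inter := by
    rintro S T hS hT g ⟨hgS, hgT⟩
    obtain ⟨U, hU, h⟩ := hS g hgS
    obtain ⟨V, hV, h'⟩ := hT g hgT
    exact ⟨U ∩ V, inter_mem hU hV, fun u hu => ⟨h u hu.1, h' u hu.2⟩⟩
  isOpen_sUnion := by
    rintro 𝒮 h𝒮 g ⟨S, hS, hg⟩
    obtain ⟨U, hU, h⟩ := h𝒮 S hS g hg
    exact ⟨U, hU, fun u hu => ⟨S, hS, h u hu⟩⟩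

/-- The compact open subgroup `K^ε_m` of `SL₂(F)`: the matrices with `a, d ∈ 𝒪`,
`b ∈ 𝔭 ^ (-ε)` and `c ∈ 𝔭 ^ (m + ε)`. -/
def K (ε : Fin 2) (m : ℕ) : Subgroup SL(2, F) where
  carrier := {g | g 0 0 ∈ fracIdeal (F := F) 0 ∧ g 0 1 ∈ fracIdeal (F := F) (-((ε : ℕ) : ℤ)) ∧
    g 1 0 ∈ fracIdeal (F := F) ((m : ℤ) + ((ε : ℕ) : ℤ)) ∧ g 1 1 ∈ fracIdeal (F := F) 0}
  one_mem' := by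
    simp [fracIdeal]
  mul_mem' := by
    rintro g h ⟨ga, gb, gc, gd⟩ ⟨ha, hb, hc, hd⟩
    have key : ∀ {x y z w : F} {i j k l n : ℤ}, x ∈ fracIdeal (F := F) i →
        y ∈ fracIdeal (F := F) j → z ∈ fracIdeal (F := F) k → w ∈ fracIdeal (F := F) l →
        n ≤ i + j → n ≤ k + l → x * y + z * w ∈ fracIdeal (F := F) n := by
      intro x y z w i j k l n hx hy hz hw h₁ h₂
      refine (val F).map_add_le ?_ ?_
      · rw [map_mul]
        refine (mul_le_mul' hx hy).trans ?_
        rw [← WithZero.exp_add, WithZero.exp_le_exp]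
        omega
      · rw [map_mul]
        refine (mul_le_mul' hz hw).trans ?_
        rw [← WithZero.exp_add, WithZero.exp_le_exp]
        omega
    have e : ∀ i j, (g * h) i j = g i 0 * h 0 j + g i 1 * h 1 j := fun i j => by
      exact (Matrix.mul_apply (M := g.val) (N := h.val)).trans (Fin.sum_univ_two _)
    refine ⟨?_, ?_, ?_, ?_⟩
    · exact Set.mem_of_eq_of_mem (e 0 0) (key ga ha gb hc (by omega) (by omega))
    · exact Set.mem_of_eq_of_mem (e 0 1) (key ga hb gb hd (by omega) (by omega))
    · exact Set.mem_of_eq_of_mem (e 1 0) (key gc ha gd hc (by omega) (by omega))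
    · exact Set.mem_of_eq_of_mem (e 1 1) (key gc hb gd hd (by omega) (by omega))
  inv_mem' := by
    rintro g ⟨ga, gb, gc, gd⟩
    have e := SpecialLinearGroup.SL2_inv_expl g
    have neg : ∀ {x : F} {i : ℤ}, x ∈ fracIdeal (F := F) i → -x ∈ fracIdeal (F := F) i := by
      intro x i hx
      simpa [fracIdeal, Valuation.map_neg] using hx
    rw [e]
    exact ⟨by simpa using gd, by simpa using neg gb, by simpa using neg gc, by simpa using ga⟩

/-- `k ↦ (k, s k)` is multiplicative on the subgroup `H`, i.e. it splits the covering over `H`. -/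
def IsSplitting (H : Subgroup SL(2, F)) (s : SL(2, F) → ℤˣ) : Prop :=
  ∀ k ∈ H, ∀ k' ∈ H, (⟨k, s k⟩ * ⟨k', s k'⟩ : Mp F) = ⟨k * k', s (k * k')⟩

open Classical in
/-- The function `𝐬^ε`, where `k ↦ (k, 𝐬^ε k)` is the unique splitting of the covering over the
maximal compact subgroup `K^ε = K^ε_0`. (Its values outside `K^ε` are irrelevant.) -/
def splitting (ε : Fin 2) : SL(2, F) → ℤˣ :=
  if h : ∃ s : SL(2, F) → ℤˣ, IsSplitting (K (F := F) ε 0) s then h.choose else 1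

/-! ## Principal series, isotypic subspaces, conductors -/

/-- Right translation on functions on the metaplectic group, `[R(g) f](x) = f(x g)`. -/
def rightTranslation (g : Mp F) : (Mp F → ℂ) →ₗ[ℂ] (Mp F → ℂ) where
  toFun f := fun x => f (x * g)
  map_add' _ _ := rfl
  map_smul' _ _ := rfl

/-- The genuine character `χ_ψ((t(a), e)) = e γ_F(a, ψ)⁻¹` of the preimage of the torus. -/
def chiPsi (ψ : AddChar F ℂ) (a : Fˣ) (e : ℤˣ) : ℂ :=
  ((e : ℤ) : ℂ) * (weilRatio (a : F) ψ)⁻¹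

/-- The space of the principal series representation `π_ψ(μ)`: the locally constant functions `f`
with `f((t(a), e) (n(b), 1) g) = |a| μ(a) χ_ψ((t(a), e)) f(g)`. The metaplectic group acts on it
by right translation. -/
def principalSeries (ψ : AddChar F ℂ) (μ : Fˣ →ₜ* ℂˣ) : Submodule ℂ (Mp F → ℂ) where
  carrier := {f | IsLocallyConstant f ∧ ∀ (a : Fˣ) (e : ℤˣ) (b : F) (g : Mp F),
    f (⟨torus a, e⟩ * ⟨unip b, 1⟩ * g) =
      (normAbs a : ℂ) * ((μ a : ℂˣ) : ℂ) * chiPsi ψ a e * f g}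
  zero_mem' := ⟨IsLocallyConstant.const 0, by simp⟩
  add_mem' := by
    rintro f f' ⟨h, e⟩ ⟨h', e'⟩
    exact ⟨h.add h', fun a s b g => by simp only [Pi.add_apply, e, e', mul_add]⟩
  smul_mem' := by
    rintro c f ⟨h, e⟩
    refine ⟨h.comp (c • ·), fun a s b g => ?_⟩
    simp only [Pi.smul_apply, smul_eq_mul, e]
    ring

/-- The space `V^{K^ε_m}_η` for a space `V` of functions on which the metaplectic group acts by
right translation: the vectors `v ∈ V` on which every `k ∈ K^ε_m` (seen in the metaplectic group
via the splitting) acts by `η(d)`, where `d` is the lower right entry of `k`, if `m ≥ c(η)`; and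
zero if `m < c(η)`. -/
def isotypic (V : Submodule ℂ (Mp F → ℂ)) (ε : Fin 2) (m : ℕ) (η : 𝒪[F]ˣ →ₜ* ℂˣ) :
    Submodule ℂ (Mp F → ℂ) :=
  if cond η ≤ m then
    V ⊓ ⨅ k ∈ K (F := F) ε m, LinearMap.ker
      (rightTranslation ⟨k, splitting ε k⟩ - evalUnit η (k 1 1) • LinearMap.id)
  else ⊥

open Classical in
/-- The element `-1_ψ = (-1, γ_F(-1, ψ))` of the metaplectic group; `γ_F(-1, ψ)` is a sign. -/
def negOne (ψ : AddChar F ℂ) : Mp F :=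
  ⟨-1, if weilRatio (-1) ψ = 1 then 1 else -1⟩

/-- The central sign of `V` with respect to `ψ` is `z`: the element `-1_ψ` acts on `V` by `z`. -/
def HasCentralSign (ψ : AddChar F ℂ) (V : Submodule ℂ (Mp F → ℂ)) (z : ℂ) : Prop :=
  ∀ f ∈ V, rightTranslation (negOne ψ) f = z • f

/-- The `η`-conductor `c^ε_η(V)`, the minimal `m` such that `V^{K^ε_m}_η` is nonzero
(`⊤` if there is none). -/
def condEta (V : Submodule ℂ (Mp F → ℂ)) (ε : Fin 2) (η : 𝒪[F]ˣ →ₜ* ℂˣ) : ℕ∞ :=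
  ⨅ (m : ℕ) (_ : isotypic V ε m η ≠ ⊥), (m : ℕ∞)

/-- The minimal conductor `c^ε_min(V)`, the minimum of the `η`-conductors where `η` runs over the
characters of `𝒪ˣ` such that `η(-1)` is the central sign of `V` with respect to `ψ = ψ^ε`. -/
def condMin (ψ : AddChar F ℂ) (V : Submodule ℂ (Mp F → ℂ)) (ε : Fin 2) : ℕ∞ :=
  ⨅ (η : 𝒪[F]ˣ →ₜ* ℂˣ) (_ : HasCentralSign ψ V ((η (-1) : ℂˣ) : ℂ)), condEta V ε η

end Group

end Metaplectic

end

/-! The covering group can be removed, after which the theorem is a count of double cosets.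

Put G(a) = γ_F(ψ_a). Reducing the defining integrals to the residue field (`quadIntegral_shrink`,
`weilIndex_of_even`, `weilIndex_of_odd`) shows that G ignores squares, is 1 when ord a + ε is even,
changes sign under nonsquare units otherwise, and satisfies G(a)G(-a) = 1. These facts
(`isWeilFunction_weilIndex`) are all that is needed about ψ. They yield (a, b)₂ = G(a)G(b) /
(G(1)G(ab)) (`mul_eq_hilbert`), hence a formula for the Kubota cocycle in terms of G (`kubota_eq`).
The function `cochain` then makes the cocycle a coboundary on all pairs (g, k) with k in K^ε_0
(`kubota_mul_cochain`). By uniqueness it restricts to the splitting on K^ε_0, and it also absorbs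
the factor γ_F(a, ψ)⁻¹ of the torus (`genuineSign_torus_unip`). So the isotypic space becomes the
space of functions on SL₂(F) with θ(t(a)n(b)gk) = |a|μ(a)η(d)θ(g) (`isotypicEquiv`).

A double coset of the Borel subgroup and K_m is an orbit of K_m on bottom rows up to scalars. For m
> 0 these are represented by rows (x, 1): one with ord x = ε, one with x = 0, and for each 0 < i < m
two with ord x = ε + i, told apart by the square class of x (`exists_representatives`). An orbit
contributes one dimension if its stabilizer acts trivially and none otherwise. Stabilizer elements
give units u with u ≡ u⁻¹ modulo 𝔭^min(i, m-i), so u ≡ ±1 there, and triviality becomes c(η) ≤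
max(i, m-i) together with c(ημ) ≤ m-i if 2i ≥ m, or c(ημ⁻¹) ≤ i if 2i ≤ m (`orbitRel_self_iff`,
`stabilizerTrivial_iff`). The dimension is twice the number of admissible i in [0, m], less one for
each admissible endpoint; `card_admissible` evaluates this. The statements on conductors are read
off at m = c(μ). -/

namespace Metaplectic

/-! ### Orders, fractional ideals and Hensel's lemma. -/

section Valuation

variable {F : Type*} [Field F] [ValuativeRel F] [TopologicalSpace F]
  [IsNonarchimedeanLocalField F]

/-- The additive normalized valuation; its value at `0` is `0`. -/
noncomputable def ord (x : F) : ℤ := -WithZero.log (val F x)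

lemma val_eq_iso (x : F) : val F x = valueGroupWithZeroIsoInt F (valuation F x) := rfl

lemma val_surjective : Function.Surjective (val F) := by
  intro y
  obtain ⟨x, hx⟩ := valuation_surjective ((valueGroupWithZeroIsoInt F).symm y)
  exact ⟨x, by rw [val_eq_iso, hx]; simp⟩

lemma val_ne_zero {x : F} (hx : x ≠ 0) : val F x ≠ 0 := (val F).ne_zero_iff.mpr hx

lemma val_eq_exp {x : F} (hx : x ≠ 0) : val F x = WithZero.exp (-ord x) := by
  rw [ord, neg_neg, WithZero.exp_log (val_ne_zero hx)]

lemma mem_fracIdeal {x : F} {n : ℤ} : x ∈ fracIdeal n ↔ val F x ≤ WithZero.exp (-n) := Iff.rfl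

lemma mem_fracIdeal_iff {x : F} {n : ℤ} : x ∈ fracIdeal n ↔ x = 0 ∨ n ≤ ord x := by
  by_cases hx : x = 0
  · simp [mem_fracIdeal, hx]
  · rw [mem_fracIdeal, val_eq_exp hx, WithZero.exp_le_exp]
    simp [hx]

lemma mem_fracIdeal_of_le {x : F} {n : ℤ} (h : n ≤ ord x) : x ∈ fracIdeal n :=
  mem_fracIdeal_iff.mpr (Or.inr h)

lemma le_ord_of_mem {x : F} {n : ℤ} (hx : x ≠ 0) (h : x ∈ fracIdeal n) : n ≤ ord x :=
  (mem_fracIdeal_iff.mp h).resolve_left hx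

lemma mem_fracIdeal_iff_of_ne {x : F} {n : ℤ} (hx : x ≠ 0) : x ∈ fracIdeal n ↔ n ≤ ord x :=
  ⟨le_ord_of_mem hx, mem_fracIdeal_of_le⟩

lemma zero_mem_fracIdeal (n : ℤ) : (0 : F) ∈ fracIdeal n := mem_fracIdeal_iff.mpr (Or.inl rfl)

lemma fracIdeal_add {x y : F} {n : ℤ} (hx : x ∈ fracIdeal n) (hy : y ∈ fracIdeal n) :
    x + y ∈ fracIdeal n := (val F).map_add_le hx hy

lemma fracIdeal_neg {x : F} {n : ℤ} (hx : x ∈ fracIdeal n) : -x ∈ fracIdeal n := by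
  rwa [mem_fracIdeal, Valuation.map_neg]

lemma fracIdeal_sub {x y : F} {n : ℤ} (hx : x ∈ fracIdeal n) (hy : y ∈ fracIdeal n) :
    x - y ∈ fracIdeal n := by
  rw [sub_eq_add_neg]; exact fracIdeal_add hx (fracIdeal_neg hy)

lemma fracIdeal_mono {x : F} {m n : ℤ} (h : n ≤ m) (hx : x ∈ fracIdeal m) : x ∈ fracIdeal n :=
  le_trans (mem_fracIdeal.mp hx) (WithZero.exp_le_exp.mpr (by omega))

lemma fracIdeal_mul {x y : F} {m n k : ℤ} (hx : x ∈ fracIdeal m) (hy : y ∈ fracIdeal n)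
    (h : k ≤ m + n) : x * y ∈ fracIdeal k := by
  rw [mem_fracIdeal, map_mul]
  refine (mul_le_mul' hx hy).trans ?_
  rw [← WithZero.exp_add, WithZero.exp_le_exp]
  omega

@[simp] lemma ord_one : ord (1 : F) = 0 := by simp [ord]

lemma ord_mul {x y : F} (hx : x ≠ 0) (hy : y ≠ 0) : ord (x * y) = ord x + ord y := by
  rw [ord, map_mul, WithZero.log_mul (val_ne_zero hx) (val_ne_zero hy), ord, ord]; ring

lemma ord_inv (x : F) : ord x⁻¹ = -ord x := by
  rw [ord, map_inv₀, WithZero.log_inv, ord]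

lemma ord_div {x y : F} (hx : x ≠ 0) (hy : y ≠ 0) : ord (x / y) = ord x - ord y := by
  rw [div_eq_mul_inv, ord_mul hx (inv_ne_zero hy), ord_inv, sub_eq_add_neg]

@[simp] lemma ord_neg (x : F) : ord (-x) = ord x := by rw [ord, Valuation.map_neg, ord]

lemma ord_pow (x : F) (n : ℕ) : ord (x ^ n) = n * ord x := by
  rw [ord, map_pow, WithZero.log_pow, ord, nsmul_eq_mul]; ring

lemma ord_eq_of_mem {x : F} {n : ℤ} (h : x ∈ fracIdeal n) (h' : x ∉ fracIdeal (n + 1)) :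
    x ≠ 0 ∧ ord x = n := by
  have hx : x ≠ 0 := by rintro rfl; exact h' (zero_mem_fracIdeal _)
  rw [mem_fracIdeal_iff_of_ne hx] at h h'
  exact ⟨hx, by omega⟩

/-- Adding an element of larger order does not change the order. -/
lemma ord_add_of_mem {x y : F} (hx : x ≠ 0) (hy : y ∈ fracIdeal (ord x + 1)) :
    x + y ≠ 0 ∧ ord (x + y) = ord x := by
  refine ord_eq_of_mem (fracIdeal_add (mem_fracIdeal_of_le le_rfl)
    (fracIdeal_mono (by omega) hy)) fun h => ?_
  have := le_ord_of_mem hx (by simpa using fracIdeal_sub h hy)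
  omega

lemma ord_one_add {y : F} (hy : y ∈ fracIdeal 1) : 1 + y ≠ 0 ∧ ord (1 + y) = 0 := by
  have := ord_add_of_mem (one_ne_zero (α := F)) (y := y) (by simpa using hy)
  simpa using this

lemma exists_ord_eq (n : ℤ) : ∃ x : F, x ≠ 0 ∧ ord x = n := by
  obtain ⟨x, hx⟩ := val_surjective (F := F) (WithZero.exp (-n))
  refine ⟨x, fun h => ?_, ?_⟩
  · rw [h, map_zero] at hx
    exact WithZero.exp_ne_zero hx.symm
  · rw [ord, hx, WithZero.log_exp, neg_neg]

lemma fracIdeal_smul {a : F} (ha : a ≠ 0) (n : ℤ) {x : F} :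
    a * x ∈ fracIdeal (n + ord a) ↔ x ∈ fracIdeal n := by
  by_cases hx : x = 0
  · simp [hx, zero_mem_fracIdeal]
  · rw [mem_fracIdeal_iff_of_ne (mul_ne_zero ha hx), mem_fracIdeal_iff_of_ne hx, ord_mul ha hx]
    omega

/-! ### The ring of integers -/

lemma mem_integer_iff {x : F} : x ∈ 𝒪[F] ↔ x ∈ fracIdeal 0 := by
  rw [mem_fracIdeal, neg_zero, WithZero.exp_zero, val_eq_iso, Valuation.mem_integer_iff,
    ← map_one (valueGroupWithZeroIsoInt F), (valueGroupWithZeroIsoInt F).strictMono.le_iff_le]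

lemma isUnit_integer_iff {x : 𝒪[F]} : IsUnit x ↔ (x : F) ≠ 0 ∧ ord (x : F) = 0 := by
  rw [(Valuation.integer.integers (valuation F)).isUnit_iff_valuation_eq_one]
  change valuation F (x : F) = 1 ↔ _
  rw [← (valueGroupWithZeroIsoInt F).strictMono.injective.eq_iff, map_one, ← val_eq_iso]
  constructor
  · intro h
    have hx : (x : F) ≠ 0 := by
      intro h0; rw [h0, map_zero] at h; exact zero_ne_one h
    exact ⟨hx, by rw [ord, h, WithZero.log_one, neg_zero]⟩
  · rintro ⟨hx, h⟩
    rw [val_eq_exp hx, h, neg_zero, WithZero.exp_zero]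

lemma unit_ne_zero (u : 𝒪[F]ˣ) : ((u : 𝒪[F]) : F) ≠ 0 := (isUnit_integer_iff.mp u.isUnit).1

lemma ord_unit (u : 𝒪[F]ˣ) : ord ((u : 𝒪[F]) : F) = 0 := (isUnit_integer_iff.mp u.isUnit).2

lemma exists_unit {x : F} (hx : x ≠ 0) (h : ord x = 0) : ∃ u : 𝒪[F]ˣ, ((u : 𝒪[F]) : F) = x := by
  have hm : x ∈ 𝒪[F] := mem_integer_iff.mpr (mem_fracIdeal_of_le h.ge)
  have : IsUnit (⟨x, hm⟩ : 𝒪[F]) := isUnit_integer_iff.mpr ⟨hx, h⟩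
  exact ⟨this.unit, rfl⟩

lemma mem_maximalIdeal_iff {x : 𝒪[F]} : x ∈ 𝓂[F] ↔ (x : F) ∈ fracIdeal 1 := by
  rw [IsLocalRing.mem_maximalIdeal, mem_nonunits_iff, isUnit_integer_iff]
  have hx := mem_integer_iff.mp x.2
  by_cases h0 : (x : F) = 0
  · simp [h0, zero_mem_fracIdeal]
  · rw [mem_fracIdeal_iff_of_ne h0] at hx ⊢
    simp only [ne_eq, h0, not_false_eq_true, true_and]
    omega

lemma mem_maximalIdeal_pow_iff {x : 𝒪[F]} {n : ℕ} :
    x ∈ 𝓂[F] ^ n ↔ (x : F) ∈ fracIdeal n := by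
  obtain ⟨p, hp, hp1⟩ := exists_ord_eq (F := F) 1
  have hpm : p ∈ 𝒪[F] := mem_integer_iff.mpr (mem_fracIdeal_of_le (by omega))
  have dvd : ∀ (k : ℕ) (y : 𝒪[F]), (⟨p, hpm⟩ : 𝒪[F]) ^ k ∣ y ↔ (y : F) ∈ fracIdeal k := by
    intro k y
    have hk := fracIdeal_smul (pow_ne_zero k hp) 0 (x := p⁻¹ ^ k * y)
    rw [ord_pow, hp1, mul_one, zero_add, ← mul_assoc, ← mul_pow, mul_inv_cancel₀ hp, one_pow,
      one_mul] at hk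
    rw [hk]
    constructor
    · rintro ⟨z, rfl⟩
      have e : p⁻¹ ^ k * ((⟨p, hpm⟩ ^ k * z : 𝒪[F]) : F) = z := by
        rw [Subring.coe_mul, Subring.coe_pow, ← mul_assoc, ← mul_pow, inv_mul_cancel₀ hp, one_pow,
          one_mul]
      rw [e]
      exact mem_integer_iff.mp z.2
    · intro h
      refine ⟨⟨_, mem_integer_iff.mpr h⟩, Subtype.ext ?_⟩
      rw [Subring.coe_mul, Subring.coe_pow, ← mul_assoc, ← mul_pow, mul_inv_cancel₀ hp, one_pow,
        one_mul]
  have : 𝓂[F] = Ideal.span {(⟨p, hpm⟩ : 𝒪[F])} := by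
    ext y
    rw [Ideal.mem_span_singleton, mem_maximalIdeal_iff]
    simpa using (dvd 1 y).symm
  rw [this, Ideal.span_singleton_pow, Ideal.mem_span_singleton, dvd]

/-! ### Residue field and squares -/

lemma ord_two (hp : ringChar 𝓀[F] ≠ 2) : (2 : F) ≠ 0 ∧ ord (2 : F) = 0 := by
  have h2 : IsUnit (2 : 𝒪[F]) := by
    by_contra h
    have h' : (2 : 𝒪[F]) ∈ 𝓂[F] := (IsLocalRing.mem_maximalIdeal _).mpr h
    have h3 : IsLocalRing.residue 𝒪[F] 2 = 0 := (IsLocalRing.residue_eq_zero_iff _).mpr h'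
    rw [map_ofNat] at h3
    exact Ring.two_ne_zero hp h3
  exact isUnit_integer_iff.mp h2

/-- A unit which is a square modulo `𝔭` is a square. -/
lemma exists_sq_of_sub_mem (hp : ringChar 𝓀[F] ≠ 2) {u t : F} (ht : t ≠ 0) (ht0 : ord t = 0)
    (h : u - t ^ 2 ∈ fracIdeal 1) : ∃ s : F, s ^ 2 = u ∧ s - t ∈ fracIdeal 1 := by
  let := IsTopologicalAddGroup.rightUniformSpace F
  have := isUniformAddGroup_of_addCommGroup (G := F)
  have htm : t ∈ 𝒪[F] := mem_integer_iff.mpr (mem_fracIdeal_of_le ht0.ge)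
  have hum : u ∈ 𝒪[F] := by
    refine mem_integer_iff.mpr ?_
    have : u = (u - t ^ 2) + t ^ 2 := by ring
    rw [this]
    refine fracIdeal_add (fracIdeal_mono (by omega) h) (mem_fracIdeal_of_le ?_)
    rw [ord_pow, ht0, mul_zero]
  have hH : HenselianRing 𝒪[F] 𝓂[F] := inferInstance
  obtain ⟨a, ha, ha'⟩ := hH.is_henselian (Polynomial.X ^ 2 - Polynomial.C ⟨u, hum⟩)
    (Polynomial.monic_X_pow_sub_C _ two_ne_zero) ⟨t, htm⟩
    (by
      rw [mem_maximalIdeal_iff]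
      simpa using fracIdeal_neg h)
    (by
      -- The derivative 2t of X² - u at t is a unit because the residual characteristic is odd.
      refine IsUnit.map _ (isUnit_integer_iff.mpr ?_)
      have h2 := ord_two hp
      simp only [Polynomial.derivative_sub, Polynomial.derivative_X_pow, Polynomial.derivative_C]
      simp only [Nat.cast_ofNat, Nat.add_one_sub_one, pow_one, sub_zero, Polynomial.eval_mul,
        Polynomial.eval_X, Subring.coe_mul]
      have e : ((Polynomial.eval (⟨t, htm⟩ : 𝒪[F]) (Polynomial.C 2) : 𝒪[F]) : F) = 2 := by
        rw [Polynomial.eval_C]; rfl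
      rw [e]
      exact ⟨mul_ne_zero h2.1 ht, by rw [ord_mul h2.1 ht, h2.2, ht0, add_zero]⟩)
  refine ⟨a, ?_, mem_maximalIdeal_iff.mp ha'⟩
  have := congrArg (Subtype.val) (show a ^ 2 - ⟨u, hum⟩ = 0 by simpa [Polynomial.IsRoot] using ha)
  simpa [sub_eq_zero] using this

/-- Hensel's lemma lifts the root 1 of X² modulo 𝔭. Consequently every square-invariant function
depends only on leading terms. -/
lemma isSquare_one_add (hp : ringChar 𝓀[F] ≠ 2) {y : F} (hy : y ∈ fracIdeal 1) :
    ∃ s : F, s ≠ 0 ∧ ord s = 0 ∧ s ^ 2 = 1 + y := by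
  obtain ⟨s, hs, hs'⟩ := exists_sq_of_sub_mem hp (u := 1 + y) one_ne_zero ord_one
    (by simpa using hy)
  have := ord_one_add hs'
  rw [add_sub_cancel] at this
  exact ⟨s, this.1, this.2, hs⟩

end Valuation

/-! ### Square classes of units and binary forms with unit coefficients. -/

section Squares

variable {F : Type*} [Field F] [ValuativeRel F] [TopologicalSpace F]
  [IsNonarchimedeanLocalField F]

lemma isSquare_unit_iff (hp : ringChar 𝓀[F] ≠ 2) (u : 𝒪[F]ˣ) :
    IsSquare ((u : 𝒪[F]) : F) ↔ IsSquare (IsLocalRing.residue 𝒪[F] (u : 𝒪[F])) := by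
  constructor
  · rintro ⟨s, hs⟩
    have hu := unit_ne_zero u
    have hs0 : s ≠ 0 := by rintro rfl; simp at hs
    have := ord_unit u
    rw [hs, ord_mul hs0 hs0] at this
    obtain ⟨t, rfl⟩ := exists_unit hs0 (by omega)
    have e : (u : 𝒪[F]) = (t : 𝒪[F]) * (t : 𝒪[F]) := Subtype.ext (by simpa using hs)
    exact ⟨IsLocalRing.residue 𝒪[F] t, by rw [e, map_mul]⟩
  · rintro ⟨r, hr⟩
    obtain ⟨t, rfl⟩ := IsLocalRing.residue_surjective r
    rw [← map_mul, ← sub_eq_zero, ← map_sub, IsLocalRing.residue_eq_zero_iff,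
      mem_maximalIdeal_iff] at hr
    have htu : (t : F) ≠ 0 ∧ ord (t : F) = 0 := by
      have hm := mem_integer_iff.mp t.2
      by_cases h : (t : F) ∈ fracIdeal 1
      · exfalso
        have h2 : ((u : 𝒪[F]) : F) ∈ fracIdeal 1 := by
          have e : ((u : 𝒪[F]) : F) = (((u : 𝒪[F]) - t * t : 𝒪[F]) : F) + t * t := by simp
          rw [e]
          exact fracIdeal_add hr (fracIdeal_mul h hm (by omega))
        have := le_ord_of_mem (unit_ne_zero u) h2
        rw [ord_unit] at this
        omega
      · exact ord_eq_of_mem hm (by simpa using h)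
    obtain ⟨s, hs, -⟩ := exists_sq_of_sub_mem hp htu.1 htu.2 (u := ((u : 𝒪[F]) : F))
      (by simpa [sq] using hr)
    exact ⟨s, by rw [← hs, sq]⟩

/-- The product of two non-square units is a square. -/
lemma isSquare_mul_of_not_isSquare (hp : ringChar 𝓀[F] ≠ 2) {u v : F} (hu : u ≠ 0)
    (hu0 : ord u = 0) (hv : v ≠ 0) (hv0 : ord v = 0) (h : ¬ IsSquare u) (h' : ¬ IsSquare v) :
    IsSquare (u * v) := by
  classical
  have := Fintype.ofFinite 𝓀[F]
  obtain ⟨u, rfl⟩ := exists_unit hu hu0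
  obtain ⟨v, rfl⟩ := exists_unit hv hv0
  have e : ((u : 𝒪[F]) : F) * ((v : 𝒪[F]) : F) = (((u * v : 𝒪[F]ˣ) : 𝒪[F]) : F) := by simp
  rw [e, isSquare_unit_iff hp]
  rw [isSquare_unit_iff hp] at h h'
  have n : ∀ w : 𝒪[F]ˣ, IsLocalRing.residue 𝒪[F] (w : 𝒪[F]) ≠ 0 := fun w =>
    (w.isUnit.map (IsLocalRing.residue 𝒪[F])).ne_zero
  rw [← quadraticChar_one_iff_isSquare (n _)]
  rw [← quadraticChar_neg_one_iff_not_isSquare] at h h'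
  rw [Units.val_mul, map_mul, map_mul, h, h']
  norm_num

lemma exists_unit_not_isSquare (hp : ringChar 𝓀[F] ≠ 2) :
    ∃ u : F, u ≠ 0 ∧ ord u = 0 ∧ ¬ IsSquare u := by
  obtain ⟨r, hr⟩ := FiniteField.exists_nonsquare hp
  obtain ⟨t, rfl⟩ := IsLocalRing.residue_surjective r
  have ht : IsUnit t := by
    by_contra h
    have h' : t ∈ 𝓂[F] := (IsLocalRing.mem_maximalIdeal _).mpr h
    rw [(IsLocalRing.residue_eq_zero_iff _).mpr h'] at hr
    exact hr (IsSquare.zero)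
  have h := isUnit_integer_iff.mp ht
  refine ⟨t, h.1, h.2, fun h' => hr ?_⟩
  obtain ⟨u, rfl⟩ := ht
  exact (isSquare_unit_iff hp u).mp h'

/-- A binary quadratic form with unit coefficients represents `1`. -/
lemma exists_sq_eq_add (hp : ringChar 𝓀[F] ≠ 2) {a b : F} (ha : a ≠ 0)
    (ha0 : ord a = 0) (hb : b ≠ 0) (hb0 : ord b = 0) :
    ∃ x y z : F, z ≠ 0 ∧ z ^ 2 = a * x ^ 2 + b * y ^ 2 := by
  classical
  have := Fintype.ofFinite 𝓀[F]
  obtain ⟨a, rfl⟩ := exists_unit ha ha0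
  obtain ⟨b, rfl⟩ := exists_unit hb hb0
  have n : ∀ w : 𝒪[F]ˣ, IsLocalRing.residue 𝒪[F] (w : 𝒪[F]) ≠ 0 := fun w =>
    (w.isUnit.map (IsLocalRing.residue 𝒪[F])).ne_zero
  set α := IsLocalRing.residue 𝒪[F] (a : 𝒪[F])
  set β := IsLocalRing.residue 𝒪[F] (b : 𝒪[F])
  have hα : α ≠ 0 := n a
  have hβ : β ≠ 0 := n b
  -- The equation αx² + βy² = 1 is solvable over the residue field. Any lift makes ax² + by² a
  -- principal unit, which is a square.
  obtain ⟨x, y, hxy⟩ := FiniteField.exists_root_sum_quadratic (R := 𝓀[F])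
    (f := Polynomial.C α * Polynomial.X ^ 2) (g := Polynomial.C β * Polynomial.X ^ 2
      - Polynomial.C 1)
    (by rw [Polynomial.degree_C_mul hα, Polynomial.degree_X_pow]; rfl)
    (by
      rw [Polynomial.degree_sub_C, Polynomial.degree_C_mul hβ, Polynomial.degree_X_pow]
      · rfl
      · rw [Polynomial.degree_C_mul hβ, Polynomial.degree_X_pow]; norm_num)
    (FiniteField.odd_card_of_char_ne_two hp)
  obtain ⟨x, rfl⟩ := IsLocalRing.residue_surjective x
  obtain ⟨y, rfl⟩ := IsLocalRing.residue_surjective y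
  have h : (a : 𝒪[F]) * x ^ 2 + b * y ^ 2 - 1 ∈ 𝓂[F] := by
    rw [← IsLocalRing.residue_eq_zero_iff]
    simp only [map_sub, map_add, map_mul, map_pow, map_one]
    simp only [Polynomial.eval_sub, Polynomial.eval_mul, Polynomial.eval_C, Polynomial.eval_pow,
      Polynomial.eval_X] at hxy
    rw [← hxy]; ring
  obtain ⟨s, hs, -, hs'⟩ := isSquare_one_add hp (mem_maximalIdeal_iff.mp h)
  refine ⟨x, y, s, hs, ?_⟩
  rw [hs']
  simp

end Squares

/-! ### Topology of the ideals 𝔭ⁿ and continuity of characters. -/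

section Topology

variable {F : Type*} [Field F] [ValuativeRel F] [TopologicalSpace F]
  [IsNonarchimedeanLocalField F]

lemma isCompact_fracIdeal (n : ℤ) : IsCompact (fracIdeal (F := F) n) := by
  have := isCompact_closedBall F ((valueGroupWithZeroIsoInt F).symm (WithZero.exp (-n)))
  convert this using 1
  ext x
  rw [mem_fracIdeal, val_eq_iso, Set.mem_ofPred_eq,
    ← (valueGroupWithZeroIsoInt F).strictMono.le_iff_le]
  simp

lemma fracIdeal_mem_nhds (n : ℤ) : fracIdeal (F := F) n ∈ 𝓝 0 := by
  rw [(IsValuativeTopology.hasBasis_nhds_zero' F).mem_iff]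
  refine ⟨(valueGroupWithZeroIsoInt F).symm (WithZero.exp (-n)), ?_, fun x hx => ?_⟩
  · simp
  · rw [Set.mem_ofPred_eq, ← (valueGroupWithZeroIsoInt F).strictMono.lt_iff_lt] at hx
    rw [mem_fracIdeal, val_eq_iso]
    simpa using hx.le

lemma exists_fracIdeal_subset {U : Set F} (hU : U ∈ 𝓝 0) : ∃ n : ℕ, fracIdeal (n : ℤ) ⊆ U := by
  rw [(IsValuativeTopology.hasBasis_nhds_zero' F).mem_iff] at hU
  obtain ⟨γ, hγ, h⟩ := hU
  obtain ⟨n, hn⟩ := WithZero.exists_exp_neg_natCast_lt (x := valueGroupWithZeroIsoInt F γ)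
    (by simpa using hγ)
  refine ⟨n, fun x hx => h ?_⟩
  rw [Set.mem_ofPred_eq, ← (valueGroupWithZeroIsoInt F).strictMono.lt_iff_lt]
  exact lt_of_le_of_lt (mem_fracIdeal.mp hx) hn

lemma isOpen_fracIdeal (n : ℤ) : IsOpen (fracIdeal (F := F) n) := by
  rw [isOpen_iff_mem_nhds]
  intro x hx
  have h : (fun y => y - x) ⁻¹' fracIdeal (F := F) n ∈ 𝓝 x := by
    refine ContinuousAt.preimage_mem_nhds (by fun_prop) ?_
    rw [sub_self]
    exact fracIdeal_mem_nhds n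
  refine mem_of_superset h fun y hy => ?_
  simpa using fracIdeal_add hy hx

/-- A complex number all of whose powers are close to `1` is `1`. -/
lemma eq_one_of_norm_pow_sub_one_le {z : ℂ} (h : ∀ n : ℕ, ‖z ^ n - 1‖ ≤ 1 / 2) : z = 1 := by
  by_contra hz
  have hpos : 0 < ‖z - 1‖ := norm_pos_iff.mpr (sub_ne_zero.mpr hz)
  -- Squaring multiplies the distance to 1 by at least 3/2 as long as that distance is at most 1/2.
  have key : ∀ k : ℕ, (3 / 2 : ℝ) ^ k * ‖z - 1‖ ≤ ‖z ^ (2 ^ k) - 1‖ := by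
    intro k
    induction k with
    | zero => simp
    | succ k ih =>
      have e : z ^ (2 ^ (k + 1)) - 1 = (z ^ (2 ^ k) - 1) * (2 + (z ^ (2 ^ k) - 1)) := by ring
      have h2 : (3 / 2 : ℝ) ≤ ‖2 + (z ^ (2 ^ k) - 1)‖ := by
        have := norm_sub_norm_le (2 : ℂ) (-(z ^ (2 ^ k) - 1))
        rw [norm_neg, sub_neg_eq_add] at this
        have h3 := h (2 ^ k)
        have h4 : ‖(2 : ℂ)‖ = 2 := by simp
        linarith
      rw [e, norm_mul, pow_succ]
      nlinarith [norm_nonneg (z ^ (2 ^ k) - 1)]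
  obtain ⟨k, hk⟩ := pow_unbounded_of_one_lt (1 / ‖z - 1‖) (by norm_num : (1 : ℝ) < 3 / 2)
  have := (div_lt_iff₀ hpos).mp hk
  have := key k
  have := h (2 ^ k)
  linarith

/-- ℂˣ has no small subgroups: for large c all powers of u are mapped close to 1, so
`eq_one_of_norm_pow_sub_one_le` applies. This guarantees that the infimum in `cond` is taken over a
nonempty set. -/
lemma exists_trivial_on (η : 𝒪[F]ˣ →ₜ* ℂˣ) :
    ∃ c : ℕ, ∀ u : 𝒪[F]ˣ, (u : 𝒪[F]) - 1 ∈ 𝓂[F] ^ c → η u = 1 := by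
  have hU : (fun u : 𝒪[F]ˣ => ((η u : ℂˣ) : ℂ)) ⁻¹' Metric.closedBall 1 (1 / 2) ∈
      𝓝 (1 : 𝒪[F]ˣ) := by
    have hc : Continuous fun u : 𝒪[F]ˣ => ((η u : ℂˣ) : ℂ) :=
      Units.continuous_val.comp η.continuous_toFun
    refine hc.continuousAt.preimage_mem_nhds ?_
    rw [map_one, Units.val_one]
    exact Metric.closedBall_mem_nhds _ (by norm_num)
  rw [nhds_induced, Filter.mem_comap] at hU
  obtain ⟨W, hW, hWU⟩ := hU
  rw [map_one, ← Prod.mk_one_one, nhds_prod_eq, Filter.mem_prod_iff] at hW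
  obtain ⟨A, hA, B, hB, hAB⟩ := hW
  have nb : ∀ A ∈ 𝓝 (1 : 𝒪[F]), ∃ n : ℕ, ∀ x : 𝒪[F], (x : F) - 1 ∈ fracIdeal n → x ∈ A := by
    intro A hA
    rw [nhds_subtype, Filter.mem_comap] at hA
    obtain ⟨A', hA', h⟩ := hA
    have h0 : (fun y : F => y + 1) ⁻¹' A' ∈ 𝓝 0 :=
      ContinuousAt.preimage_mem_nhds (by fun_prop) (by simpa using hA')
    obtain ⟨n, hn⟩ := exists_fracIdeal_subset h0
    exact ⟨n, fun x hx => h (by simpa using hn hx)⟩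
  obtain ⟨n₁, h₁⟩ := nb A hA
  obtain ⟨n₂, h₂⟩ := nb (MulOpposite.op ⁻¹' B)
    (MulOpposite.continuous_op.continuousAt.preimage_mem_nhds hB)
  refine ⟨max n₁ n₂, fun u hu => ?_⟩
  have mem : ∀ w : 𝒪[F]ˣ, (w : 𝒪[F]) - 1 ∈ 𝓂[F] ^ max n₁ n₂ →
      ‖((η w : ℂˣ) : ℂ) - 1‖ ≤ 1 / 2 := by
    intro w hw
    -- The topology of 𝒪ˣ also controls inverses, so w⁻¹ has to be close to 1 as well.
    have hw' : ((w⁻¹ : 𝒪[F]ˣ) : 𝒪[F]) - 1 ∈ 𝓂[F] ^ max n₁ n₂ := by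
      have e : ((w⁻¹ : 𝒪[F]ˣ) : 𝒪[F]) - 1 = -((w⁻¹ : 𝒪[F]ˣ) : 𝒪[F]) * ((w : 𝒪[F]) - 1) := by
        rw [mul_sub, neg_mul, Units.inv_mul]; ring
      rw [e]
      exact Ideal.mul_mem_left _ _ hw
    rw [mem_maximalIdeal_pow_iff] at hw hw'
    have : w ∈ (fun u : 𝒪[F]ˣ => ((η u : ℂˣ) : ℂ)) ⁻¹' Metric.closedBall 1 (1 / 2) := by
      refine hWU (hAB ⟨h₁ _ (fracIdeal_mono (by simp) hw), h₂ _ (fracIdeal_mono (by simp) hw')⟩)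
    simpa [dist_eq_norm] using this
  have : ((η u : ℂˣ) : ℂ) = 1 := by
    refine eq_one_of_norm_pow_sub_one_le fun n => ?_
    rw [← Units.val_pow_eq_pow_val, ← map_pow]
    refine mem _ ?_
    rw [Units.val_pow_eq_pow_val]
    obtain ⟨d, hd⟩ := sub_dvd_pow_sub_pow (u : 𝒪[F]) 1 n
    rw [one_pow] at hd
    rw [hd]
    exact Ideal.mul_mem_right _ _ hu
  exact Units.ext this

end Topology

/-! ### Elementary properties of the Hilbert symbol. -/

section Hilbert

variable {F : Type*} [Field F]

lemma hilbert_eq_one_iff {a b : F} : hilbert a b = 1 ↔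
    ∃ x y z : F, (x, y, z) ≠ (0, 0, 0) ∧ z ^ 2 = a * x ^ 2 + b * y ^ 2 := by
  unfold hilbert
  split_ifs with h
  · simpa using h
  · simpa using h

lemma hilbert_eq_neg_one_of_ne {a b : F} (h : hilbert a b ≠ 1) : hilbert a b = -1 :=
  (Int.units_eq_one_or _).resolve_left h

lemma hilbert_symm (a b : F) : hilbert a b = hilbert b a := by
  unfold hilbert
  congr 1
  refine propext ⟨?_, ?_⟩ <;>
  · rintro ⟨x, y, z, h, e⟩
    refine ⟨y, x, z, fun h' => h ?_, by rw [e, add_comm]⟩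
    simp only [Prod.mk.injEq] at h' ⊢
    tauto

lemma hilbert_of_isSquare {a s : F} (h : a = s ^ 2) (b : F) : hilbert a b = 1 :=
  hilbert_eq_one_iff.mpr ⟨1, 0, s, by simp, by rw [h]; ring⟩

/-- Multiplying an argument by a square does not change the Hilbert symbol. -/
lemma hilbert_mul_sq {s : F} (hs : s ≠ 0) (a b : F) : hilbert (a * s ^ 2) b = hilbert a b := by
  unfold hilbert
  congr 1
  refine propext ⟨?_, ?_⟩
  · rintro ⟨x, y, z, h, e⟩
    refine ⟨s * x, y, z, fun h' => h ?_, by rw [e]; ring⟩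
    simpa [hs] using h'
  · rintro ⟨x, y, z, h, e⟩
    refine ⟨s⁻¹ * x, y, z, fun h' => h ?_, by rw [e]; field_simp⟩
    simpa [hs] using h'

/-- A solution of z² = ax² + by² gives (ax)² = az² - ab·y². This stands in for bimultiplicativity
when two arguments of odd order have to be replaced by a pair with one of even order. -/
lemma hilbert_neg_mul {a b : F} (ha : a ≠ 0) : hilbert a (-(a * b)) = hilbert a b := by
  have key : ∀ {b : F}, hilbert a b = 1 → hilbert a (-(a * b)) = 1 := by
    intro b h
    rw [hilbert_eq_one_iff] at h ⊢
    obtain ⟨x, y, z, h, e⟩ := h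
    refine ⟨z, y, a * x, fun h' => h ?_, by linear_combination (-a) * e⟩
    simp only [Prod.mk.injEq, mul_eq_zero, ha, false_or] at h' ⊢
    tauto
  have h2 : hilbert a (-(a * -(a * b))) = hilbert a b := by
    rw [hilbert_symm, show -(a * -(a * b)) = b * a ^ 2 by ring, hilbert_mul_sq ha, hilbert_symm]
  by_cases h : hilbert a b = 1
  · rw [h, key h]
  · rw [hilbert_eq_neg_one_of_ne h]
    refine hilbert_eq_neg_one_of_ne fun h' => h ?_
    rw [← h2, key h']

end Hilbert

/-! ### Weil indices as a function of a, and their relation to the Hilbert symbol. -/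

section WeilFunction

variable {F : Type*} [Field F] [ValuativeRel F] [TopologicalSpace F]
  [IsNonarchimedeanLocalField F]

/-- The formal properties of the function `a ↦ γ_F(ψ_a)` for `ψ` of conductor `-ε`, in odd
residual characteristic. -/
structure IsWeilFunction (ε : ℤ) (G : F → ℂ) : Prop where
  mul_sq : ∀ {a b : F}, a ≠ 0 → b ≠ 0 → G (a * b ^ 2) = G a
  eq_one : ∀ {a : F}, a ≠ 0 → Even (ord a + ε) → G a = 1
  mul_nonsquare : ∀ {u a : F}, u ≠ 0 → ord u = 0 → ¬ IsSquare u → a ≠ 0 →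
    ¬ Even (ord a + ε) → G (u * a) = -G a
  mul_neg : ∀ {a : F}, a ≠ 0 → G a * G (-a) = 1

namespace IsWeilFunction

variable {ε : ℤ} {G : F → ℂ} (hG : IsWeilFunction ε G)

include hG

lemma ne_zero {a : F} (ha : a ≠ 0) : G a ≠ 0 := left_ne_zero_of_mul_eq_one (hG.mul_neg ha)

lemma inv_eq {a : F} (ha : a ≠ 0) : (G a)⁻¹ = G (-a) :=
  inv_eq_of_mul_eq_one_right (hG.mul_neg ha)

lemma congr_sq {a b s : F} (ha : a ≠ 0) (hs : s ≠ 0) (h : b = a * s ^ 2) : G b = G a := by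
  rw [h, hG.mul_sq ha hs]

/-- `G` only depends on the leading term of the argument. -/
lemma mul_one_add (hp : ringChar 𝓀[F] ≠ 2) {a y : F} (ha : a ≠ 0) (hy : y ∈ fracIdeal 1) :
    G (a * (1 + y)) = G a := by
  obtain ⟨s, hs, -, h⟩ := isSquare_one_add hp hy
  rw [← h, hG.mul_sq ha hs]

lemma congr_lead (hp : ringChar 𝓀[F] ≠ 2) {a b : F} (ha : a ≠ 0)
    (h : b - a ∈ fracIdeal (ord a + 1)) : G b = G a := by
  have e : b = a * (1 + a⁻¹ * (b - a)) := by field_simp; ring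
  rw [e]
  refine hG.mul_one_add hp ha ?_
  refine fracIdeal_mul (mem_fracIdeal_of_le (ord_inv a).ge) h (by omega)

lemma mul_unit_sq {u a : F} (hu : u ≠ 0) (hu0 : ord u = 0) (ha : a ≠ 0) (h : IsSquare u) :
    G (u * a) = G a := by
  obtain ⟨s, rfl⟩ := h
  have hs : s ≠ 0 := left_ne_zero_of_mul hu
  exact hG.congr_sq ha hs (by ring)

lemma mul_unit_of_even {u a : F} (hu : u ≠ 0) (hu0 : ord u = 0) (ha : a ≠ 0)
    (h : Even (ord a + ε)) : G (u * a) = G a := by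
  rw [hG.eq_one ha h, hG.eq_one (mul_ne_zero hu ha)]
  rwa [ord_mul hu ha, hu0, zero_add]

/-- Compatibility with the equivalence `⟨u, v⟩ ≅ ⟨u + v, u v (u + v)⟩` of quadratic forms. -/
lemma mul_eq_add (hp : ringChar 𝓀[F] ≠ 2) {u v : F} (hu : u ≠ 0) (hv : v ≠ 0)
    (hw : u + v ≠ 0) : G u * G v = G (u + v) * G (u * v * (u + v)) := by
  wlog h : ord u ≤ ord v generalizing u v
  · have := this hv hu (by rwa [add_comm]) (by omega)
    rw [mul_comm, this, add_comm v u, mul_comm v u]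
  rcases h.lt_or_eq with h | h
  -- Different orders: u is the leading term of u + v, and everything is a comparison of leading
  -- terms.
  · have e1 : G (u + v) = G u :=
      hG.congr_lead hp hu (by rw [add_sub_cancel_left]; exact mem_fracIdeal_of_le (by omega))
    have e2 : G (u * v * (u + v)) = G v := by
      have : u * v * (u + v) = v * (1 + u⁻¹ * v) * u ^ 2 := by field_simp
      have hy : u⁻¹ * v ∈ fracIdeal 1 := mem_fracIdeal_of_le (by
        rw [ord_mul (inv_ne_zero hu) hv, ord_inv]; omega)
      rw [this, hG.mul_sq (mul_ne_zero hv (ord_one_add hy).1) hu, hG.mul_one_add hp hv hy]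
    rw [e1, e2]
  · have hle : ord u ≤ ord (u + v) := le_ord_of_mem hw
      (fracIdeal_add (mem_fracIdeal_of_le le_rfl) (mem_fracIdeal_of_le h.le))
    rcases hle.lt_or_eq with h' | h'
    · -- then `v` is `-u` up to a principal unit
      have e1 : G v = G (-u) :=
        hG.congr_lead hp (neg_ne_zero.mpr hu) (by
          rw [sub_neg_eq_add, add_comm v u, ord_neg]; exact mem_fracIdeal_of_le (by omega))
      have e2 : G (u * v * (u + v)) = G (-(u + v)) := by
        have : u * v * (u + v) = -(u + v) * (1 + -(u⁻¹ * (u + v))) * u ^ 2 := by field_simp; ring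
        have hy : -(u⁻¹ * (u + v)) ∈ fracIdeal 1 := mem_fracIdeal_of_le (by
          rw [ord_neg, ord_mul (inv_ne_zero hu) hw, ord_inv]; omega)
        rw [this, hG.mul_sq (mul_ne_zero (neg_ne_zero.mpr hw) (ord_one_add hy).1) hu,
          hG.mul_one_add hp (neg_ne_zero.mpr hw) hy]
      rw [e1, e2, hG.mul_neg hu, hG.mul_neg hw]
    -- No cancellation: u, v and u + v have the same order, so only the square classes of the units
    -- v/u and (u + v)/u enter.
    · by_cases hev : Even (ord u + ε)
      · rw [hG.eq_one hu hev, hG.eq_one hv (by rwa [← h]), hG.eq_one hw (by rwa [← h']),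
          hG.eq_one (mul_ne_zero (mul_ne_zero hu hv) hw)]
        rw [ord_mul (mul_ne_zero hu hv) hw, ord_mul hu hv, ← h, ← h']
        have : ord u + ord u + ord u + ε = (ord u + ε) + 2 * ord u := by ring
        rw [this]
        exact hev.add (even_two_mul _)
      · set α := v * u⁻¹ with hα
        set β := (u + v) * u⁻¹ with hβ
        have hα0 : α ≠ 0 := mul_ne_zero hv (inv_ne_zero hu)
        have hβ0 : β ≠ 0 := mul_ne_zero hw (inv_ne_zero hu)
        have oα : ord α = 0 := by rw [hα, ord_mul hv (inv_ne_zero hu), ord_inv]; omega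
        have oβ : ord β = 0 := by rw [hβ, ord_mul hw (inv_ne_zero hu), ord_inv]; omega
        have ev : v = α * u := by rw [hα]; field_simp
        have ew : u + v = β * u := by rw [hβ]; field_simp
        have ew' : G (u * v * (u + v)) = G (α * β * u) :=
          hG.congr_sq (mul_ne_zero (mul_ne_zero hα0 hβ0) hu) hu (by rw [ew, ev]; ring)
        rw [ew', ew, ev]
        have oαβ : ord (α * β) = 0 := by rw [ord_mul hα0 hβ0, oα, oβ, add_zero]
        by_cases sα : IsSquare α <;> by_cases sβ : IsSquare β
        · rw [hG.mul_unit_sq hα0 oα hu sα, hG.mul_unit_sq hβ0 oβ hu sβ,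
            hG.mul_unit_sq (mul_ne_zero hα0 hβ0) oαβ hu (sα.mul sβ)]
        · rw [hG.mul_unit_sq hα0 oα hu sα, mul_assoc α, hG.mul_unit_sq hα0 oα (mul_ne_zero hβ0 hu) sα,
            hG.mul_nonsquare hβ0 oβ sβ hu hev, neg_mul_neg]
        · rw [hG.mul_unit_sq hβ0 oβ hu sβ, mul_comm α β, mul_assoc β,
            hG.mul_unit_sq hβ0 oβ (mul_ne_zero hα0 hu) sβ]
        · rw [hG.mul_nonsquare hα0 oα sα hu hev, hG.mul_nonsquare hβ0 oβ sβ hu hev, neg_mul, _root_.mul_neg,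
            hG.mul_unit_sq (mul_ne_zero hα0 hβ0) oαβ hu
              (isSquare_mul_of_not_isSquare hp hα0 oα hβ0 oβ sα sβ)]

end IsWeilFunction

/-- The Hilbert symbol measures the failure of `G` to be multiplicative. -/
lemma IsWeilFunction.mul_eq_hilbert {ε : ℤ} {G : F → ℂ} (hG : IsWeilFunction ε G)
    (hp : ringChar 𝓀[F] ≠ 2) {a b : F} (ha : a ≠ 0) (hb : b ≠ 0) :
    G a * G b = G 1 * G (a * b) * ((hilbert a b : ℤ) : ℂ) := by
  by_cases h : hilbert a b = 1
  · rw [h, Units.val_one, Int.cast_one, mul_one]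
    obtain ⟨x, y, z, hne, e⟩ := hilbert_eq_one_iff.mp h
    by_cases hx : x = 0
    · have hy : y ≠ 0 := by
        rintro rfl
        simp only [hx, ne_eq, OfNat.ofNat_ne_zero, not_false_eq_true, zero_pow, mul_zero, add_zero,
          pow_eq_zero_iff] at e
        exact hne (by rw [hx, e])
      have hbs : b = 1 * (z / y) ^ 2 := by field_simp; rw [e, hx]; ring
      have hz : z / y ≠ 0 := by
        intro h0; rw [h0] at hbs; exact hb (by simpa using hbs)
      rw [hbs, hG.mul_sq one_ne_zero hz, ← mul_assoc, mul_one, hG.mul_sq ha hz, mul_comm]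
    by_cases hy : y = 0
    · have has : a = 1 * (z / x) ^ 2 := by field_simp; rw [e, hy]; ring
      have hz : z / x ≠ 0 := by
        intro h0; rw [h0] at has; exact ha (by simpa using has)
      rw [has, hG.mul_sq one_ne_zero hz, one_mul, mul_comm _ b, hG.mul_sq hb hz]
    have e1 := hG.mul_sq ha hx
    have e2 := hG.mul_sq hb hy
    -- If z = 0 the form is isotropic, and b is -a up to squares.
    by_cases hz : z = 0
    · have : b * y ^ 2 = -(a * x ^ 2) := by
        rw [hz] at e; linear_combination -e
      rw [← e1, ← e2, this, hG.mul_neg (mul_ne_zero ha (pow_ne_zero _ hx))]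
      have e3 : G (a * b) = G (-1) := by
        have : -1 * (a * x ^ 2) ^ 2 = a * b * (x * y) ^ 2 := by
          linear_combination (-(a * x ^ 2)) * this
        rw [← hG.mul_sq (mul_ne_zero ha hb) (mul_ne_zero hx hy), ← this,
          hG.mul_sq (neg_ne_zero.mpr one_ne_zero) (mul_ne_zero ha (pow_ne_zero _ hx))]
      rw [e3, hG.mul_neg one_ne_zero]
    -- The form ⟨a, b⟩ represents the nonzero square z², so `mul_eq_add` with u = ax² and v = by²
    -- compares it with ⟨1, ab⟩.
    · rw [← e1, ← e2, hG.mul_eq_add hp (mul_ne_zero ha (pow_ne_zero _ hx))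
        (mul_ne_zero hb (pow_ne_zero _ hy)) (by rw [← e]; exact pow_ne_zero _ hz), ← e]
      congr 1
      · exact hG.congr_sq one_ne_zero hz (by ring)
      · exact hG.congr_sq (mul_ne_zero ha hb) (mul_ne_zero (mul_ne_zero hx hy) hz) (by ring)
  · rw [hilbert_eq_neg_one_of_ne h]
    rw [Units.val_neg, Units.val_one, Int.cast_neg, Int.cast_one, mul_neg_one]
    -- the unit part of an element of even order
    have unitPart : ∀ {a : F}, a ≠ 0 → Even (ord a) → ∃ u s : F, u ≠ 0 ∧ ord u = 0 ∧ s ≠ 0 ∧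
        a = u * s ^ 2 := by
      intro a ha hev
      obtain ⟨n, hn⟩ := hev
      obtain ⟨s, hs, hsn⟩ := exists_ord_eq (F := F) n
      refine ⟨a / s ^ 2, s, div_ne_zero ha (pow_ne_zero _ hs), ?_, hs, by field_simp⟩
      rw [ord_div ha (pow_ne_zero _ hs), ord_pow, hsn, hn]
      push_cast; ring
    -- the case of one argument of even order
    have half : ∀ {a b : F}, a ≠ 0 → b ≠ 0 → Even (ord a) → hilbert a b ≠ 1 →
        G a * G b = -(G 1 * G (a * b)) := by
      intro a b ha hb hev h
      obtain ⟨u, s, hu, hu0, hs, rfl⟩ := unitPart ha hev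
      rw [hilbert_mul_sq hs] at h
      have hns : ¬ IsSquare u := by
        rintro ⟨t, ht⟩
        exact h (hilbert_of_isSquare (by rw [ht, sq]) b)
      -- If b also had even order, both arguments would be units up to squares, and such a symbol is
      -- trivial.
      have hodd : ¬ Even (ord b) := by
        intro hev'
        obtain ⟨v, t, hv, hv0, ht, rfl⟩ := unitPart hb hev'
        rw [hilbert_symm, hilbert_mul_sq ht, hilbert_symm] at h
        obtain ⟨x, y, z, hz, e⟩ := exists_sq_eq_add hp hu hu0 hv hv0
        exact h (hilbert_eq_one_iff.mpr ⟨x, y, z, by simp [hz], e⟩)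
      have e3 : G (u * s ^ 2 * b) = G (u * b) :=
        hG.congr_sq (mul_ne_zero hu hb) hs (by ring)
      rw [hG.mul_sq hu hs, e3]
      -- The sign of the nonsquare unit u shows up in G(ub) if ε is even and in G(u) if ε is odd.
      by_cases hε : Even ε
      · rw [hG.eq_one hu (by rwa [hu0, zero_add]), hG.eq_one one_ne_zero (by simpa using hε),
          hG.mul_nonsquare hu hu0 hns hb (by rw [Int.even_add]; tauto), one_mul, one_mul, neg_neg]
      · have e4 := hG.mul_nonsquare hu hu0 hns one_ne_zero (by simpa using hε)
        rw [mul_one] at e4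
        have h5 : Even (ord b + ε) := by rw [Int.even_add]; tauto
        rw [e4, hG.mul_unit_of_even hu hu0 hb h5, neg_mul]
    by_cases hev : Even (ord a)
    · exact half ha hb hev h
    by_cases hev' : Even (ord b)
    · rw [mul_comm, half hb ha hev' (by rwa [hilbert_symm]), mul_comm b a]
    have hab := mul_ne_zero ha hb
    -- Both orders are odd here. Since (a, b) = (a, -ab) and -ab has even order, the previous case
    -- applies.
    have h1 := half (neg_ne_zero.mpr hab) ha
      (by rw [ord_neg, ord_mul ha hb, Int.even_add]; tauto)
      (by rwa [hilbert_symm, hilbert_neg_mul ha])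
    have h2 : G (-(a * b) * a) = G (-b) :=
      hG.congr_sq (neg_ne_zero.mpr hb) ha (by ring)
    rw [h2] at h1
    have h3 := hG.mul_neg hab
    have h4 := hG.mul_neg hb
    linear_combination (G (a * b) * G b) * h1 - (G a * G b) * h3 - (G 1 * G (a * b)) * h4

end WeilFunction

/-! ### Quadratic Gauss sums over a finite field. -/

section FiniteField

variable {k : Type*} [Field k] [Fintype k]

/-- An element s has χ(s) + 1 square roots, where χ is the quadratic character, and the summand 1
contributes the vanishing sum of θ. -/
lemma sum_sq_eq_gaussSum [DecidableEq k] (hk : ringChar k ≠ 2) {θ : AddChar k ℂ} (hθ : θ ≠ 1) :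
    ∑ t, θ (t ^ 2) = gaussSum ((quadraticChar k).ringHomComp (Int.castRingHom ℂ)) θ := by
  have e : ∑ t, θ (t ^ 2) = ∑ s, ((Finset.univ.filter fun t : k => t ^ 2 = s).card : ℂ) * θ s := by
    rw [← Finset.sum_fiberwise Finset.univ (fun t : k => t ^ 2)]
    refine Finset.sum_congr rfl fun s _ => ?_
    rw [Finset.sum_congr rfl (g := fun _ => θ s)]
    · rw [Finset.sum_const, nsmul_eq_mul]
    · intro t ht
      rw [(Finset.mem_filter.mp ht).2]
  have c : ∀ s : k, ((Finset.univ.filter fun t : k => t ^ 2 = s).card : ℂ)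
      = (quadraticChar k s : ℂ) + 1 := by
    intro s
    have := quadraticChar_card_sqrts hk s
    rw [Set.toFinset_ofPred] at this
    exact_mod_cast congrArg (Int.cast : ℤ → ℂ) this
  rw [e, gaussSum]
  simp only [c, add_mul, one_mul, Finset.sum_add_distrib, AddChar.sum_eq_zero_of_ne_one hθ,
    add_zero]
  rfl

lemma sum_nonsquare_mul_sq (hk : ringChar k ≠ 2) {θ : AddChar k ℂ} (hθ : θ ≠ 1) {u : k}
    (hu : ¬ IsSquare u) : ∑ t, θ (u * t ^ 2) = -∑ t, θ (t ^ 2) := by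
  classical
  have hu0 : u ≠ 0 := by rintro rfl; exact hu IsSquare.zero
  have h := gaussSum_mulShift ((quadraticChar k).ringHomComp (Int.castRingHom ℂ)) θ
    (Units.mk0 u hu0)
  have hθ' : θ.mulShift u ≠ 1 := fun h' => hθ (by
    ext x
    have := DFunLike.congr_fun h' (u⁻¹ * x)
    simpa [AddChar.mulShift_apply, ← mul_assoc, mul_inv_cancel₀ hu0] using this)
  rw [← sum_sq_eq_gaussSum hk hθ, Units.val_mk0, ← sum_sq_eq_gaussSum hk hθ',
    MulChar.ringHomComp_apply, quadraticChar_neg_one_iff_not_isSquare.mpr hu] at h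
  simp only [AddChar.mulShift_apply] at h
  rw [← h]
  simp

lemma sum_sq_mul_sum_neg_sq (hk : ringChar k ≠ 2) {θ : AddChar k ℂ} (hθ : θ ≠ 1) :
    (∑ t, θ (t ^ 2)) * ∑ t, θ (-t ^ 2) = Fintype.card k := by
  classical
  have hχ : (quadraticChar k).ringHomComp (Int.castRingHom ℂ) ≠ 1 := by
    rw [MulChar.ringHomComp_ne_one_iff (RingHom.injective_int _)]
    exact quadraticChar_ne_one hk
  have hinv : ((quadraticChar k).ringHomComp (Int.castRingHom ℂ))⁻¹ =
      (quadraticChar k).ringHomComp (Int.castRingHom ℂ) :=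
    ((quadraticChar_isQuadratic k).comp _).inv
  have h := gaussSum_mul_gaussSum_eq_card hχ (AddChar.IsPrimitive.of_ne_one hθ)
  rw [hinv, ← sum_sq_eq_gaussSum hk hθ, ← sum_sq_eq_gaussSum hk (inv_ne_one.mpr hθ)] at h
  simpa only [AddChar.inv_apply] using h

end FiniteField

/-! ### Computation of the Weil index by integration. -/

section Weil

variable {F : Type*} [Field F] [ValuativeRel F] [TopologicalSpace F]
  [IsNonarchimedeanLocalField F]

/-- The additive character `t ↦ ψ(d t)` of the residue field, for `ψ` trivial on `d 𝔭`. -/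
noncomputable def residueChar (ψ : AddChar F ℂ) (d : F)
    (h : ∀ x ∈ fracIdeal (F := F) 1, ψ (d * x) = 1) : AddChar 𝓀[F] ℂ where
  toFun t := ψ (d * (Function.surjInv IsLocalRing.residue_surjective t : 𝒪[F]))
  map_zero_eq_one' := by
    refine h _ (mem_maximalIdeal_iff.mp ?_)
    rw [← IsLocalRing.residue_eq_zero_iff, Function.surjInv_eq IsLocalRing.residue_surjective]
  map_add_eq_mul' s t := by
    set f := Function.surjInv (IsLocalRing.residue_surjective (R := 𝒪[F])) with hf
    have hm : f (s + t) - (f s + f t) ∈ 𝓂[F] := by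
      have hfr : ∀ t, IsLocalRing.residue 𝒪[F] (f t) = t := Function.surjInv_eq _
      rw [← IsLocalRing.residue_eq_zero_iff, map_sub, map_add, hfr, hfr, hfr, sub_self]
    have := h _ (mem_maximalIdeal_iff.mp hm)
    have e : d * (f (s + t) : F) = (d * (f s : F) + d * (f t : F)) +
        d * ((f (s + t) - (f s + f t) : 𝒪[F]) : F) := by
      push_cast; ring
    rw [e, AddChar.map_add_eq_mul, this, mul_one, AddChar.map_add_eq_mul]

lemma residueChar_residue (ψ : AddChar F ℂ) (d : F)
    (h : ∀ x ∈ fracIdeal (F := F) 1, ψ (d * x) = 1) (x : 𝒪[F]) :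
    residueChar ψ d h (IsLocalRing.residue 𝒪[F] x) = ψ (d * x) := by
  set f := Function.surjInv (IsLocalRing.residue_surjective (R := 𝒪[F])) with hf
  change ψ (d * (f _ : 𝒪[F])) = _
  have hm : f (IsLocalRing.residue 𝒪[F] x) - x ∈ 𝓂[F] := by
    have hfr : ∀ t, IsLocalRing.residue 𝒪[F] (f t) = t := Function.surjInv_eq _
    rw [← IsLocalRing.residue_eq_zero_iff, map_sub, hfr, sub_self]
  have := h _ (mem_maximalIdeal_iff.mp hm)
  have e : d * (f (IsLocalRing.residue 𝒪[F] x) : F) =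
      d * x + d * ((f (IsLocalRing.residue 𝒪[F] x) - x : 𝒪[F]) : F) := by
    push_cast; ring
  rw [e, AddChar.map_add_eq_mul, this, mul_one]

lemma t2Space : T2Space F :=
  IsTopologicalAddGroup.t2Space_of_zero_sep fun x hx => ⟨fracIdeal (ord x + 1),
    fracIdeal_mem_nhds _, fun h => by have := le_ord_of_mem hx h; omega⟩

lemma isClopen_fracIdeal (n : ℤ) : IsClopen (fracIdeal (F := F) n) := by
  have : T2Space F := t2Space
  exact ⟨(isCompact_fracIdeal n).isClosed, isOpen_fracIdeal n⟩

lemma add_mem_fracIdeal_iff {x y : F} {n : ℤ} (hy : y ∈ fracIdeal n) :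
    x + y ∈ fracIdeal n ↔ x ∈ fracIdeal n :=
  ⟨fun h => by simpa using fracIdeal_sub h hy, fun h => fracIdeal_add h hy⟩

section Integral

open MeasureTheory

variable [MeasurableSpace F] [BorelSpace F]

lemma measurableSet_fracIdeal (n : ℤ) : MeasurableSet (fracIdeal (F := F) n) :=
  (isOpen_fracIdeal n).measurableSet

lemma measureReal_fracIdeal_pos (n : ℤ) :
    0 < (Measure.addHaar : Measure F).real (fracIdeal (F := F) n) := by
  refine ENNReal.toReal_pos ?_ (isCompact_fracIdeal n).measure_lt_top.ne
  exact ((isOpen_fracIdeal n).measure_pos _ ⟨0, zero_mem_fracIdeal n⟩).ne'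

lemma setIntegral_fracIdeal_add (f : F → ℂ) {n : ℤ} {y : F} (hy : y ∈ fracIdeal n) :
    ∫ x in fracIdeal (F := F) n, f (x + y) ∂Measure.addHaar =
      ∫ x in fracIdeal (F := F) n, f x ∂Measure.addHaar := by
  rw [← integral_indicator (measurableSet_fracIdeal n),
    ← integral_indicator (measurableSet_fracIdeal n),
    ← integral_add_right_eq_self ((fracIdeal (F := F) n).indicator f) y]
  refine integral_congr_ae (ae_of_all _ fun x => ?_)
  have h := add_mem_fracIdeal_iff (x := x) hy
  by_cases hx : x ∈ fracIdeal n
  · simp [Set.indicator, hx, h.mpr hx]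
  · simp [Set.indicator, hx, mt h.mp hx]

/-- Orthogonality: a nontrivial character integrates to zero. -/
lemma setIntegral_addChar (ψ : AddChar F ℂ) {n : ℤ} {y : F} (hy : y ∈ fracIdeal n)
    (h : ψ y ≠ 1) : ∫ x in fracIdeal (F := F) n, ψ x ∂Measure.addHaar = 0 := by
  have e := setIntegral_fracIdeal_add (fun x => ψ x) hy
  simp only [AddChar.map_add_eq_mul, integral_mul_const] at e
  by_contra h0
  exact h (by simpa [h0] using e)

lemma setIntegral_of_eq_one {f : F → ℂ} {n : ℤ} (h : ∀ x ∈ fracIdeal (F := F) n, f x = 1) :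
    ∫ x in fracIdeal (F := F) n, f x ∂Measure.addHaar =
      ((Measure.addHaar : Measure F).real (fracIdeal (F := F) n) : ℂ) := by
  rw [setIntegral_congr_fun (measurableSet_fracIdeal n) (g := fun _ => (1 : ℂ)) h,
    setIntegral_const]
  simp

variable {ψ : AddChar F ℂ} {e : ℤ}

/-- The integral of `ψ(a x²)` over a large fractional ideal reduces to a smaller one. -/
lemma quadIntegral_shrink (hp : ringChar 𝓀[F] ≠ 2) (hψ : Continuous ψ)
    (h1 : ∀ x ∈ fracIdeal (F := F) (-e), ψ x = 1)
    {z : F} (hz : z ∈ fracIdeal (-e - 1)) (hz1 : ψ z ≠ 1) {a : F} (ha : a ≠ 0) {j r s : ℤ}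
    (hj : -e ≤ ord a + 2 * j) (hs : s = -e - ord a - j) (hr : r ≤ s) :
    ∫ x in fracIdeal (F := F) r, ψ (a * x ^ 2) ∂Measure.addHaar =
      ∫ x in fracIdeal (F := F) s, ψ (a * x ^ 2) ∂Measure.addHaar := by
  have h2 := ord_two hp
  have hz0 : z ≠ 0 := by rintro rfl; exact hz1 (AddChar.map_zero_eq_one ψ)
  set c : ℂ := ((Measure.addHaar : Measure F).real (fracIdeal (F := F) j) : ℂ) with hc
  have hc0 : c ≠ 0 := by
    rw [hc]; exact_mod_cast (measureReal_fracIdeal_pos j).ne'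
  -- Average over translations by y ∈ 𝔭^j and exchange the integrals. The term ay² is invisible to
  -- ψ, and the linear term 2axy kills all x outside 𝔭^s, the dual of 𝔭^j with respect to ψ(2axy).
  let f : F → F → ℂ := fun x y => (fracIdeal r ×ˢ fracIdeal j).indicator
    (fun p : F × F => ψ (a * (p.1 + p.2) ^ 2)) (x, y)
  have hcont : Continuous (Function.uncurry f) :=
    ((isClopen_fracIdeal r).prod (isClopen_fracIdeal j)).continuous_indicator
      (hψ.comp (by fun_prop))
  have hsupp : HasCompactSupport (Function.uncurry f) :=
    HasCompactSupport.intro ((isCompact_fracIdeal r).prod (isCompact_fracIdeal j))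
      (by rintro ⟨x, y⟩ h; simp only [Function.uncurry, f, Set.indicator_of_notMem h])
  have swap := integral_integral_swap_of_hasCompactSupport hcont hsupp
    (μ := (Measure.addHaar : Measure F)) (ν := (Measure.addHaar : Measure F))
  have ef : ∀ x y, f x y = (fracIdeal (F := F) r).indicator
      (fun x => (fracIdeal (F := F) j).indicator (fun y => ψ (a * (x + y) ^ 2)) y) x := by
    intro x y
    by_cases hx : x ∈ fracIdeal r <;> by_cases hy : y ∈ fracIdeal j <;> simp [f, hx, hy]
  have hright : ∫ y, ∫ x, f x y ∂Measure.addHaar ∂(Measure.addHaar : Measure F) =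
      c * ∫ x in fracIdeal (F := F) r, ψ (a * x ^ 2) ∂Measure.addHaar := by
    have : ∀ y, ∫ x, f x y ∂Measure.addHaar = (fracIdeal (F := F) j).indicator
        (fun _ => ∫ x in fracIdeal (F := F) r, ψ (a * x ^ 2) ∂Measure.addHaar) y := by
      intro y
      by_cases hy : y ∈ fracIdeal j
      · simp only [ef, Set.indicator_of_mem hy]
        -- Translation by y preserves 𝔭^r because r ≤ s ≤ j.
        rw [integral_indicator (measurableSet_fracIdeal r),
          setIntegral_fracIdeal_add (fun x => ψ (a * x ^ 2)) (fracIdeal_mono (by omega) hy)]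
      · simp [ef, Set.indicator_of_notMem hy]
    simp only [this]
    rw [integral_indicator (measurableSet_fracIdeal j), setIntegral_const, Complex.real_smul]
  have hleft : ∫ x, ∫ y, f x y ∂Measure.addHaar ∂(Measure.addHaar : Measure F) =
      c * ∫ x in fracIdeal (F := F) s, ψ (a * x ^ 2) ∂Measure.addHaar := by
    have : ∀ x, ∫ y, f x y ∂Measure.addHaar = (fracIdeal (F := F) s).indicator
        (fun x => c * ψ (a * x ^ 2)) x := by
      intro x
      by_cases hx : x ∈ fracIdeal r
      · simp only [ef, Set.indicator_of_mem hx]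
        rw [integral_indicator (measurableSet_fracIdeal j)]
        have e1 : ∀ y ∈ fracIdeal (F := F) j,
            ψ (a * (x + y) ^ 2) = ψ (a * x ^ 2) * (ψ.mulShift (2 * a * x)) y := by
          intro y hy
          have e2 : a * (x + y) ^ 2 = a * x ^ 2 + 2 * a * x * y + a * (y * y) := by ring
          rw [e2, AddChar.map_add_eq_mul, AddChar.map_add_eq_mul, AddChar.mulShift_apply,
            h1 (a * (y * y)), mul_one]
          exact fracIdeal_mul (mem_fracIdeal_of_le le_rfl) (fracIdeal_mul hy hy le_rfl) (by omega)
        rw [setIntegral_congr_fun (measurableSet_fracIdeal j) e1, integral_const_mul]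
        by_cases hxs : x ∈ fracIdeal s
        · rw [Set.indicator_of_mem hxs, setIntegral_of_eq_one, mul_comm]
          intro y hy
          rw [AddChar.mulShift_apply]
          refine h1 _ (fracIdeal_mul (fracIdeal_mul (mem_fracIdeal_of_le (n := ord a) ?_) hxs le_rfl)
            hy (by omega))
          rw [ord_mul h2.1 ha, h2.2]; omega
        · have hx0 : x ≠ 0 := by rintro rfl; exact hxs (zero_mem_fracIdeal s)
          have hb := mul_ne_zero (mul_ne_zero h2.1 ha) hx0
          -- For x outside 𝔭^s the point z/(2ax) lies in 𝔭^j, and the linear character takes the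
          -- value ψ(z) ≠ 1 there.
          rw [Set.indicator_of_notMem hxs,
            setIntegral_addChar (ψ.mulShift (2 * a * x)) (y := z / (2 * a * x)), mul_zero]
          · refine mem_fracIdeal_of_le ?_
            rw [mem_fracIdeal_iff_of_ne hx0] at hxs
            rw [mem_fracIdeal_iff_of_ne hz0] at hz
            rw [ord_div hz0 hb, ord_mul (mul_ne_zero h2.1 ha) hx0, ord_mul h2.1 ha, h2.2]
            omega
          · rwa [AddChar.mulShift_apply, mul_div_cancel₀ _ hb]
      · have hxs : x ∉ fracIdeal s := fun h => hx (fracIdeal_mono hr h)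
        simp [ef, Set.indicator_of_notMem hx, Set.indicator_of_notMem hxs]
    simp only [this]
    rw [integral_indicator (measurableSet_fracIdeal s), integral_const_mul]
  rw [hleft, hright] at swap
  exact (mul_left_cancel₀ hc0 swap).symm

/-- The integral of `ψ(a x²)` over `𝔭 ^ ord c` as a sum over the residue field. -/
lemma quadIntegral_eq_sum [Fintype 𝓀[F]] (hψ : Continuous ψ)
    (h1 : ∀ x ∈ fracIdeal (F := F) (-e), ψ x = 1) {a c : F} (hc : c ≠ 0)
    (hac : ord a + 2 * ord c = -e - 1)
    (h : ∀ x ∈ fracIdeal (F := F) 1, ψ (a * c ^ 2 * x) = 1) :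
    ∫ x in fracIdeal (F := F) (ord c), ψ (a * x ^ 2) ∂Measure.addHaar =
      ((Measure.addHaar : Measure F).real (fracIdeal (F := F) (ord c + 1)) : ℂ) *
        ∑ t, residueChar ψ (a * c ^ 2) h (t ^ 2) := by
  set f := Function.surjInv (IsLocalRing.residue_surjective (R := 𝒪[F])) with hf
  have hfr : ∀ t, IsLocalRing.residue 𝒪[F] (f t) = t := Function.surjInv_eq _
  -- The cosets of 𝔭^(ord c + 1) in 𝔭^(ord c), on each of which ψ(ax²) is constant.
  let S : 𝓀[F] → Set F := fun t => (fun x => x + -(c * (f t : F))) ⁻¹' fracIdeal (ord c + 1)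
  have hSm : ∀ t, MeasurableSet (S t) := fun t =>
    ((isOpen_fracIdeal _).preimage (by fun_prop)).measurableSet
  have hcf : ∀ t, c * (f t : F) ∈ fracIdeal (ord c) := fun t =>
    fracIdeal_mul (mem_fracIdeal_of_le le_rfl) (mem_integer_iff.mp (f t).2) (by omega)
  have hU : fracIdeal (F := F) (ord c) = ⋃ t, S t := by
    ext x
    simp only [Set.mem_iUnion, S, Set.mem_preimage]
    constructor
    · intro hx
      have hxc : c⁻¹ * x ∈ 𝒪[F] := mem_integer_iff.mpr
        (fracIdeal_mul (mem_fracIdeal_of_le le_rfl) hx (by rw [ord_inv]; omega))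
      refine ⟨IsLocalRing.residue 𝒪[F] ⟨_, hxc⟩, ?_⟩
      have hm : (⟨_, hxc⟩ : 𝒪[F]) - f (IsLocalRing.residue 𝒪[F] ⟨_, hxc⟩) ∈ 𝓂[F] := by
        rw [← IsLocalRing.residue_eq_zero_iff, map_sub, hfr, sub_self]
      have e1 : ∀ y : F, x + -(c * y) = c * (c⁻¹ * x - y) := by
        intro y; field_simp; ring
      rw [e1]
      exact fracIdeal_mul (mem_fracIdeal_of_le le_rfl) (mem_maximalIdeal_iff.mp hm) le_rfl
    · rintro ⟨t, ht⟩
      simpa using fracIdeal_add (fracIdeal_mono (by omega) ht) (hcf t)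
  have hdisj : Pairwise (Function.onFun Disjoint S) := by
    intro s t hst
    rw [Function.onFun, Set.disjoint_left]
    intro x hs ht
    apply hst
    have h3 := fracIdeal_mul (k := 1) (mem_fracIdeal_of_le (ord_inv c).ge) (fracIdeal_sub ht hs)
      (by omega)
    have e1 : c⁻¹ * (x + -(c * (f t : F)) - (x + -(c * (f s : F)))) = ((f s - f t : 𝒪[F]) : F) := by
      push_cast; field_simp; ring
    rw [e1] at h3
    rw [← hfr s, ← hfr t, ← sub_eq_zero, ← map_sub, IsLocalRing.residue_eq_zero_iff]
    exact mem_maximalIdeal_iff.mpr h3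
  have : T2Space F := t2Space
  have hint : ∀ t, IntegrableOn (fun x => ψ (a * x ^ 2)) (S t) (Measure.addHaar : Measure F) := by
    intro t
    refine IntegrableOn.mono_set (ContinuousOn.integrableOn_compact
      (isCompact_fracIdeal (ord c)) (hψ.comp (by fun_prop)).continuousOn) ?_
    rw [hU]; exact Set.subset_iUnion S t
  rw [hU, integral_iUnion_fintype hSm hdisj hint, Finset.mul_sum]
  refine Finset.sum_congr rfl fun t _ => ?_
  have e1 : Set.EqOn (fun x => ψ (a * x ^ 2))
      (fun _ => residueChar ψ (a * c ^ 2) h (t ^ 2)) (S t) := by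
    intro x hx
    have hx' : x + -(c * (f t : F)) ∈ fracIdeal (ord c + 1) := hx
    set y := x + -(c * (f t : F)) with hy
    have ex : x = c * (f t : F) + y := by rw [hy]; ring
    have et : t ^ 2 = IsLocalRing.residue 𝒪[F] (f t ^ 2) := by rw [map_pow, hfr]
    change ψ (a * x ^ 2) = residueChar ψ (a * c ^ 2) h (t ^ 2)
    rw [et, residueChar_residue, ex]
    have e2 : a * (c * (f t : F) + y) ^ 2 = a * c ^ 2 * ((f t ^ 2 : 𝒪[F]) : F) +
        a * (y * (c * (f t : F) + (c * (f t : F) + y))) := by push_cast; ring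
    rw [e2, AddChar.map_add_eq_mul, h1 (a * _), mul_one]
    refine fracIdeal_mul (mem_fracIdeal_of_le le_rfl) (fracIdeal_mul hx'
      (fracIdeal_add (hcf t) (fracIdeal_add (hcf t) (fracIdeal_mono (by omega) hx'))) le_rfl)
      (by omega)
  rw [setIntegral_congr_fun (hSm t) e1, setIntegral_const, Complex.real_smul]
  congr 2
  rw [Measure.real, Measure.real, measure_preimage_add_right]

end Integral

lemma weilIndex_eq_of_eventually {φ : AddChar F ℂ} {w : ℂ}
    (h : ∀ᶠ n in atTop, quadIntegral φ n / (‖quadIntegral φ n‖ : ℂ) = w) : weilIndex φ = w :=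
  Tendsto.limUnder_eq (tendsto_const_nhds.congr' (h.mono fun _ => Eq.symm))

variable {ψ : AddChar F ℂ} {e : ℤ}

/-- If ord a + e = 2k, then 𝔭^(-k) is its own dual and ψ(ax²) = 1 on it. The integral therefore
shrinks to a positive volume. -/
lemma weilIndex_of_even (hp : ringChar 𝓀[F] ≠ 2) (hψ : Continuous ψ) (hψe : HasConductor ψ (-e))
    {a : F} (ha : a ≠ 0) (h : Even (ord a + e)) : weilIndex (ψ.mulShift a) = 1 := by
  obtain ⟨k, hk⟩ := h
  have h1 : ∀ x ∈ fracIdeal (F := F) (-e), ψ x = 1 := hψe.1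
  obtain ⟨z, hz, hz1⟩ : ∃ z ∈ fracIdeal (F := F) (-e - 1), ψ z ≠ 1 := by
    by_contra! hcon
    have := hψe.2 hcon
    omega
  refine weilIndex_eq_of_eventually ?_
  filter_upwards [eventually_ge_atTop k.toNat] with n hn
  let _ : MeasurableSpace F := borel F
  have _ : BorelSpace F := ⟨rfl⟩
  have e1 : quadIntegral (ψ.mulShift a) n =
      ((MeasureTheory.Measure.addHaar : MeasureTheory.Measure F).real
        (fracIdeal (F := F) (-k)) : ℂ) := by
    change ∫ x in fracIdeal (F := F) (-(n : ℤ)), (ψ.mulShift a) (x ^ 2)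
      ∂MeasureTheory.Measure.addHaar = _
    simp only [AddChar.mulShift_apply]
    rw [quadIntegral_shrink hp hψ h1 hz hz1 ha (j := -k) (s := -k) (by omega) (by omega)
      (by omega), setIntegral_of_eq_one]
    intro x hx
    refine h1 _ ?_
    rw [sq]
    exact fracIdeal_mul (mem_fracIdeal_of_le le_rfl) (fracIdeal_mul hx hx le_rfl) (by omega)
  have hpos := measureReal_fracIdeal_pos (F := F) (-k)
  rw [e1, Complex.norm_real, Real.norm_of_nonneg hpos.le, div_self]
  exact_mod_cast hpos.ne'

/-- Here 𝔭^(ord c + 1) is dual to 𝔭^(ord c), and on the latter ψ(ax²) factors through the residue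
field. The volume factor drops out of the phase. -/
lemma weilIndex_of_odd [Fintype 𝓀[F]] (hp : ringChar 𝓀[F] ≠ 2) (hψ : Continuous ψ)
    (hψe : HasConductor ψ (-e))
    {a c : F} (ha : a ≠ 0) (hc : c ≠ 0) (hac : ord a + 2 * ord c = -e - 1)
    (h : ∀ x ∈ fracIdeal (F := F) 1, ψ (a * c ^ 2 * x) = 1) :
    weilIndex (ψ.mulShift a) = (∑ t, residueChar ψ (a * c ^ 2) h (t ^ 2)) /
      (‖∑ t, residueChar ψ (a * c ^ 2) h (t ^ 2)‖ : ℂ) := by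
  have h1 : ∀ x ∈ fracIdeal (F := F) (-e), ψ x = 1 := hψe.1
  obtain ⟨z, hz, hz1⟩ : ∃ z ∈ fracIdeal (F := F) (-e - 1), ψ z ≠ 1 := by
    by_contra! hcon
    have := hψe.2 hcon
    omega
  refine weilIndex_eq_of_eventually ?_
  filter_upwards [eventually_ge_atTop (-ord c).toNat] with n hn
  let _ : MeasurableSpace F := borel F
  have _ : BorelSpace F := ⟨rfl⟩
  have e1 : quadIntegral (ψ.mulShift a) n =
      ((MeasureTheory.Measure.addHaar : MeasureTheory.Measure F).real
        (fracIdeal (F := F) (ord c + 1)) : ℂ) * ∑ t, residueChar ψ (a * c ^ 2) h (t ^ 2) := by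
    rw [← quadIntegral_eq_sum hψ h1 hc hac h]
    change ∫ x in fracIdeal (F := F) (-(n : ℤ)), (ψ.mulShift a) (x ^ 2)
      ∂MeasureTheory.Measure.addHaar = _
    simp only [AddChar.mulShift_apply]
    exact quadIntegral_shrink hp hψ h1 hz hz1 ha (j := ord c + 1) (by omega) (by omega)
      (by omega)
  have hpos := measureReal_fracIdeal_pos (F := F) (ord c + 1)
  rw [e1, norm_mul, Complex.norm_real, Real.norm_of_nonneg hpos.le, Complex.ofReal_mul,
    mul_div_mul_left]
  exact_mod_cast hpos.ne'

/-- According to parity the index is 1 or a normalized Gauss sum Σ θ(t²). A nonsquare unit changes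
the sign of the sum. Passing to -a replaces θ by θ⁻¹, and the product of the two sums is q, a
positive number. -/
lemma isWeilFunction_weilIndex (hp : ringChar 𝓀[F] ≠ 2) (hψ : Continuous ψ)
    (hψe : HasConductor ψ (-e)) : IsWeilFunction e fun a : F => weilIndex (ψ.mulShift a) := by
  have := Fintype.ofFinite 𝓀[F]
  have h1 : ∀ x ∈ fracIdeal (F := F) (-e), ψ x = 1 := hψe.1
  obtain ⟨z, hz, hz1⟩ : ∃ z ∈ fracIdeal (F := F) (-e - 1), ψ z ≠ 1 := by
    by_contra! hcon
    have := hψe.2 hcon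
    omega
  have hz0 : z ≠ 0 := by rintro rfl; exact hz1 (AddChar.map_zero_eq_one ψ)
  have exc : ∀ {a : F}, ¬ Even (ord a + e) → ∃ c : F, c ≠ 0 ∧ ord a + 2 * ord c = -e - 1 := by
    intro a h
    obtain ⟨k, hk⟩ := Int.not_even_iff_odd.mp h
    obtain ⟨c, hc, hck⟩ := exists_ord_eq (F := F) (-k - 1)
    exact ⟨c, hc, by omega⟩
  have triv : ∀ {d : F}, d ≠ 0 → ord d = -e - 1 → ∀ x ∈ fracIdeal (F := F) 1, ψ (d * x) = 1 :=
    fun {d} _ hd x hx => h1 _ (fracIdeal_mul (mem_fracIdeal_of_le le_rfl) hx (by omega))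
  have ne1 : ∀ {d : F} (_ : d ≠ 0) (_ : ord d = -e - 1) (h), residueChar ψ d h ≠ 1 := by
    intro d hd0 hd h hcon
    have hm : d⁻¹ * z ∈ 𝒪[F] := mem_integer_iff.mpr
      (fracIdeal_mul (mem_fracIdeal_of_le le_rfl) hz (by rw [ord_inv]; omega))
    have := residueChar_residue ψ d h ⟨_, hm⟩
    rw [hcon, AddChar.one_apply] at this
    apply hz1
    rw [this]
    congr 1
    field_simp
  have oac : ∀ {a c : F}, a ≠ 0 → c ≠ 0 → ord a + 2 * ord c = -e - 1 →
      ord (a * c ^ 2) = -e - 1 := by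
    intro a c ha hc h
    rw [ord_mul ha (pow_ne_zero _ hc), ord_pow]
    exact_mod_cast h
  refine ⟨?_, fun {a} ha h => weilIndex_of_even hp hψ hψe ha h, ?_, ?_⟩
  · intro a b ha hb
    have hb2 := pow_ne_zero 2 hb
    by_cases h : Even (ord a + e)
    · rw [weilIndex_of_even hp hψ hψe ha h,
        weilIndex_of_even hp hψ hψe (mul_ne_zero ha hb2)]
      rw [ord_mul ha hb2, ord_pow]
      have : ord a + (2 : ℕ) * ord b + e = (ord a + e) + 2 * ord b := by push_cast; ring
      rw [this]
      exact h.add (even_two_mul _)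
    · obtain ⟨c, hc, hac⟩ := exc h
      have ho := oac ha hc hac
      have hd := triv (mul_ne_zero ha (pow_ne_zero 2 hc)) ho
      -- Replacing c by c/b keeps ac² fixed, so the same residue character occurs on both sides.
      have ecb : a * b ^ 2 * (c / b) ^ 2 = a * c ^ 2 := by field_simp
      rw [weilIndex_of_odd hp hψ hψe ha hc hac hd,
        weilIndex_of_odd hp hψ hψe (mul_ne_zero ha hb2) (div_ne_zero hc hb)
          (by rw [ord_mul ha hb2, ord_pow, ord_div hc hb]; push_cast; omega)
          (by rwa [ecb])]
      simp only [ecb]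
  · intro u a hu hu0 hns ha h
    obtain ⟨c, hc, hac⟩ := exc h
    have ho := oac ha hc hac
    have hac0 := mul_ne_zero ha (pow_ne_zero 2 hc)
    have hd := triv hac0 ho
    have hua : ord (u * a) = ord a := by rw [ord_mul hu ha, hu0, zero_add]
    have hd' : ∀ x ∈ fracIdeal (F := F) 1, ψ (u * a * c ^ 2 * x) = 1 :=
      triv (mul_ne_zero (mul_ne_zero hu ha) (pow_ne_zero 2 hc))
        (oac (mul_ne_zero hu ha) hc (by rw [hua, hac]))
    obtain ⟨v, rfl⟩ := exists_unit hu hu0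
    have hns' := fun hs => hns ((isSquare_unit_iff hp v).mpr hs)
    have es : ∑ t, residueChar ψ (((v : 𝒪[F]) : F) * a * c ^ 2) hd' (t ^ 2) =
        -∑ t, residueChar ψ (a * c ^ 2) hd (t ^ 2) := by
      rw [← sum_nonsquare_mul_sq hp (ne1 hac0 ho hd) hns']
      refine Finset.sum_congr rfl fun t _ => ?_
      obtain ⟨t, rfl⟩ := IsLocalRing.residue_surjective t
      rw [← map_pow, ← map_mul, residueChar_residue, residueChar_residue]
      congr 1
      push_cast; ring
    rw [weilIndex_of_odd hp hψ hψe ha hc hac hd,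
      weilIndex_of_odd hp hψ hψe (mul_ne_zero hu ha) hc (by rw [hua, hac]) hd', es, norm_neg,
      neg_div]
  · intro a ha
    by_cases h : Even (ord a + e)
    · rw [weilIndex_of_even hp hψ hψe ha h,
        weilIndex_of_even hp hψ hψe (neg_ne_zero.mpr ha) (by rwa [ord_neg]), one_mul]
    · obtain ⟨c, hc, hac⟩ := exc h
      have ho := oac ha hc hac
      have hac0 := mul_ne_zero ha (pow_ne_zero 2 hc)
      have hd := triv hac0 ho
      have ho' := oac (neg_ne_zero.mpr ha) hc (by rw [ord_neg, hac])
      have hd' : ∀ x ∈ fracIdeal (F := F) 1, ψ (-a * c ^ 2 * x) = 1 :=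
        triv (mul_ne_zero (neg_ne_zero.mpr ha) (pow_ne_zero 2 hc)) ho'
      have es : ∑ t, residueChar ψ (-a * c ^ 2) hd' (t ^ 2) =
          ∑ t, residueChar ψ (a * c ^ 2) hd (-t ^ 2) := by
        refine Finset.sum_congr rfl fun t _ => ?_
        obtain ⟨t, rfl⟩ := IsLocalRing.residue_surjective t
        rw [← map_pow, ← map_neg, residueChar_residue, residueChar_residue]
        congr 1
        push_cast; ring
      rw [weilIndex_of_odd hp hψ hψe ha hc hac hd,
        weilIndex_of_odd hp hψ hψe (neg_ne_zero.mpr ha) hc (by rw [ord_neg, hac]) hd', es]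
      have hprod := sum_sq_mul_sum_neg_sq hp (ne1 hac0 ho hd)
      rw [div_mul_div_comm, ← Complex.ofReal_mul, ← norm_mul, hprod, Complex.norm_natCast,
        Complex.ofReal_natCast, div_self]
      exact_mod_cast Fintype.card_ne_zero

end Weil

/-! ### The trivializing function on bottom rows. -/

section RowIndex

open Classical in
/-- The first nonzero entry of the row `(c, d)`. -/
noncomputable def lead {F : Type*} [Field F] (c d : F) : F := if c ≠ 0 then c else d

lemma lead_of_ne {F : Type*} [Field F] {c d : F} (h : c ≠ 0) : lead c d = c := if_pos h

@[simp] lemma lead_zero {F : Type*} [Field F] (d : F) : lead 0 d = d := if_neg (by simp)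

lemma kubotaX_eq_lead {F : Type*} [Field F] (g : SL(2, F)) :
    kubotaX g = lead (g 1 0) (g 1 1) := rfl

lemma lead_smul {F : Type*} [Field F] {l : F} (hl : l ≠ 0) (c d : F) : lead (l * c) (l * d) = l * lead c d := by
  by_cases hc : c = 0
  · simp [hc]
  · rw [lead_of_ne hc, lead_of_ne (mul_ne_zero hl hc)]

lemma lead_ne_zero {F : Type*} [Field F] {c d : F} (h : c ≠ 0 ∨ d ≠ 0) : lead c d ≠ 0 := by
  by_cases hc : c = 0
  · rw [hc, lead_zero]; tauto
  · rwa [lead_of_ne hc]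

variable {F : Type*} [Field F] [ValuativeRel F] [TopologicalSpace F]
  [IsNonarchimedeanLocalField F]

/-- The row `(c, d)` is in the big cell relative to the lattice `𝔭 ^ ε ⊕ 𝒪`. -/
def IsUpper (ε : ℤ) (c d : F) : Prop := c ≠ 0 ∧ d ∈ fracIdeal (ord c - ε)

open Classical in
/-- The function on rows which, up to `G (lead c d)`, trivializes the Kubota cocycle on pairs
`(g, k)` with `k` in the maximal compact subgroup. -/
noncomputable def rowIndex (ε : ℤ) (G : F → ℂ) (c d : F) : ℂ :=
  if IsUpper ε c d then 1 else if c = 0 then (G 1)⁻¹ else (G (c * d))⁻¹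

variable {ε : ℤ} {G : F → ℂ}

lemma rowIndex_of_isUpper {c d : F} (h : IsUpper ε c d) : rowIndex ε G c d = 1 := if_pos h

lemma rowIndex_zero (d : F) : rowIndex ε G 0 d = (G 1)⁻¹ := by
  rw [rowIndex, if_neg (fun h => h.1 rfl), if_pos rfl]

lemma rowIndex_of_not {c d : F} (h : ¬ IsUpper ε c d) (hc : c ≠ 0) :
    rowIndex ε G c d = (G (c * d))⁻¹ := by
  rw [rowIndex, if_neg h, if_neg hc]

lemma not_isUpper_iff {c d : F} (h : c ≠ 0 ∨ d ≠ 0) :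
    ¬ IsUpper ε c d ↔ d ≠ 0 ∧ c ∈ fracIdeal (ord d + ε + 1) := by
  rw [IsUpper, not_and]
  by_cases hc : c = 0
  · simp only [hc, ne_eq, not_true_eq_false, false_imp_iff, true_iff]
    exact ⟨by tauto, zero_mem_fracIdeal _⟩
  · by_cases hd : d = 0
    · simp [hc, hd, zero_mem_fracIdeal]
    · rw [mem_fracIdeal_iff_of_ne hc, mem_fracIdeal_iff_of_ne hd]
      simp only [ne_eq, hc, not_false_eq_true, true_imp_iff, hd, true_and]
      omega

lemma isUpper_smul {l c d : F} (hl : l ≠ 0) : IsUpper ε (l * c) (l * d) ↔ IsUpper ε c d := by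
  unfold IsUpper
  by_cases hc : c = 0
  · simp [hc]
  · rw [ord_mul hl hc, show ord l + ord c - ε = (ord c - ε) + ord l by ring, fracIdeal_smul hl]
    simp [hc, hl]

lemma row_ne_zero {F : Type*} [Field F] {a b c d : F} (det : a * d - b * c = 1) :
    c ≠ 0 ∨ d ≠ 0 := by
  by_contra! h
  rw [h.1, h.2] at det
  simp at det

/-- An upper row of the maximal compact subgroup. -/
lemma ord_eq_of_isUpper {a b c d : F} (det : a * d - b * c = 1) (ha : a ∈ fracIdeal 0)
    (hb : b ∈ fracIdeal (-ε)) (hc : c ∈ fracIdeal ε) (hu : IsUpper ε c d) :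
    c ≠ 0 ∧ ord c = ε := by
  refine ⟨hu.1, ?_⟩
  have h1 := le_ord_of_mem hu.1 hc
  by_contra hne
  have h2 : a * d - b * c ∈ fracIdeal 1 :=
    fracIdeal_sub (fracIdeal_mul ha hu.2 (by omega))
      (fracIdeal_mul hb (mem_fracIdeal_of_le le_rfl) (by omega))
  rw [det] at h2
  have := le_ord_of_mem one_ne_zero h2
  rw [ord_one] at this
  omega

/-- A lower row of the maximal compact subgroup. -/
lemma ord_eq_of_not_isUpper {a b c d : F} (det : a * d - b * c = 1) (ha : a ∈ fracIdeal 0)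
    (hb : b ∈ fracIdeal (-ε)) (hd : d ∈ fracIdeal 0)
    (hu : ¬ IsUpper ε c d) :
    a ≠ 0 ∧ d ≠ 0 ∧ ord d = 0 ∧ c ∈ fracIdeal (ε + 1) ∧ b * c ∈ fracIdeal 1 := by
  obtain ⟨hd0, hc1⟩ := (not_isUpper_iff (row_ne_zero det)).mp hu
  have hdo := le_ord_of_mem hd0 hd
  have hc2 : c ∈ fracIdeal (ε + 1) := fracIdeal_mono (by omega) hc1
  have hbc : b * c ∈ fracIdeal 1 := fracIdeal_mul hb hc2 (by omega)
  have hone := ord_one_add hbc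
  have e : a * d = 1 + b * c := by linear_combination det
  rw [← e] at hone
  have ha0 := left_ne_zero_of_mul hone.1
  have hao := le_ord_of_mem ha0 ha
  rw [ord_mul ha0 hd0] at hone
  exact ⟨ha0, hd0, by omega, hc2, hbc⟩

namespace IsWeilFunction

variable (hG : IsWeilFunction ε G)

include hG

lemma rowIndex_ne_zero {c d : F} (h : c ≠ 0 ∨ d ≠ 0) : rowIndex ε G c d ≠ 0 := by
  by_cases hu : IsUpper ε c d
  · rw [rowIndex_of_isUpper hu]; exact one_ne_zero
  by_cases hc : c = 0
  · rw [hc, rowIndex_zero]; exact inv_ne_zero (hG.ne_zero one_ne_zero)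
  · rw [rowIndex_of_not hu hc]
    exact inv_ne_zero (hG.ne_zero (mul_ne_zero hc ((not_isUpper_iff h).mp hu).1))

lemma rowIndex_smul {l c d : F} (hl : l ≠ 0) (h : c ≠ 0 ∨ d ≠ 0) :
    rowIndex ε G (l * c) (l * d) = rowIndex ε G c d := by
  by_cases hu : IsUpper ε c d
  · rw [rowIndex_of_isUpper hu, rowIndex_of_isUpper ((isUpper_smul hl).mpr hu)]
  by_cases hc : c = 0
  · rw [hc, mul_zero, rowIndex_zero, rowIndex_zero]
  · rw [rowIndex_of_not hu hc, rowIndex_of_not (mt (isUpper_smul hl).mp hu) (mul_ne_zero hl hc)]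
    congr 1
    exact hG.congr_sq (mul_ne_zero hc ((not_isUpper_iff h).mp hu).1) hl (by ring)

/-- `G` is invariant under multiplication by squares and principal units. -/
lemma congr_of_eq (hp : ringChar 𝓀[F] ≠ 2) {a b y s t : F} (ha : a ≠ 0) (hs : s ≠ 0) (ht : t ≠ 0)
    (hy : y ∈ fracIdeal 1) (h : b * t ^ 2 = a * (1 + y) * s ^ 2) : G b = G a := by
  have h1 := mul_ne_zero ha (ord_one_add hy).1
  have hb : b ≠ 0 := by
    rintro rfl
    rw [zero_mul] at h
    exact mul_ne_zero h1 (pow_ne_zero 2 hs) h.symm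
  rw [← hG.mul_sq hb ht, h, hG.mul_sq h1 hs, hG.mul_one_add hp ha hy]

/-- This is the coboundary identity stripped of the factors G(𝐱). The cases are whether the rows are
upper or lower and which left entries vanish. In nearly all of them some entry of the product is
known up to a principal unit or up to squares, to which G is blind. -/
lemma rowIndex_mul (hp : ringChar 𝓀[F] ≠ 2) {a' b' c' d' c d c'' d'' : F}
    (det : a' * d' - b' * c' = 1)
    (ha' : a' ∈ fracIdeal 0) (hb' : b' ∈ fracIdeal (-ε)) (hc' : c' ∈ fracIdeal ε)
    (hd' : d' ∈ fracIdeal 0) (hrow : c ≠ 0 ∨ d ≠ 0) (ec : c'' = c * a' + d * c')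
    (ed : d'' = c * b' + d * d') :
    rowIndex ε G c' d' * rowIndex ε G c d * G (lead c d * lead c' d' * lead c'' d'') =
      rowIndex ε G c'' d'' := by
  have rel1 : d' * c'' - c' * d'' = c := by rw [ec, ed]; linear_combination c * det
  have rel2 : a' * d'' - b' * c'' = d := by rw [ec, ed]; linear_combination d * det
  have hrow'' : c'' ≠ 0 ∨ d'' ≠ 0 := by
    by_contra! h
    rw [h.1, h.2] at rel1 rel2
    rcases hrow with h | h
    · exact h (by simpa using rel1.symm)
    · exact h (by simpa using rel2.symm)
  have g1 := hG.ne_zero (one_ne_zero (α := F))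
  have e' : a' * d' = 1 + b' * c' := by linear_combination det
  by_cases hu' : IsUpper ε c' d'
  · obtain ⟨hc0', hco'⟩ := ord_eq_of_isUpper det ha' hb' hc' hu'
    rw [rowIndex_of_isUpper hu', one_mul, lead_of_ne hc0']
    by_cases hu : IsUpper ε c d
    · rw [rowIndex_of_isUpper hu, one_mul, lead_of_ne hu.1]
      by_cases hu'' : IsUpper ε c'' d''
      · rw [rowIndex_of_isUpper hu'', lead_of_ne hu''.1]
        have h1 : ord c ≤ ord c'' := le_ord_of_mem hu''.1 (by
          rw [ec]
          exact fracIdeal_add (fracIdeal_mul (mem_fracIdeal_of_le le_rfl) ha' (by omega))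
            (fracIdeal_mul hu.2 hc' (by omega)))
        have h2 : ord c'' ≤ ord c := le_ord_of_mem hu.1 (by
          rw [← rel1]
          exact fracIdeal_sub (fracIdeal_mul hd' (mem_fracIdeal_of_le le_rfl) (by omega))
            (fracIdeal_mul hc' hu''.2 (by omega)))
        refine hG.eq_one (mul_ne_zero (mul_ne_zero hu.1 hc0') hu''.1) ?_
        rw [ord_mul (mul_ne_zero hu.1 hc0') hu''.1, ord_mul hu.1 hc0', hco']
        exact ⟨ord c + ε, by omega⟩
      · obtain ⟨hd0, hcm⟩ := (not_isUpper_iff hrow'').mp hu''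
        have hcd := mul_ne_zero hc0' hd0
        -- `c` is `-c' d''` up to a principal unit
        have hy : -(d' * c'' * (c' * d'')⁻¹) ∈ fracIdeal 1 :=
          fracIdeal_neg (fracIdeal_mul (fracIdeal_mul hd' hcm le_rfl)
            (mem_fracIdeal_of_le le_rfl) (by rw [ord_inv, ord_mul hc0' hd0]; omega))
        have ecc : c = -(c' * d'') * (1 + -(d' * c'' * (c' * d'')⁻¹)) := by
          rw [← rel1]; field_simp; ring
        by_cases hc0'' : c'' = 0
        · rw [hc0'', rowIndex_zero, lead_zero, hG.inv_eq one_ne_zero]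
          refine hG.congr_of_eq hp (neg_ne_zero.mpr one_ne_zero) hcd one_ne_zero hy ?_
          rw [ecc]; ring
        · rw [rowIndex_of_not hu'' hc0'', lead_of_ne hc0'', hG.inv_eq (mul_ne_zero hc0'' hd0)]
          refine hG.congr_of_eq hp (neg_ne_zero.mpr (mul_ne_zero hc0'' hd0)) hc0' one_ne_zero hy ?_
          rw [ecc]; ring
    · obtain ⟨hd0, hcm⟩ := (not_isUpper_iff hrow).mp hu
      have hdc := mul_ne_zero hd0 hc0'
      have hy : c * a' * (d * c')⁻¹ ∈ fracIdeal 1 :=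
        fracIdeal_mul (fracIdeal_mul hcm ha' le_rfl) (mem_fracIdeal_of_le le_rfl)
          (by rw [ord_inv, ord_mul hd0 hc0']; omega)
      have ecc : c'' = d * c' * (1 + c * a' * (d * c')⁻¹) := by rw [ec]; field_simp; ring
      have hone := ord_one_add hy
      have hc0'' : c'' ≠ 0 := by rw [ecc]; exact mul_ne_zero hdc hone.1
      have hco'' : ord c'' = ord d + ε := by
        rw [ecc, ord_mul hdc hone.1, hone.2, ord_mul hd0 hc0', hco', add_zero]
      have hu'' : IsUpper ε c'' d'' := ⟨hc0'', by
        rw [ed, hco'']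
        exact fracIdeal_add (fracIdeal_mul hcm hb' (by omega))
          (fracIdeal_mul (mem_fracIdeal_of_le le_rfl) hd' (by omega))⟩
      rw [rowIndex_of_isUpper hu'', lead_of_ne hc0'']
      by_cases hc0 : c = 0
      · rw [hc0, rowIndex_zero, lead_zero]
        have e1 : G (d * c' * c'') = G 1 :=
          hG.congr_of_eq hp one_ne_zero hdc one_ne_zero hy (by rw [ecc]; ring)
        rw [e1, inv_mul_cancel₀ g1]
      · rw [rowIndex_of_not hu hc0, lead_of_ne hc0]
        have hcd := mul_ne_zero hc0 hd0
        have e1 : G (c * c' * c'') = G (c * d) :=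
          hG.congr_of_eq hp hcd hc0' one_ne_zero hy (by rw [ecc]; ring)
        rw [e1, inv_mul_cancel₀ (hG.ne_zero hcd)]
  · obtain ⟨ha0', hd0', hdo', hcm', hbc⟩ := ord_eq_of_not_isUpper det ha' hb' hd' hu'
    by_cases hu : IsUpper ε c d
    · have hca := mul_ne_zero hu.1 ha0'
      have hao' : ord a' = 0 := by
        have h := (ord_one_add hbc).2
        rw [← e', ord_mul ha0' hd0'] at h; omega
      have hy : d * c' * (c * a')⁻¹ ∈ fracIdeal 1 :=
        fracIdeal_mul (fracIdeal_mul hu.2 hcm' le_rfl) (mem_fracIdeal_of_le le_rfl)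
          (by rw [ord_inv, ord_mul hu.1 ha0']; omega)
      have ecc : c'' = c * a' * (1 + d * c' * (c * a')⁻¹) := by
        rw [mul_add, mul_one, mul_comm (d * c'), mul_inv_cancel_left₀ hca, ec]
      have hone := ord_one_add hy
      have hc0'' : c'' ≠ 0 := by rw [ecc]; exact mul_ne_zero hca hone.1
      have hco'' : ord c'' = ord c := by
        rw [ecc, ord_mul hca hone.1, hone.2, ord_mul hu.1 ha0', hao']; omega
      have hu'' : IsUpper ε c'' d'' := ⟨hc0'', by
        rw [ed, hco'']
        exact fracIdeal_add (fracIdeal_mul (mem_fracIdeal_of_le le_rfl) hb' (by omega))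
          (fracIdeal_mul hu.2 hd' (by omega))⟩
      rw [rowIndex_of_isUpper hu'', rowIndex_of_isUpper hu, mul_one, lead_of_ne hu.1,
        lead_of_ne hc0'']
      by_cases hc0' : c' = 0
      · have had : a' * d' = 1 := by rw [e', hc0']; ring
        have e1 : G (c * d' * c'') = G 1 := hG.congr_sq one_ne_zero hu.1
          (by rw [ec, hc0']; linear_combination c ^ 2 * had)
        rw [hc0', rowIndex_zero, lead_zero, e1, inv_mul_cancel₀ g1]
      · rw [rowIndex_of_not hu' hc0', lead_of_ne hc0']
        have hcd := mul_ne_zero hc0' hd0'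
        have e1 : G (c * c' * c'') = G (a' * c') :=
          hG.congr_of_eq hp (mul_ne_zero ha0' hc0') hu.1 one_ne_zero hy (by rw [ecc]; ring)
        have e2 : G (a' * c') = G (c' * d') :=
          hG.congr_of_eq hp hcd one_ne_zero hd0' hbc (by rw [← e']; ring)
        rw [e1, e2, inv_mul_cancel₀ (hG.ne_zero hcd)]
    · obtain ⟨hd0, hcm⟩ := (not_isUpper_iff hrow).mp hu
      have hdd := mul_ne_zero hd0 hd0'
      have hy : c * b' * (d * d')⁻¹ ∈ fracIdeal 1 :=
        fracIdeal_mul (fracIdeal_mul hcm hb' le_rfl) (mem_fracIdeal_of_le le_rfl)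
          (by rw [ord_inv, ord_mul hd0 hd0']; omega)
      have edd : d'' = d * d' * (1 + c * b' * (d * d')⁻¹) := by rw [ed]; field_simp; ring
      have hone := ord_one_add hy
      have hd0'' : d'' ≠ 0 := by rw [edd]; exact mul_ne_zero hdd hone.1
      have hdo'' : ord d'' = ord d := by
        rw [edd, ord_mul hdd hone.1, hone.2, ord_mul hd0 hd0', hdo']; omega
      have hu'' : ¬ IsUpper ε c'' d'' := (not_isUpper_iff hrow'').mpr ⟨hd0'', by
        rw [ec, hdo'']
        exact fracIdeal_add (fracIdeal_mul hcm ha' (by omega))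
          (fracIdeal_mul (mem_fracIdeal_of_le le_rfl) hcm' (by omega))⟩
      by_cases hc0 : c = 0
      · have ec0 : c'' = d * c' := by rw [ec, hc0]; ring
        have ed0 : d'' = d * d' := by rw [ed, hc0]; ring
        by_cases hc0' : c' = 0
        · have hc0'' : c'' = 0 := by rw [ec0, hc0', mul_zero]
          have e1 : G (d * d' * d'') = G 1 := hG.congr_sq one_ne_zero hdd (by rw [ed0]; ring)
          rw [hc0, hc0', hc0'', rowIndex_zero, rowIndex_zero, rowIndex_zero, lead_zero, lead_zero,
            lead_zero, e1, mul_assoc, inv_mul_cancel₀ g1, mul_one]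
        · have hc0'' : c'' ≠ 0 := by rw [ec0]; exact mul_ne_zero hd0 hc0'
          have e1 : G (d * c' * c'') = G 1 :=
            hG.congr_sq one_ne_zero (mul_ne_zero hd0 hc0') (by rw [ec0]; ring)
          rw [rowIndex_of_not hu'' hc0'', hc0, rowIndex_zero, lead_zero, rowIndex_of_not hu' hc0',
            lead_of_ne hc0', lead_of_ne hc0'', e1, mul_assoc, inv_mul_cancel₀ g1, mul_one]
          congr 1
          exact (hG.congr_sq (mul_ne_zero hc0' hd0') hd0 (by rw [ec0, ed0]; ring)).symm
      · have hcd := mul_ne_zero hc0 hd0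
        rw [rowIndex_of_not hu hc0, lead_of_ne hc0]
        by_cases hc0' : c' = 0
        · have had : a' * d' = 1 := by rw [e', hc0']; ring
          have ec0 : c'' = c * a' := by rw [ec, hc0']; ring
          have hc0'' : c'' ≠ 0 := by rw [ec0]; exact mul_ne_zero hc0 ha0'
          have e1 : G (c * d' * c'') = G 1 :=
            hG.congr_sq one_ne_zero hc0 (by rw [ec0]; linear_combination c ^ 2 * had)
          rw [rowIndex_of_not hu'' hc0'', hc0', rowIndex_zero, lead_zero, lead_of_ne hc0'', e1,
            mul_comm (G 1)⁻¹, mul_assoc, inv_mul_cancel₀ g1, mul_one]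
          congr 1
          exact (hG.congr_of_eq hp hcd one_ne_zero one_ne_zero hy (by
            rw [ec0, edd]; linear_combination c * d * (1 + c * b' * (d * d')⁻¹) * had)).symm
        · have hcd' := mul_ne_zero hc0' hd0'
          rw [rowIndex_of_not hu' hc0', lead_of_ne hc0']
          by_cases hc0'' : c'' = 0
          · rw [hc0'', rowIndex_zero, lead_zero]
            have hneg : d * c' = -(c * a') := by rw [ec] at hc0''; linear_combination hc0''
            have e1 : G (c' * d') = G (-(c * d)) :=
              hG.congr_of_eq hp (neg_ne_zero.mpr hcd) one_ne_zero hd0 hbc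
                (by rw [← e']; linear_combination (d * d') * hneg)
            have e2 : G (c * c' * d'') = G (-1) := by
              have e3 : G (c * c' * d'') = G (c * c' * d * d') :=
                hG.congr_of_eq hp (mul_ne_zero (mul_ne_zero (mul_ne_zero hc0 hc0') hd0) hd0')
                  one_ne_zero one_ne_zero hy (by rw [edd]; ring)
              rw [e3]
              exact hG.congr_of_eq hp (neg_ne_zero.mpr one_ne_zero) hc0 one_ne_zero hbc
                (by rw [← e']; linear_combination (c * d') * hneg)
            have h1 := hG.mul_neg hcd
            rw [e1, e2, ← mul_inv, mul_comm (G (-(c * d))), h1, inv_one, one_mul,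
              hG.inv_eq one_ne_zero]
          · rw [rowIndex_of_not hu'' hc0'', lead_of_ne hc0'']
            -- The one case beyond leading terms: c'' is a sum of two terms, either of which may
            -- dominate. For these u and v one has u + v = dd'c'', and `mul_eq_add` is exactly what
            -- is needed.
            set u := c * d * (a' * d') with hudef
            set v := c' * d' * d ^ 2 with hvdef
            have hu0 : u ≠ 0 := mul_ne_zero hcd (mul_ne_zero ha0' hd0')
            have hv0 : v ≠ 0 := mul_ne_zero hcd' (pow_ne_zero 2 hd0)
            have huv : u + v = d * d' * c'' := by rw [hudef, hvdef, ec]; ring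
            have huv0 : u + v ≠ 0 := by rw [huv]; exact mul_ne_zero hdd hc0''
            have f1 : G u = G (c * d) :=
              hG.congr_of_eq hp hcd one_ne_zero one_ne_zero hbc (by rw [← e', hudef])
            have f2 : G v = G (c' * d') := hG.mul_sq hcd' hd0
            have f3 : G (c'' * d'') = G (u + v) :=
              hG.congr_of_eq hp huv0 one_ne_zero one_ne_zero hy (by rw [huv, edd]; ring)
            have f4 : G (u * v * (u + v)) = G (c * c' * c'') :=
              hG.congr_of_eq hp (mul_ne_zero (mul_ne_zero hc0 hc0') hc0'')
                (mul_ne_zero (pow_ne_zero 2 hd0) hd0') one_ne_zero hbc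
                (by rw [huv, hudef, hvdef, ← e']; ring)
            have key := hG.mul_eq_add hp hu0 hv0 huv0
            rw [f1, f2, f4, ← f3] at key
            rw [← mul_inv, mul_comm (G (c' * d')), key, mul_inv, mul_assoc,
              inv_mul_cancel₀ (hG.ne_zero (mul_ne_zero (mul_ne_zero hc0 hc0') hc0'')), mul_one]

end IsWeilFunction

end RowIndex

/-! ### Bimultiplicativity of the symbol attached to G. -/

section Bilinear

variable {F : Type*} [Field F] [ValuativeRel F] [TopologicalSpace F]
  [IsNonarchimedeanLocalField F] {ε : ℤ} {G : F → ℂ}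

lemma exists_unit_mul_sq {a b : F} (ha : a ≠ 0) (hb : b ≠ 0) (h : Even (ord a - ord b)) :
    ∃ u s : F, u ≠ 0 ∧ ord u = 0 ∧ s ≠ 0 ∧ a = u * b * s ^ 2 := by
  obtain ⟨n, hn⟩ := h
  obtain ⟨s, hs, hsn⟩ := exists_ord_eq (F := F) n
  have hs2 := pow_ne_zero 2 hs
  refine ⟨a / (b * s ^ 2), s, div_ne_zero ha (mul_ne_zero hb hs2), ?_, hs, by field_simp⟩
  rw [ord_div ha (mul_ne_zero hb hs2), ord_mul hb hs2, ord_pow, hsn]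
  push_cast; omega

namespace IsWeilFunction

variable (hG : IsWeilFunction ε G)

include hG

lemma mul_unit_eq_or {u a : F} (hu : u ≠ 0) (hu0 : ord u = 0) (ha : a ≠ 0) :
    G (u * a) = G a ∨ G (u * a) = -G a := by
  by_cases hs : IsSquare u
  · exact Or.inl (hG.mul_unit_sq hu hu0 ha hs)
  by_cases he : Even (ord a + ε)
  · exact Or.inl (hG.mul_unit_of_even hu hu0 ha he)
  · exact Or.inr (hG.mul_nonsquare hu hu0 hs ha he)

/-- Elements whose orders have the same parity differ by a unit times a square, and a unit changes G
at most by a sign. -/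
lemma sq_congr {a b : F} (ha : a ≠ 0) (hb : b ≠ 0) (h : Even (ord a - ord b)) :
    G a ^ 2 = G b ^ 2 := by
  obtain ⟨u, s, hu, hu0, hs, rfl⟩ := exists_unit_mul_sq ha hb h
  rw [hG.mul_sq (mul_ne_zero hu hb) hs]
  rcases hG.mul_unit_eq_or hu hu0 hb with h | h <;> rw [h]
  ring

lemma pow_four {a : F} (ha : a ≠ 0) : G a ^ 4 = 1 := by
  have h := hG.sq_congr ha (neg_ne_zero.mpr ha) (by simp)
  calc G a ^ 4 = G a ^ 2 * G a ^ 2 := by ring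
    _ = G a ^ 2 * G (-a) ^ 2 := by rw [← h]
    _ = 1 := by rw [← mul_pow, hG.mul_neg ha, one_pow]

/-- A nonsquare unit multiplies G(a) by the sign (-1)^(ord a + ε). The four signs, for a = Y, 1, Z
and ZY, cancel. -/
lemma bilinear_unit {u Y Z : F} (hu : u ≠ 0) (hu0 : ord u = 0) (hY : Y ≠ 0) (hZ : Z ≠ 0) :
    G (u * Y) * G (Z * Y) * (G u * G Z) = G 1 * G (u * Z) * (G (u * (Z * Y)) * G Y) := by
  have hZY := mul_ne_zero hZ hY
  have h1 := one_ne_zero (α := F)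
  have eu : G u = G (u * 1) := by rw [mul_one]
  by_cases hs : IsSquare u
  · rw [eu, hG.mul_unit_sq hu hu0 hY hs, hG.mul_unit_sq hu hu0 hZ hs,
      hG.mul_unit_sq hu hu0 hZY hs, hG.mul_unit_sq hu hu0 h1 hs]
    ring
  · have key : ∀ {a : F}, a ≠ 0 →
        G (u * a) = (if Even (ord a + ε) then 1 else -1) * G a := by
      intro a ha
      split_ifs with h
      · rw [hG.mul_unit_of_even hu hu0 ha h, one_mul]
      · rw [hG.mul_nonsquare hu hu0 hs ha h, neg_one_mul]
    rw [eu, key hY, key h1, key hZ, key hZY, ord_mul hZ hY, ord_one]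
    by_cases p1 : Even (ord Y) <;> by_cases p2 : Even (ord Z) <;> by_cases p3 : Even ε <;>
      simp only [Int.even_add, p1, p2, p3, Even.zero, iff_true, iff_false, iff_self, not_true,
        if_true, if_false] <;> ring

/-- The symbol `(a, b) ↦ G a G b / (G 1 G (a b))` is bimultiplicative. -/
lemma bilinear {X Y Z : F} (hX : X ≠ 0) (hY : Y ≠ 0) (hZ : Z ≠ 0) :
    G (X * Y) * G (Z * Y) * (G X * G Z) = G 1 * G (X * Z) * (G (X * Z * Y) * G Y) := by
  have h1 := one_ne_zero (α := F)
  have even : ∀ {X Y Z : F}, X ≠ 0 → Y ≠ 0 → Z ≠ 0 → Even (ord X) →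
      G (X * Y) * G (Z * Y) * (G X * G Z) = G 1 * G (X * Z) * (G (X * Z * Y) * G Y) := by
    intro X Y Z hX hY hZ hev
    obtain ⟨u, s, hu, hu0, hs, rfl⟩ := exists_unit_mul_sq hX h1 (by simpa using hev)
    have := hG.bilinear_unit hu hu0 hY hZ
    have e1 : G (u * 1 * s ^ 2 * Y) = G (u * Y) := hG.congr_sq (mul_ne_zero hu hY) hs (by ring)
    have e2 : G (u * 1 * s ^ 2 * Z) = G (u * Z) := hG.congr_sq (mul_ne_zero hu hZ) hs (by ring)
    have e3 : G (u * 1 * s ^ 2) = G u := hG.congr_sq hu hs (by ring)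
    have e4 : G (u * 1 * s ^ 2 * Z * Y) = G (u * (Z * Y)) :=
      hG.congr_sq (mul_ne_zero hu (mul_ne_zero hZ hY)) hs (by ring)
    rw [e1, e2, e3, e4, this]
  by_cases hX2 : Even (ord X)
  · exact even hX hY hZ hX2
  by_cases hZ2 : Even (ord Z)
  · have := even hZ hY hX hZ2
    rw [mul_comm Z X] at this
    rw [← this]; ring
  -- If X and Z both have odd order, then Z is vX up to squares with a unit v. The identity `base`
  -- is the case v = 1, and v contributes signs as in `bilinear_unit`.
  · obtain ⟨v, s, hv, hv0, hs, rfl⟩ := exists_unit_mul_sq hZ hX (by rw [Int.even_sub]; tauto)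
    have hvX := mul_ne_zero hv hX
    have e1 : G (v * X * s ^ 2 * Y) = G (v * (X * Y)) :=
      hG.congr_sq (mul_ne_zero hv (mul_ne_zero hX hY)) hs (by ring)
    have e2 : G (v * X * s ^ 2) = G (v * X) := hG.mul_sq hvX hs
    have e3 : G (X * (v * X * s ^ 2)) = G (v * 1) :=
      hG.congr_sq (mul_ne_zero hv h1) (mul_ne_zero hX hs) (by ring)
    have e4 : G (X * (v * X * s ^ 2) * Y) = G (v * Y) :=
      hG.congr_sq (mul_ne_zero hv hY) (mul_ne_zero hX hs) (by ring)
    have hXY := mul_ne_zero hX hY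
    rw [e1, e2, e3, e4]
    have base : (G (X * Y) * G X) ^ 2 = (G 1 * G Y) ^ 2 := by
      rw [mul_pow, mul_pow]
      by_cases hY2 : Even (ord Y)
      · rw [hG.sq_congr hXY hX (by rw [ord_mul hX hY]; simpa using hY2),
          hG.sq_congr hY h1 (by simpa using hY2)]
        have f1 := hG.pow_four hX
        have f2 := hG.pow_four h1
        linear_combination f1 - f2
      · rw [hG.sq_congr hXY h1 (by rw [ord_mul hX hY, ord_one, sub_zero, Int.even_add]; tauto),
          hG.sq_congr hX hY (by rw [Int.even_sub]; tauto)]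
    by_cases hsq : IsSquare v
    · rw [hG.mul_unit_sq hv hv0 hXY hsq, hG.mul_unit_sq hv hv0 hX hsq,
        hG.mul_unit_sq hv hv0 h1 hsq, hG.mul_unit_sq hv hv0 hY hsq]
      linear_combination base
    · have key : ∀ {a : F}, a ≠ 0 →
          G (v * a) = (if Even (ord a + ε) then 1 else -1) * G a := by
        intro a ha
        split_ifs with h
        · rw [hG.mul_unit_of_even hv hv0 ha h, one_mul]
        · rw [hG.mul_nonsquare hv hv0 hsq ha h, neg_one_mul]
      rw [key hXY, key hX, key h1, key hY, ord_mul hX hY, ord_one]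
      by_cases p1 : Even (ord Y) <;> by_cases p3 : Even ε <;>
        simp only [Int.even_add, p1, hX2, p3, Even.zero, iff_true, iff_false, iff_self, not_true,
          if_true, if_false] <;>
        first | linear_combination base | linear_combination -base

end IsWeilFunction

end Bilinear

/-! ### Matrix entries and bottom rows. -/

section SL

variable {F : Type*} [Field F]

lemma sl_mul_apply (g k : SL(2, F)) (i j : Fin 2) :
    (g * k) i j = g i 0 * k 0 j + g i 1 * k 1 j :=
  (Matrix.mul_apply (M := g.val) (N := k.val)).trans (Fin.sum_univ_two _)

lemma sl_det (g : SL(2, F)) : g 0 0 * g 1 1 - g 0 1 * g 1 0 = 1 := by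
  have := g.det_coe
  rwa [Matrix.det_fin_two] at this

lemma sl_row_ne_zero (g : SL(2, F)) : g 1 0 ≠ 0 ∨ g 1 1 ≠ 0 := row_ne_zero (sl_det g)

lemma kubotaX_ne_zero (g : SL(2, F)) : kubotaX g ≠ 0 := by
  rw [kubotaX_eq_lead]
  exact lead_ne_zero (sl_row_ne_zero g)

lemma sl_ext {g k : SL(2, F)} (h00 : g 0 0 = k 0 0) (h01 : g 0 1 = k 0 1) (h10 : g 1 0 = k 1 0)
    (h11 : g 1 1 = k 1 1) : g = k := by
  ext i j
  fin_cases i <;> fin_cases j <;> assumption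

/-- The lower triangular unipotent matrix with lower left entry `c`. -/
def lowerUnip (c : F) : SL(2, F) := ⟨!![1, 0; c, 1], by simp [Matrix.det_fin_two]⟩

@[simp] lemma lowerUnip_00 (c : F) : (lowerUnip c) 0 0 = 1 := rfl
@[simp] lemma lowerUnip_01 (c : F) : (lowerUnip c) 0 1 = 0 := rfl
@[simp] lemma lowerUnip_10 (c : F) : (lowerUnip c) 1 0 = c := rfl
@[simp] lemma lowerUnip_11 (c : F) : (lowerUnip c) 1 1 = 1 := rfl
@[simp] lemma unip_00 (b : F) : (unip b) 0 0 = 1 := rfl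
@[simp] lemma unip_01 (b : F) : (unip b) 0 1 = b := rfl
@[simp] lemma unip_10 (b : F) : (unip b) 1 0 = 0 := rfl
@[simp] lemma unip_11 (b : F) : (unip b) 1 1 = 1 := rfl
@[simp] lemma torus_00 (a : Fˣ) : (torus a) 0 0 = (a : F) := rfl
@[simp] lemma torus_01 (a : Fˣ) : (torus a) 0 1 = 0 := rfl
@[simp] lemma torus_10 (a : Fˣ) : (torus a) 1 0 = 0 := rfl
@[simp] lemma torus_11 (a : Fˣ) : (torus a) 1 1 = ((a⁻¹ : Fˣ) : F) := rfl

lemma torus_unip_row (a : Fˣ) (b : F) (g : SL(2, F)) (j : Fin 2) :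
    (torus a * unip b * g) 1 j = ((a⁻¹ : Fˣ) : F) * g 1 j := by
  simp [sl_mul_apply]

/-- Two matrices with proportional bottom rows differ by an upper triangular matrix. -/
lemma exists_eq_torus_unip_mul {g g' : SL(2, F)} (l : Fˣ) (h0 : g' 1 0 = l * g 1 0)
    (h1 : g' 1 1 = l * g 1 1) : ∃ b : F, g' = torus l⁻¹ * unip b * g := by
  have d := sl_det g
  have d' := sl_det g'
  rw [h0, h1] at d'
  have hl : (l : F) ≠ 0 := l.ne_zero
  refine ⟨l * (g' 0 1 * g 0 0 - g' 0 0 * g 0 1), sl_ext ?_ ?_ ?_ ?_⟩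
  · simp only [sl_mul_apply, torus_00, torus_01, unip_00, unip_01, unip_10, unip_11,
      Units.val_inv_eq_inv_val]
    field_simp
    linear_combination (-(l : F) * g' 0 0) * d + g 0 0 * d'
  · simp only [sl_mul_apply, torus_00, torus_01, unip_00, unip_01, unip_10, unip_11,
      Units.val_inv_eq_inv_val]
    field_simp
    linear_combination (-(l : F) * g' 0 1) * d + g 0 1 * d'
  · rw [torus_unip_row, inv_inv, h0]
  · rw [torus_unip_row, inv_inv, h1]

end SL

lemma IsSplitting.mul_eq {F : Type*} [Field F] {H : Subgroup SL(2, F)} {s : SL(2, F) → ℤˣ} (hs : IsSplitting H s)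
    {k k' : SL(2, F)} (hk : k ∈ H) (hk' : k' ∈ H) : s k * s k' * kubota k k' = s (k * k') :=
  congrArg Mp.sgn (hs k hk k' hk')

/-! ### The Kubota cocycle as a coboundary, and the splitting over K^ε_0. -/

section Splitting

variable {F : Type*} [Field F] [ValuativeRel F] [TopologicalSpace F]
  [IsNonarchimedeanLocalField F] {e : ℤ} {G : F → ℂ}

lemma sign_cast_eq {s t : ℤˣ} (h : ((s : ℤ) : ℂ) = ((t : ℤ) : ℂ)) : s = t :=
  Units.ext (Int.cast_injective h)

lemma sign_sq (s : ℤˣ) : ((s : ℤ) : ℂ) * ((s : ℤ) : ℂ) = 1 := by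
  rcases Int.units_eq_one_or s with rfl | rfl <;> norm_num

lemma sign_ne_zero (s : ℤˣ) : ((s : ℤ) : ℂ) ≠ 0 := left_ne_zero_of_mul_eq_one (sign_sq s)

/-- The function on `SL₂(F)` extending the splitting over the maximal compact subgroup. -/
noncomputable def cochain (e : ℤ) (G : F → ℂ) (g : SL(2, F)) : ℂ :=
  rowIndex e G (g 1 0) (g 1 1) * G (kubotaX g)

lemma IsWeilFunction.cochain_ne_zero (hG : IsWeilFunction e G) (g : SL(2, F)) :
    cochain e G g ≠ 0 :=
  mul_ne_zero (hG.rowIndex_ne_zero (sl_row_ne_zero g)) (hG.ne_zero (kubotaX_ne_zero g))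

lemma IsWeilFunction.hilbert_eq (hG : IsWeilFunction e G)
    (hp : ringChar 𝓀[F] ≠ 2) {a b : F} (ha : a ≠ 0) (hb : b ≠ 0) :
    ((hilbert a b : ℤ) : ℂ) = G a * G b * (G 1 * G (a * b))⁻¹ := by
  rw [hG.mul_eq_hilbert hp ha hb, mul_comm, inv_mul_cancel_left₀]
  exact mul_ne_zero (hG.ne_zero one_ne_zero) (hG.ne_zero (mul_ne_zero ha hb))

/-- The Kubota cocycle in terms of Weil indices. -/
lemma IsWeilFunction.kubota_eq (hG : IsWeilFunction e G) (hp : ringChar 𝓀[F] ≠ 2)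
    (g k : SL(2, F)) :
    ((kubota g k : ℤ) : ℂ) * (G (kubotaX g) * G (kubotaX k)) =
      G (kubotaX g * kubotaX k * kubotaX (g * k)) * G (kubotaX (g * k)) := by
  have hX := kubotaX_ne_zero g
  have hZ := kubotaX_ne_zero k
  have hY := kubotaX_ne_zero (g * k)
  unfold kubota
  set X := kubotaX g
  set Z := kubotaX k
  set Y := kubotaX (g * k)
  rw [hG.hilbert_eq hp (div_ne_zero hX hY) (div_ne_zero hZ hY)]
  have e1 : G (X / Y) = G (X * Y) :=
    hG.congr_sq (mul_ne_zero hX hY) (inv_ne_zero hY) (by field_simp)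
  have e2 : G (Z / Y) = G (Z * Y) :=
    hG.congr_sq (mul_ne_zero hZ hY) (inv_ne_zero hY) (by field_simp)
  have e3 : G (X / Y * (Z / Y)) = G (X * Z) :=
    hG.congr_sq (mul_ne_zero hX hZ) (inv_ne_zero hY) (by field_simp)
  rw [e1, e2, e3, mul_right_comm, hG.bilinear hX hY hZ, mul_right_comm, mul_inv_cancel₀, one_mul]
  exact mul_ne_zero (hG.ne_zero one_ne_zero) (hG.ne_zero (mul_ne_zero hX hZ))

/-- Membership in the maximal compact subgroup attached to `e`. -/
def IsCompactElt (e : ℤ) (k : SL(2, F)) : Prop :=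
  k 0 0 ∈ fracIdeal (F := F) 0 ∧ k 0 1 ∈ fracIdeal (F := F) (-e) ∧
    k 1 0 ∈ fracIdeal (F := F) e ∧ k 1 1 ∈ fracIdeal (F := F) 0

/-- The Kubota cocycle is the coboundary of `cochain` on pairs `(g, k)` with `k` in the maximal
compact subgroup. -/
lemma IsWeilFunction.kubota_mul_cochain (hG : IsWeilFunction e G) (hp : ringChar 𝓀[F] ≠ 2)
    (g : SL(2, F)) {k : SL(2, F)} (hk : IsCompactElt e k) :
    ((kubota g k : ℤ) : ℂ) * (cochain e G g * cochain e G k) = cochain e G (g * k) := by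
  have h1 := hG.kubota_eq hp g k
  have h2 := hG.rowIndex_mul hp (sl_det k) hk.1 hk.2.1 hk.2.2.1 hk.2.2.2 (sl_row_ne_zero g)
    (sl_mul_apply g k 1 0) (sl_mul_apply g k 1 1)
  rw [← kubotaX_eq_lead, ← kubotaX_eq_lead, ← kubotaX_eq_lead] at h2
  unfold cochain
  rw [← h2]
  linear_combination rowIndex e G (g 1 0) (g 1 1) * rowIndex e G (k 1 0) (k 1 1) * h1

/-- On an upper row ord c = ε, so G(c) = 1. On a lower row d is a unit, and the value is a quotient
of values of G whose arguments differ by d. Being a sign, `cochain` can define a section of the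
covering over K^ε_0. -/
lemma IsWeilFunction.cochain_eq_or (hG : IsWeilFunction e G) {k : SL(2, F)}
    (hk : IsCompactElt e k) : cochain e G k = 1 ∨ cochain e G k = -1 := by
  have h1 := one_ne_zero (α := F)
  unfold cochain
  by_cases hu : IsUpper e (k 1 0) (k 1 1)
  · obtain ⟨hc, ho⟩ := ord_eq_of_isUpper (sl_det k) hk.1 hk.2.1 hk.2.2.1 hu
    rw [rowIndex_of_isUpper hu, kubotaX_eq_lead, lead_of_ne hc, hG.eq_one hc (by rw [ho]; simp)]
    simp
  · obtain ⟨-, hd, ho, -, -⟩ := ord_eq_of_not_isUpper (sl_det k) hk.1 hk.2.1 hk.2.2.2 hu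
    by_cases hc : k 1 0 = 0
    · have g1 := hG.ne_zero h1
      rw [kubotaX_eq_lead, hc, rowIndex_zero, lead_zero]
      rcases hG.mul_unit_eq_or hd ho h1 with h | h <;> rw [mul_one] at h <;> rw [h]
      · exact Or.inl (inv_mul_cancel₀ g1)
      · right; rw [_root_.mul_neg, inv_mul_cancel₀ g1]
    · have g1 := hG.ne_zero hc
      rw [kubotaX_eq_lead, rowIndex_of_not hu hc, lead_of_ne hc, mul_comm (k 1 0)]
      rcases hG.mul_unit_eq_or hd ho hc with h | h <;> rw [h]
      · exact Or.inl (inv_mul_cancel₀ g1)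
      · right; rw [inv_neg, neg_mul, inv_mul_cancel₀ g1]

/-- Near the identity, `cochain` is `1`. -/
lemma IsWeilFunction.cochain_eq_one (hG : IsWeilFunction e G) (hp : ringChar 𝓀[F] ≠ 2)
    {k : SL(2, F)} (hc : k 1 0 ∈ fracIdeal (F := F) (e + 1)) (hd : k 1 1 - 1 ∈ fracIdeal 1) :
    cochain e G k = 1 := by
  have h1 := one_ne_zero (α := F)
  have hone := ord_one_add hd
  have ed : k 1 1 = 1 + (k 1 1 - 1) := by ring
  rw [← ed] at hone
  have hu : ¬ IsUpper e (k 1 0) (k 1 1) := (not_isUpper_iff (sl_row_ne_zero k)).mpr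
    ⟨hone.1, fracIdeal_mono (by omega) hc⟩
  unfold cochain
  by_cases hc0 : k 1 0 = 0
  · rw [kubotaX_eq_lead, hc0, rowIndex_zero, lead_zero]
    have := hG.mul_one_add hp h1 hd
    rw [← ed, one_mul] at this
    rw [this, inv_mul_cancel₀ (hG.ne_zero h1)]
  · rw [kubotaX_eq_lead, rowIndex_of_not hu hc0, lead_of_ne hc0]
    have := hG.mul_one_add hp hc0 hd
    rw [← ed] at this
    rw [this, inv_mul_cancel₀ (hG.ne_zero hc0)]

lemma mem_K_zero {ε : Fin 2} {k : SL(2, F)} :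
    k ∈ K (F := F) ε 0 ↔ IsCompactElt ((ε : ℕ) : ℤ) k := by
  change _ ∧ _ ∧ _ ∧ _ ↔ _ ∧ _ ∧ _ ∧ _
  simp

lemma mem_K {ε : Fin 2} {m : ℕ} {k : SL(2, F)} :
    k ∈ K (F := F) ε m ↔ k 0 0 ∈ fracIdeal (F := F) 0 ∧
      k 0 1 ∈ fracIdeal (F := F) (-((ε : ℕ) : ℤ)) ∧
      k 1 0 ∈ fracIdeal (F := F) ((m : ℤ) + ((ε : ℕ) : ℤ)) ∧ k 1 1 ∈ fracIdeal (F := F) 0 :=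
  Iff.rfl

lemma K_le_K_zero {ε : Fin 2} {m : ℕ} {k : SL(2, F)} (hk : k ∈ K (F := F) ε m) :
    k ∈ K (F := F) ε 0 := by
  rw [mem_K] at hk ⊢
  exact ⟨hk.1, hk.2.1, fracIdeal_mono (by omega) hk.2.2.1, hk.2.2.2⟩

/-- The covering splits uniquely over the maximal compact subgroup. -/
lemma IsSplitting.unique (hp : ringChar 𝓀[F] ≠ 2) {ε : Fin 2} {s s' : SL(2, F) → ℤˣ}
    (hs : IsSplitting (K (F := F) ε 0) s) (hs' : IsSplitting (K (F := F) ε 0) s')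
    {k : SL(2, F)} (hk : k ∈ K (F := F) ε 0) : s k = s' k := by
  have h2 := ord_two hp
  -- The ratio of two splittings is a homomorphism to {±1}. Since 2 is a unit, unipotent elements of
  -- K^ε_0 are squares there and r is trivial on them; it remains to write k as a product of such
  -- elements.
  set r : SL(2, F) → ℤˣ := fun k => s k * s' k with hr
  have hmul : ∀ {k k' : SL(2, F)}, k ∈ K (F := F) ε 0 → k' ∈ K (F := F) ε 0 →
      r (k * k') = r k * r k' := by
    intro k k' hk hk'
    rw [hr]
    simp only
    rw [← hs.mul_eq hk hk', ← hs'.mul_eq hk hk']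
    have := Int.units_mul_self (kubota k k')
    calc _ = s k * s k' * (s' k * s' k') * (kubota k k' * kubota k k') := by
          simp only [mul_comm, mul_left_comm, mul_assoc]
      _ = _ := by rw [this, mul_one]; simp only [mul_comm, mul_left_comm]
  have half : ∀ {x : F} {n : ℤ}, x ∈ fracIdeal n → x / 2 ∈ fracIdeal n := by
    intro x n hx
    rw [div_eq_mul_inv]
    exact fracIdeal_mul hx (mem_fracIdeal_of_le (ord_inv 2).ge) (by rw [h2.2]; omega)
  have one0 : (1 : F) ∈ fracIdeal 0 := mem_fracIdeal_of_le ord_one.ge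
  have memU : ∀ {x : F}, x ∈ fracIdeal (-((ε : ℕ) : ℤ)) → unip x ∈ K (F := F) ε 0 :=
    fun hx => mem_K_zero.mpr ⟨one0, hx, zero_mem_fracIdeal _, one0⟩
  have memL : ∀ {x : F}, x ∈ fracIdeal ((ε : ℕ) : ℤ) → lowerUnip x ∈ K (F := F) ε 0 :=
    fun hx => mem_K_zero.mpr ⟨one0, zero_mem_fracIdeal _, hx, one0⟩
  have hh : ∀ x : F, x = x / 2 + x / 2 := by
    intro x
    have := h2.1
    field_simp
    ring
  have rU : ∀ {x : F}, x ∈ fracIdeal (-((ε : ℕ) : ℤ)) → r (unip x) = 1 := by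
    intro x hx
    have e : unip x = unip (x / 2) * unip (x / 2) := by
      apply sl_ext <;> simp [sl_mul_apply, ← hh]
    rw [e, hmul (memU (half hx)) (memU (half hx)), Int.units_mul_self]
  have rL : ∀ {x : F}, x ∈ fracIdeal ((ε : ℕ) : ℤ) → r (lowerUnip x) = 1 := by
    intro x hx
    have e : lowerUnip x = lowerUnip (x / 2) * lowerUnip (x / 2) := by
      apply sl_ext <;> simp [sl_mul_apply, ← hh]
    rw [e, hmul (memL (half hx)) (memL (half hx)), Int.units_mul_self]
  have rUpper : ∀ {k : SL(2, F)}, k ∈ K (F := F) ε 0 → k 1 0 ≠ 0 →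
      ord (k 1 0) = ((ε : ℕ) : ℤ) → r k = 1 := by
    intro k hk hc ho
    obtain ⟨ha, hb, hc', hd⟩ := mem_K_zero.mp hk
    have hx : (k 0 0 - 1) / k 1 0 ∈ fracIdeal (-((ε : ℕ) : ℤ)) := by
      rw [div_eq_mul_inv]
      exact fracIdeal_mul (fracIdeal_sub ha one0) (mem_fracIdeal_of_le (ord_inv _).ge)
        (by omega)
    have hy : (k 1 1 - 1) / k 1 0 ∈ fracIdeal (-((ε : ℕ) : ℤ)) := by
      rw [div_eq_mul_inv]
      exact fracIdeal_mul (fracIdeal_sub hd one0) (mem_fracIdeal_of_le (ord_inv _).ge)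
        (by omega)
    -- Any matrix with c ≠ 0 is such a product of three unipotents; ord c = ε keeps the outer two in
    -- K^ε_0.
    have e : k = unip ((k 0 0 - 1) / k 1 0) * lowerUnip (k 1 0) * unip ((k 1 1 - 1) / k 1 0) := by
      have det := sl_det k
      apply sl_ext <;> simp only [sl_mul_apply, unip_00, unip_01, unip_10, unip_11, lowerUnip_00,
        lowerUnip_01, lowerUnip_10, lowerUnip_11] <;> field_simp
      · ring
      · linear_combination -det
      · ring
      · ring
    rw [e, hmul (mul_mem (memU hx) (memL hc')) (memU hy), hmul (memU hx) (memL hc'), rU hx, rL hc',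
      rU hy]
    rfl
  have key : r k = 1 := by
    have hk' := mem_K_zero.mp hk
    by_cases hu : IsUpper ((ε : ℕ) : ℤ) (k 1 0) (k 1 1)
    · obtain ⟨hc, ho⟩ := ord_eq_of_isUpper (sl_det k) hk'.1 hk'.2.1 hk'.2.2.1 hu
      exact rUpper hk hc ho
    · obtain ⟨-, hd, ho, hc, -⟩ :=
        ord_eq_of_not_isUpper (sl_det k) hk'.1 hk'.2.1 hk'.2.2.2 hu
      -- Since d is a unit and ord c > ε, right multiplication by the lower unipotent of t gives a
      -- lower left entry of order exactly ε.
      obtain ⟨t, ht, hto⟩ := exists_ord_eq (F := F) ((ε : ℕ) : ℤ)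
      have htm : t ∈ fracIdeal ((ε : ℕ) : ℤ) := mem_fracIdeal_of_le hto.ge
      have e10 : (k * lowerUnip t) 1 0 = k 1 1 * t + k 1 0 := by
        rw [sl_mul_apply, lowerUnip_00, lowerUnip_10]; ring
      have hdt : ord (k 1 1 * t) = ((ε : ℕ) : ℤ) := by rw [ord_mul hd ht]; omega
      have h3 := ord_add_of_mem (mul_ne_zero hd ht) (y := k 1 0) (by rwa [hdt])
      have h4 := rUpper (mul_mem hk (memL htm)) (by rw [e10]; exact h3.1)
        (by rw [e10, h3.2, hdt])
      rwa [hmul hk (memL htm), rL htm, mul_one] at h4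
  have := congrArg (· * s' k) key
  simpa [hr, mul_assoc, Int.units_mul_self] using this

/-- The splitting over the maximal compact subgroup is given by `cochain`. -/
lemma IsWeilFunction.splitting_eq {ε : Fin 2} (hG : IsWeilFunction ((ε : ℕ) : ℤ) G)
    (hp : ringChar 𝓀[F] ≠ 2) {k : SL(2, F)} (hk : k ∈ K (F := F) ε 0) :
    ((splitting ε k : ℤ) : ℂ) = cochain ((ε : ℕ) : ℤ) G k := by
  classical
  set s : SL(2, F) → ℤˣ := fun k => if cochain ((ε : ℕ) : ℤ) G k = 1 then 1 else -1 with hsdef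
  have hs : ∀ {k}, k ∈ K (F := F) ε 0 → ((s k : ℤ) : ℂ) = cochain ((ε : ℕ) : ℤ) G k := by
    intro k hk
    rw [hsdef]
    rcases hG.cochain_eq_or (mem_K_zero.mp hk) with h | h
    · simp [h]
    · have : (-1 : ℂ) ≠ 1 := by norm_num
      simp [h, this]
  have hsplit : IsSplitting (K (F := F) ε 0) s := by
    intro k hk k' hk'
    refine Mp.ext rfl (sign_cast_eq ?_)
    change (((s k * s k' * kubota k k' : ℤˣ) : ℤ) : ℂ) = ((s (k * k') : ℤ) : ℂ)
    rw [hs (mul_mem hk hk'), ← hG.kubota_mul_cochain hp k (mem_K_zero.mp hk'), Units.val_mul,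
      Units.val_mul, Int.cast_mul, Int.cast_mul, hs hk, hs hk', mul_comm]
  have hex : ∃ s : SL(2, F) → ℤˣ, IsSplitting (K (F := F) ε 0) s := ⟨s, hsplit⟩
  have h1 : IsSplitting (K (F := F) ε 0) (splitting ε) := by
    rw [splitting, dif_pos hex]
    exact hex.choose_spec
  rw [h1.unique hp hsplit hk, hs hk]

end Splitting

/-! ### Characters of 𝒪ˣ as functions on F. -/

section EvalUnit

variable {F : Type*} [Field F] [ValuativeRel F] [TopologicalSpace F]

lemma evalUnit_coe (η : 𝒪[F]ˣ →ₜ* ℂˣ) (u : 𝒪[F]ˣ) :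
    evalUnit η ((u : 𝒪[F]) : F) = ((η u : ℂˣ) : ℂ) := by
  have h : ∃ v : 𝒪[F]ˣ, ((v : 𝒪[F]) : F) = ((u : 𝒪[F]) : F) := ⟨u, rfl⟩
  rw [evalUnit, dif_pos h]
  have : h.choose = u := Units.ext (Subtype.ext h.choose_spec)
  rw [this]

lemma evalUnit_ne_zero (η : 𝒪[F]ˣ →ₜ* ℂˣ) (d : F) : evalUnit η d ≠ 0 := by
  unfold evalUnit
  split_ifs
  · exact Units.ne_zero _
  · exact one_ne_zero

lemma evalUnit_mul_char (η η' : 𝒪[F]ˣ →ₜ* ℂˣ) (x : F) :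
    evalUnit (η * η') x = evalUnit η x * evalUnit η' x := by
  unfold evalUnit
  split_ifs
  · exact Units.val_mul _ _
  · rw [mul_one]

lemma evalUnit_inv_char (η : 𝒪[F]ˣ →ₜ* ℂˣ) (x : F) :
    evalUnit η⁻¹ x = (evalUnit η x)⁻¹ := by
  unfold evalUnit
  split_ifs
  · exact Units.val_inv_eq_inv_val _
  · rw [inv_one]

lemma evalUnit_trivial (d : F) : evalUnit (1 : 𝒪[F]ˣ →ₜ* ℂˣ) d = 1 := by
  unfold evalUnit
  split_ifs
  · rfl
  · rfl

lemma evalUnit_one (η : 𝒪[F]ˣ →ₜ* ℂˣ) : evalUnit η 1 = 1 := by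
  have := evalUnit_coe η 1
  rwa [map_one] at this

lemma evalUnit_neg_one (η : 𝒪[F]ˣ →ₜ* ℂˣ) : evalUnit η (-1) = ((η (-1) : ℂˣ) : ℂ) := by
  have := evalUnit_coe η (-1)
  simpa using this

end EvalUnit

/-! ### Left multiplication by upper triangular elements. -/

section Kubota

variable {F : Type*} [Field F]

/-- The cocycle is trivial on (t(a), n(b)) because one argument of the symbol is 1. On the second
product 𝐱 is scaled by a⁻¹, which leaves a single symbol. -/
lemma torus_unip_mul (a : Fˣ) (s : ℤˣ) (b : F) (x : Mp F) :
    (⟨torus a, s⟩ * ⟨unip b, 1⟩ * x : Mp F) =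
      ⟨torus a * unip b * x.mat, s * x.sgn * hilbert (kubotaX x.mat)⁻¹ (a : F)⟩ := by
  have ha : ((a⁻¹ : Fˣ) : F) ≠ 0 := Units.ne_zero _
  have hX := kubotaX_ne_zero x.mat
  have x1 : kubotaX (torus a) = ((a⁻¹ : Fˣ) : F) := by simp [kubotaX_eq_lead]
  have x2 : kubotaX (unip b) = (1 : F) := by simp [kubotaX_eq_lead]
  have x3 : kubotaX (torus a * unip b) = ((a⁻¹ : Fˣ) : F) := by
    simp [kubotaX_eq_lead, sl_mul_apply]
  have x4 : kubotaX (torus a * unip b * x.mat) = ((a⁻¹ : Fˣ) : F) * kubotaX x.mat := by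
    rw [kubotaX_eq_lead, torus_unip_row, torus_unip_row, lead_smul ha, ← kubotaX_eq_lead]
  refine Mp.ext rfl ?_
  change s * 1 * kubota (torus a) (unip b) * x.sgn * kubota (torus a * unip b) x.mat = _
  have k1 : kubota (torus a) (unip b) = 1 := by
    rw [kubota, x1, x2, x3, div_self ha]
    exact hilbert_of_isSquare (s := 1) (by simp) _
  have k2 : kubota (torus a * unip b) x.mat = hilbert (kubotaX x.mat)⁻¹ (a : F) := by
    rw [kubota, x3, x4]
    congr 1
    · field_simp
    · rw [Units.val_inv_eq_inv_val]; field_simp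
  rw [k1, k2, mul_one, mul_one]

lemma continuous_sl_apply [TopologicalSpace F] (i j : Fin 2) : Continuous fun g : SL(2, F) => g i j :=
  (continuous_apply_apply i j).comp continuous_subtype_val

end Kubota

/-! ### Conductors and the character of the torus. -/

section Characters

variable {F : Type*} [Field F] [ValuativeRel F] [TopologicalSpace F]
  [IsNonarchimedeanLocalField F]

lemma evalUnit_mul (η : 𝒪[F]ˣ →ₜ* ℂˣ) {x y : F} (hx : x ≠ 0) (hx0 : ord x = 0) (hy : y ≠ 0)
    (hy0 : ord y = 0) : evalUnit η (x * y) = evalUnit η x * evalUnit η y := by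
  obtain ⟨u, rfl⟩ := exists_unit hx hx0
  obtain ⟨v, rfl⟩ := exists_unit hy hy0
  have := evalUnit_coe η (u * v)
  rw [map_mul, Units.val_mul, Units.val_mul, Subring.coe_mul] at this
  rw [this, evalUnit_coe, evalUnit_coe]

lemma evalUnit_inv (η : 𝒪[F]ˣ →ₜ* ℂˣ) {x : F} (hx : x ≠ 0) (hx0 : ord x = 0) :
    evalUnit η x⁻¹ = (evalUnit η x)⁻¹ := by
  refine eq_inv_of_mul_eq_one_left ?_
  rw [← evalUnit_mul η (inv_ne_zero hx) (by rw [ord_inv, hx0, neg_zero]) hx hx0,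
    inv_mul_cancel₀ hx, evalUnit_one]

lemma evalUnit_resUnits (μ : Fˣ →ₜ* ℂˣ) (a : Fˣ) (ha : ord (a : F) = 0) :
    evalUnit (resUnits μ) (a : F) = ((μ a : ℂˣ) : ℂ) := by
  obtain ⟨u, hu⟩ := exists_unit a.ne_zero ha
  have h : Units.map (𝒪[F].subtype : 𝒪[F] →* F) u = a := Units.ext hu
  rw [← hu, evalUnit_coe, ← h]
  rfl

/-- `n` is at least the conductor if and only if the character is trivial on `1 + 𝔭 ^ n`. -/
lemma cond_le_iff {η : 𝒪[F]ˣ →ₜ* ℂˣ} {n : ℕ} : cond η ≤ n ↔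
    ∀ d : F, d ≠ 0 → ord d = 0 → d - 1 ∈ fracIdeal n → evalUnit η d = 1 := by
  have mem : ∀ k : ℕ, (∀ u : 𝒪[F]ˣ, (u : 𝒪[F]) - 1 ∈ 𝓂[F] ^ k → η u = 1) ↔
      ∀ d : F, d ≠ 0 → ord d = 0 → d - 1 ∈ fracIdeal k → evalUnit η d = 1 := by
    intro k
    constructor
    · intro h d hd hd0 hk
      obtain ⟨u, rfl⟩ := exists_unit hd hd0
      rw [evalUnit_coe, h u (mem_maximalIdeal_pow_iff.mpr (by simpa using hk)), Units.val_one]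
    · intro h u hu
      have := h _ (unit_ne_zero u) (ord_unit u)
        (by simpa using mem_maximalIdeal_pow_iff.mp hu)
      rw [evalUnit_coe] at this
      exact Units.ext this
  rw [← mem]
  constructor
  · intro h u hu
    exact Nat.sInf_mem (exists_trivial_on η) u (Ideal.pow_le_pow_right h hu)
  · intro h
    exact Nat.sInf_le h

lemma evalUnit_eq_one {η : 𝒪[F]ˣ →ₜ* ℂˣ} {n : ℕ} (h : cond η ≤ n) {d : F} (hd : d ≠ 0)
    (hd0 : ord d = 0) (hn : d - 1 ∈ fracIdeal n) : evalUnit η d = 1 :=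
  cond_le_iff.mp h d hd hd0 hn

lemma cond_eq_zero_iff {η : 𝒪[F]ˣ →ₜ* ℂˣ} : cond η = 0 ↔ η = 1 := by
  constructor
  · intro h
    ext u
    have := evalUnit_eq_one h.le (unit_ne_zero u) (ord_unit u)
      (by simpa using mem_integer_iff.mp ((u : 𝒪[F]) - 1).2)
    rw [evalUnit_coe] at this
    simpa using this
  · rintro rfl
    have : cond (1 : 𝒪[F]ˣ →ₜ* ℂˣ) ≤ 0 := by
      rw [cond_le_iff]
      intro d hd hd0 _
      obtain ⟨u, rfl⟩ := exists_unit hd hd0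
      rw [evalUnit_coe]
      rfl
    omega

lemma cond_inv (η : 𝒪[F]ˣ →ₜ* ℂˣ) : cond η⁻¹ = cond η := by
  have : ∀ n, cond η⁻¹ ≤ n ↔ cond η ≤ n := by
    intro n
    simp only [cond_le_iff, evalUnit_inv_char, inv_eq_one]
  exact le_antisymm ((this _).mpr le_rfl) ((this _).mp le_rfl)

lemma cond_mul_le (η η' : 𝒪[F]ˣ →ₜ* ℂˣ) : cond (η * η') ≤ max (cond η) (cond η') := by
  rw [cond_le_iff]
  intro d hd hd0 h
  rw [evalUnit_mul_char, evalUnit_eq_one (le_max_left _ _) hd hd0 h,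
    evalUnit_eq_one (le_max_right _ _) hd hd0 h, mul_one]

/-- Conductors are ultrametric: writing η' = η⁻¹(ηη') shows that the product cannot have a smaller
conductor than η'. -/
lemma cond_mul_of_lt {η η' : 𝒪[F]ˣ →ₜ* ℂˣ} (h : cond η < cond η') :
    cond (η * η') = cond η' := by
  have h1 := cond_mul_le η η'
  have h2 := cond_mul_le η⁻¹ (η * η')
  rw [cond_inv, inv_mul_cancel_left] at h2
  rcases le_total (cond η) (cond (η * η')) with h3 | h3
  · rw [max_eq_right h3] at h2
    rw [max_eq_right h.le] at h1
    omega
  · rw [max_eq_left h3] at h2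
    omega

/-- An upper row in K^ε_0 has a left entry of order exactly ε, which is excluded for m > 0. -/
lemma K_entry_unit {ε : Fin 2} {m : ℕ} (hm : m ≠ 0) {k : SL(2, F)} (hk : k ∈ K (F := F) ε m) :
    k 1 1 ≠ 0 ∧ ord (k 1 1) = 0 := by
  obtain ⟨ha, hb, hc, hd⟩ := mem_K.mp hk
  have hu : ¬ IsUpper ((ε : ℕ) : ℤ) (k 1 0) (k 1 1) := by
    intro hu
    have h := ord_eq_of_isUpper (sl_det k) ha hb (fracIdeal_mono (by omega) hc) hu
    have := le_ord_of_mem h.1 hc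
    omega
  have := ord_eq_of_not_isUpper (sl_det k) ha hb hd hu
  exact ⟨this.2.1, this.2.2.1⟩

/-- `k ↦ η(d)` is multiplicative on `K_m` if `m` is at least the conductor of `η`. -/
lemma evalUnit_K_mul {ε : Fin 2} {m : ℕ} {η : 𝒪[F]ˣ →ₜ* ℂˣ} (hη : cond η ≤ m)
    {k k' : SL(2, F)} (hk : k ∈ K (F := F) ε m) (hk' : k' ∈ K (F := F) ε m) :
    evalUnit η ((k * k') 1 1) = evalUnit η (k 1 1) * evalUnit η (k' 1 1) := by
  by_cases hm : m = 0
  · have : η = 1 := cond_eq_zero_iff.mp (by omega)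
    simp only [this, evalUnit_trivial, mul_one]
  · obtain ⟨h1, h1'⟩ := K_entry_unit hm hk
    obtain ⟨h2, h2'⟩ := K_entry_unit hm hk'
    have h12 := mul_ne_zero h1 h2
    have o12 : ord (k 1 1 * k' 1 1) = 0 := by rw [ord_mul h1 h2]; omega
    -- The contributions of ε to c and b' cancel, so the correction cb' lies in 𝔭^m and η does not
    -- see it.
    have hy : k 1 0 * k' 0 1 * (k 1 1 * k' 1 1)⁻¹ ∈ fracIdeal m :=
      fracIdeal_mul (fracIdeal_mul hk.2.2.1 hk'.2.1 le_rfl) (mem_fracIdeal_of_le le_rfl)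
        (by rw [ord_inv]; omega)
    have hone := ord_one_add (fracIdeal_mono (by omega) hy)
    have e : (k * k') 1 1 = k 1 1 * k' 1 1 * (1 + k 1 0 * k' 0 1 * (k 1 1 * k' 1 1)⁻¹) := by
      rw [sl_mul_apply, mul_add, mul_one, mul_comm (k 1 0 * k' 0 1), mul_inv_cancel_left₀ h12,
        add_comm]
    rw [e, evalUnit_mul η h12 o12 hone.1 hone.2, evalUnit_mul η h1 h1' h2 h2',
      evalUnit_eq_one hη hone.1 hone.2 (by simpa using hy), mul_one]

lemma normAbs_eq (a : Fˣ) : normAbs a = (Nat.card 𝓀[F] : ℝ) ^ (-ord (a : F)) := by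
  rw [normAbs, ord, neg_neg]

lemma card_residue_ne_zero : (Nat.card 𝓀[F] : ℝ) ≠ 0 := by
  exact_mod_cast Nat.card_pos.ne'

lemma normAbs_mul (a b : Fˣ) : normAbs (a * b) = normAbs a * normAbs b := by
  rw [normAbs_eq, normAbs_eq, normAbs_eq, Units.val_mul, ord_mul a.ne_zero b.ne_zero, neg_add,
    zpow_add₀ card_residue_ne_zero]

lemma normAbs_ne_zero (a : Fˣ) : normAbs a ≠ 0 := by
  rw [normAbs_eq]
  exact zpow_ne_zero _ card_residue_ne_zero

lemma normAbs_of_ord {a : Fˣ} (h : ord (a : F) = 0) : normAbs a = 1 := by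
  rw [normAbs_eq, h, neg_zero, zpow_zero]

/-- The character `a ↦ |a| μ(a)` of the torus. -/
noncomputable def torusChar (μ : Fˣ →ₜ* ℂˣ) : Fˣ →* ℂ where
  toFun a := (normAbs a : ℂ) * ((μ a : ℂˣ) : ℂ)
  map_one' := by rw [normAbs_of_ord (by simp), map_one]; simp
  map_mul' a b := by
    rw [normAbs_mul, map_mul]
    push_cast
    ring

lemma torusChar_apply (μ : Fˣ →ₜ* ℂˣ) (a : Fˣ) :
    torusChar μ a = (normAbs a : ℂ) * ((μ a : ℂˣ) : ℂ) := rfl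

lemma torusChar_ne_zero (μ : Fˣ →ₜ* ℂˣ) (a : Fˣ) : torusChar μ a ≠ 0 :=
  mul_ne_zero (by exact_mod_cast normAbs_ne_zero a) (Units.ne_zero _)

lemma torusChar_of_ord (μ : Fˣ →ₜ* ℂˣ) {a : Fˣ} (h : ord (a : F) = 0) :
    torusChar μ a = evalUnit (resUnits μ) (a : F) := by
  rw [torusChar_apply, normAbs_of_ord h, evalUnit_resUnits μ a h]
  simp

end Characters

/-! ### Equivariant functions on SL₂(F). -/

section Reduction

variable {F : Type*} [Field F] [ValuativeRel F] [TopologicalSpace F]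
  [IsNonarchimedeanLocalField F]

/-- `g'` arises from `g` by left multiplication by an upper triangular matrix and right
multiplication by an element of `K_m`, and the corresponding value of the characters is `z`. -/
def OrbitRel (μ : Fˣ →ₜ* ℂˣ) (η : 𝒪[F]ˣ →ₜ* ℂˣ) (ε : Fin 2) (m : ℕ) (g g' : SL(2, F))
    (z : ℂ) : Prop :=
  ∃ (l : Fˣ) (k : SL(2, F)), k ∈ K (F := F) ε m ∧ g' 1 0 = l * (g * k) 1 0 ∧
    g' 1 1 = l * (g * k) 1 1 ∧ z = (torusChar μ l)⁻¹ * evalUnit η (k 1 1)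

/-- The functions on `X` which transform according to the scalar-valued relation `T`. -/
def equivariantFunctions {X : Type*} (T : X → X → ℂ → Prop) : Submodule ℂ (X → ℂ) where
  carrier := {θ | ∀ x y z, T x y z → θ y = z * θ x}
  zero_mem' := by simp
  add_mem' := by
    intro θ θ' h h' x y z hT
    simp only [Pi.add_apply, h x y z hT, h' x y z hT, mul_add]
  smul_mem' := by
    intro c θ h x y z hT
    simp only [Pi.smul_apply, smul_eq_mul, h x y z hT]
    ring

variable {ψ : AddChar F ℂ} {μ : Fˣ →ₜ* ℂˣ} {η : 𝒪[F]ˣ →ₜ* ℂˣ} {ε : Fin 2} {m : ℕ}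

lemma weilRatio_eq (a : F) :
    weilRatio a ψ = weilIndex (ψ.mulShift a) / weilIndex (ψ.mulShift 1) := by
  rw [AddChar.mulShift_one, weilRatio]

/-- `rowIndex` ignores the scaling of the row by a⁻¹, so only the factor G(𝐱) changes. By
`mul_eq_hilbert` the change is the symbol from the group law times G(a)/G(1). -/
lemma cochain_torus_unip {e : ℤ} {G : F → ℂ} (hG : IsWeilFunction e G)
    (hp : ringChar 𝓀[F] ≠ 2) (a : Fˣ) (b : F) (g : SL(2, F)) :
    cochain e G (torus a * unip b * g) * (G 1 / G a) =
      ((hilbert (kubotaX g)⁻¹ (a : F) : ℤ) : ℂ) * cochain e G g := by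
  have ha : ((a⁻¹ : Fˣ) : F) ≠ 0 := Units.ne_zero _
  have hX := kubotaX_ne_zero g
  have hXi := inv_ne_zero hX
  have ha' := a.ne_zero
  have h := hG.mul_eq_hilbert hp hXi ha'
  have e1 : G (kubotaX g)⁻¹ = G (kubotaX g) := hG.congr_sq hX hXi (by field_simp)
  have e2 : G ((kubotaX g)⁻¹ * a) = G (((a⁻¹ : Fˣ) : F) * kubotaX g) :=
    hG.congr_sq (mul_ne_zero ha hX) (s := a * (kubotaX g)⁻¹) (mul_ne_zero ha' hXi)
      (by rw [Units.val_inv_eq_inv_val]; field_simp)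
  rw [e1, e2] at h
  have hs := sign_sq (hilbert (kubotaX g)⁻¹ (a : F))
  unfold cochain
  rw [torus_unip_row, torus_unip_row, hG.rowIndex_smul ha (sl_row_ne_zero g), kubotaX_eq_lead,
    torus_unip_row, torus_unip_row, lead_smul ha, ← kubotaX_eq_lead]
  have hGa := hG.ne_zero ha'
  have key : G (((a⁻¹ : Fˣ) : F) * kubotaX g) * (G 1 / G a) =
      ((hilbert (kubotaX g)⁻¹ (a : F) : ℤ) : ℂ) * G (kubotaX g) := by
    rw [mul_div_assoc', div_eq_iff hGa, mul_assoc, h]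
    linear_combination -(G 1 * G (((a⁻¹ : Fˣ) : F) * kubotaX g)) * hs
  rw [mul_assoc, key]
  ring

/-- The defining equation at a = 1, b = 0 says that the kernel of the covering acts by the sign. -/
lemma mem_principalSeries_sgn (hG : IsWeilFunction ((ε : ℕ) : ℤ)
    fun a : F => weilIndex (ψ.mulShift a)) {f : Mp F → ℂ} (hf : f ∈ principalSeries ψ μ)
    (g : SL(2, F)) (s : ℤˣ) : f ⟨g, s⟩ = ((s : ℤ) : ℂ) * f ⟨g, 1⟩ := by
  have h := hf.2 1 s 0 ⟨g, 1⟩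
  rw [torus_unip_mul] at h
  have e1 : (torus (1 : Fˣ) * unip 0 * g : SL(2, F)) = g := by
    have t1 : (torus (1 : Fˣ) : SL(2, F)) = 1 := by apply sl_ext <;> simp
    have t2 : (unip (0 : F) : SL(2, F)) = 1 := by apply sl_ext <;> simp
    rw [t1, t2, one_mul, one_mul]
  have e2 : hilbert (kubotaX g)⁻¹ ((1 : Fˣ) : F) = 1 := by
    rw [hilbert_symm]
    exact hilbert_of_isSquare (s := 1) (by simp) _
  have e3 : weilRatio ((1 : Fˣ) : F) ψ = 1 := by
    rw [weilRatio_eq, Units.val_one]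
    exact div_self (hG.ne_zero one_ne_zero)
  have e4 : (normAbs (1 : Fˣ) : ℂ) * ((μ 1 : ℂˣ) : ℂ) = 1 := by
    rw [← torusChar_apply, map_one]
  rw [chiPsi, e3, e4] at h
  simp only [e1, e2] at h
  simpa using h

lemma mem_isotypic_iff (hη : cond η ≤ m) {V : Submodule ℂ (Mp F → ℂ)} {f : Mp F → ℂ} :
    f ∈ isotypic V ε m η ↔ f ∈ V ∧ ∀ k ∈ K (F := F) ε m, ∀ x : Mp F,
      f (x * ⟨k, splitting ε k⟩) = evalUnit η (k 1 1) * f x := by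
  rw [isotypic, if_pos hη, Submodule.mem_inf]
  simp only [Submodule.mem_iInf, LinearMap.mem_ker, LinearMap.sub_apply, sub_eq_zero,
    LinearMap.smul_apply, LinearMap.id_apply]
  refine and_congr_right fun _ => forall_congr' fun k => forall_congr' fun _ => ?_
  rw [funext_iff]
  rfl

lemma entries_mem_nhds (n : ℤ) : {u : SL(2, F) | ∀ i j, u i j - (1 : SL(2, F)) i j ∈
    fracIdeal (F := F) n} ∈ 𝓝 (1 : SL(2, F)) := by
  have : {u : SL(2, F) | ∀ i j, u i j - (1 : SL(2, F)) i j ∈ fracIdeal (F := F) n} =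
      ⋂ i, ⋂ j, (fun u : SL(2, F) => u i j - (1 : SL(2, F)) i j) ⁻¹' fracIdeal n := by
    ext u; simp
  rw [this]
  refine Filter.iInter_mem.mpr fun i => Filter.iInter_mem.mpr fun j => ?_
  refine ContinuousAt.preimage_mem_nhds
    ((continuous_sl_apply i j).sub continuous_const).continuousAt ?_
  rw [sub_self]
  exact fracIdeal_mem_nhds n

end Reduction

/-! ### Removal of the covering group. -/

section Reduction

variable {F : Type*} [Field F] [ValuativeRel F] [TopologicalSpace F]
  [IsNonarchimedeanLocalField F] {e : ℤ} {G : F → ℂ}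
  {ψ : AddChar F ℂ} {μ : Fˣ →ₜ* ℂˣ} {η : 𝒪[F]ˣ →ₜ* ℂˣ} {ε : Fin 2} {m : ℕ}

/-- The genuine function `(g, s) ↦ s / cochain g` on the metaplectic group. -/
noncomputable def genuineSign (e : ℤ) (G : F → ℂ) (x : Mp F) : ℂ :=
  ((x.sgn : ℤ) : ℂ) * (cochain e G x.mat)⁻¹

lemma IsWeilFunction.genuineSign_ne_zero (hG : IsWeilFunction e G) (x : Mp F) :
    genuineSign e G x ≠ 0 :=
  mul_ne_zero (sign_ne_zero _) (inv_ne_zero (hG.cochain_ne_zero _))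

/-- The symbol in the group law cancels the one in `cochain_torus_unip`, and exactly the genuine
character χ_ψ of the torus remains. -/
lemma IsWeilFunction.genuineSign_torus_unip (hG : IsWeilFunction e G)
    (hp : ringChar 𝓀[F] ≠ 2) (a : Fˣ) (s : ℤˣ) (b : F) (x : Mp F) :
    genuineSign e G (⟨torus a, s⟩ * ⟨unip b, 1⟩ * x) =
      ((s : ℤ) : ℂ) * (G a / G 1)⁻¹ * genuineSign e G x := by
  have h := cochain_torus_unip hG hp a b x.mat
  have c1 := hG.cochain_ne_zero (torus a * unip b * x.mat)
  have c2 := hG.cochain_ne_zero x.mat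
  rw [torus_unip_mul]
  unfold genuineSign
  rw [inv_div, ← div_eq_mul_inv, div_eq_iff c1]
  push_cast
  have : ((s : ℤ) : ℂ) * (G 1 / G a) * (((x.sgn : ℤ) : ℂ) * (cochain e G x.mat)⁻¹) *
      cochain e G (torus a * unip b * x.mat) = ((s : ℤ) : ℂ) * ((x.sgn : ℤ) : ℂ) *
      (cochain e G (torus a * unip b * x.mat) * (G 1 / G a)) * (cochain e G x.mat)⁻¹ := by ring
  rw [this, h]
  field_simp

/-- The splitting is `cochain` on K^ε_0, so this is `kubota_mul_cochain` read backwards. -/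
lemma IsWeilFunction.genuineSign_mul_splitting (hG : IsWeilFunction ((ε : ℕ) : ℤ) G)
    (hp : ringChar 𝓀[F] ≠ 2) (x : Mp F) {k : SL(2, F)} (hk : k ∈ K (F := F) ε 0) :
    genuineSign ((ε : ℕ) : ℤ) G (x * ⟨k, splitting ε k⟩) = genuineSign ((ε : ℕ) : ℤ) G x := by
  have h := hG.kubota_mul_cochain hp x.mat (mem_K_zero.mp hk)
  have c1 := hG.cochain_ne_zero (x.mat * k)
  have c2 := hG.cochain_ne_zero x.mat
  have s2 := sign_sq (kubota x.mat k)
  change (((x.sgn * splitting ε k * kubota x.mat k : ℤˣ) : ℤ) : ℂ) *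
    (cochain _ G (x.mat * k))⁻¹ = _
  unfold genuineSign
  push_cast
  rw [hG.splitting_eq hp hk, ← div_eq_mul_inv, div_eq_iff c1, ← h]
  field_simp

lemma eq_genuineSign_mul (hG : IsWeilFunction ((ε : ℕ) : ℤ)
    fun a : F => weilIndex (ψ.mulShift a)) {f : Mp F → ℂ} (hf : f ∈ principalSeries ψ μ)
    (x : Mp F) : f x = genuineSign ((ε : ℕ) : ℤ) (fun a => weilIndex (ψ.mulShift a)) x *
      (cochain ((ε : ℕ) : ℤ) (fun a => weilIndex (ψ.mulShift a)) x.mat * f ⟨x.mat, 1⟩) := by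
  rw [genuineSign, mul_assoc, inv_mul_cancel_left₀ (hG.cochain_ne_zero _)]
  exact mem_principalSeries_sgn hG hf x.mat x.sgn

lemma principalSeries_torus {f : Mp F → ℂ} (hf : f ∈ principalSeries ψ μ) (a : Fˣ) (s : ℤˣ) (b : F)
    (x : Mp F) : f (⟨torus a, s⟩ * ⟨unip b, 1⟩ * x) = torusChar μ a * (((s : ℤ) : ℂ) *
      (weilIndex (ψ.mulShift (a : F)) / weilIndex (ψ.mulShift 1))⁻¹) * f x := by
  rw [hf.2, chiPsi, weilRatio_eq]
  rfl

/-- The value of f at a product t·n·g·k is expanded once by the transformation laws of f and once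
through `genuineSign`. On comparison every trace of the covering cancels. -/
lemma cochain_mul_mem_equivariantFunctions (hp : ringChar 𝓀[F] ≠ 2)
    (hG : IsWeilFunction ((ε : ℕ) : ℤ) fun a : F => weilIndex (ψ.mulShift a)) (hη : cond η ≤ m)
    {f : Mp F → ℂ} (hf : f ∈ isotypic (principalSeries ψ μ) ε m η) :
    (fun g => cochain ((ε : ℕ) : ℤ) (fun a => weilIndex (ψ.mulShift a)) g * f ⟨g, 1⟩) ∈
      equivariantFunctions (OrbitRel μ η ε m) := by
  obtain ⟨hV, hK⟩ := (mem_isotypic_iff hη).mp hf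
  rintro g g' z ⟨l, k, hk, h0, h1, rfl⟩
  obtain ⟨b, rfl⟩ := exists_eq_torus_unip_mul l h0 h1
  have z0 := hG.genuineSign_ne_zero ⟨g, 1⟩
  have z1 : (weilIndex (ψ.mulShift ((l⁻¹ : Fˣ) : F)) / weilIndex (ψ.mulShift 1))⁻¹ ≠ 0 :=
    inv_ne_zero (div_ne_zero (hG.ne_zero l⁻¹.ne_zero) (hG.ne_zero one_ne_zero))
  have t1 := principalSeries_torus hV l⁻¹ 1 b (⟨g, 1⟩ * ⟨k, splitting ε k⟩)
  have n1 := hG.genuineSign_torus_unip hp l⁻¹ 1 b (⟨g, 1⟩ * ⟨k, splitting ε k⟩)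
  rw [hG.genuineSign_mul_splitting hp ⟨g, 1⟩ (K_le_K_zero hk)] at n1
  have e1 := eq_genuineSign_mul hG hV (⟨torus l⁻¹, 1⟩ * ⟨unip b, 1⟩ * (⟨g, 1⟩ * ⟨k, splitting ε k⟩))
  rw [t1, n1, hK k hk, eq_genuineSign_mul hG hV ⟨g, 1⟩] at e1
  have e : (⟨torus l⁻¹, 1⟩ * ⟨unip b, 1⟩ * (⟨g, 1⟩ * ⟨k, splitting ε k⟩) : Mp F).mat =
    torus l⁻¹ * unip b * (g * k) := rfl
  have t2 : torusChar μ l⁻¹ = (torusChar μ l)⁻¹ :=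
    eq_inv_of_mul_eq_one_left (by rw [← map_mul, inv_mul_cancel, map_one])
  rw [e, t2, Units.val_one, Int.cast_one, one_mul] at e1
  beta_reduce at e1 z0 ⊢
  refine mul_left_cancel₀ (mul_ne_zero z1 z0) (e1.symm.trans ?_)
  ring

lemma genuineSign_mul_mem_isotypic (hp : ringChar 𝓀[F] ≠ 2)
    (hG : IsWeilFunction ((ε : ℕ) : ℤ) fun a : F => weilIndex (ψ.mulShift a)) (hη : cond η ≤ m)
    {θ : SL(2, F) → ℂ} (hθ : θ ∈ equivariantFunctions (OrbitRel μ η ε m)) :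
    (fun x : Mp F => genuineSign ((ε : ℕ) : ℤ) (fun a => weilIndex (ψ.mulShift a)) x * θ x.mat) ∈
      isotypic (principalSeries ψ μ) ε m η := by
  have hK : ∀ (g : SL(2, F)) {k : SL(2, F)}, k ∈ K (F := F) ε m →
      θ (g * k) = evalUnit η (k 1 1) * θ g := by
    intro g k hk
    refine hθ g (g * k) _ ⟨1, k, hk, ?_, ?_, ?_⟩ <;> simp
  have hN : ∀ x : Mp F, ∀ k ∈ K (F := F) ε m,
      genuineSign ((ε : ℕ) : ℤ) (fun a => weilIndex (ψ.mulShift a)) (x * ⟨k, splitting ε k⟩) *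
        θ (x * ⟨k, splitting ε k⟩ : Mp F).mat = evalUnit η (k 1 1) *
      (genuineSign ((ε : ℕ) : ℤ) (fun a => weilIndex (ψ.mulShift a)) x * θ x.mat) := by
    intro x k hk
    rw [hG.genuineSign_mul_splitting hp x (K_le_K_zero hk)]
    change _ * θ (x.mat * k) = _
    rw [hK x.mat hk]
    ring
  refine (mem_isotypic_iff hη).mpr ⟨⟨?_, ?_⟩, fun k hk x => hN x k hk⟩
  · intro S x hx
    -- As ε ≤ 1, congruence to 1 modulo 𝔭^(m+2) puts u into K_m and also satisfies the hypotheses of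
    -- `cochain_eq_one`. Hence its splitting sign and η(d) are both 1.
    refine ⟨_, entries_mem_nhds ((m : ℤ) + 2), fun u hu => ?_⟩
    have hu' : ∀ i j, u i j - (1 : SL(2, F)) i j ∈ fracIdeal (F := F) (m + 2) := hu
    have u00 : u 0 0 - 1 ∈ fracIdeal (F := F) (m + 2) := by simpa using hu' 0 0
    have u01 : u 0 1 ∈ fracIdeal (F := F) (m + 2) := by simpa using hu' 0 1
    have u10 : u 1 0 ∈ fracIdeal (F := F) (m + 2) := by simpa using hu' 1 0
    have u11 : u 1 1 - 1 ∈ fracIdeal (F := F) (m + 2) := by simpa using hu' 1 1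
    have hε : ((ε : ℕ) : ℤ) ≤ 1 := by have := ε.2; omega
    have one0 : (1 : F) ∈ fracIdeal 0 := mem_fracIdeal_of_le ord_one.ge
    have aux : ∀ {y : F}, y - 1 ∈ fracIdeal (F := F) (m + 2) → y ∈ fracIdeal 0 := fun hy => by
      simpa using fracIdeal_add (fracIdeal_mono (by omega) hy) one0
    have huK : u ∈ K (F := F) ε m := mem_K.mpr ⟨aux u00, fracIdeal_mono (by omega) u01,
      fracIdeal_mono (by omega) u10, aux u11⟩
    have hs : splitting ε u = 1 := by
      refine sign_cast_eq ?_
      rw [hG.splitting_eq hp (K_le_K_zero huK), hG.cochain_eq_one hp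
        (fracIdeal_mono (by omega) u10) (fracIdeal_mono (by omega) u11)]
      simp
    have hη1 : evalUnit η (u 1 1) = 1 := by
      have hone := ord_one_add (fracIdeal_mono (by omega) u11)
      rw [add_sub_cancel] at hone
      exact evalUnit_eq_one hη hone.1 hone.2 (fracIdeal_mono (by omega) u11)
    have := hN x u huK
    rw [hs, hη1, one_mul] at this
    exact Set.mem_preimage.mpr (Set.mem_of_eq_of_mem this hx)
  · intro a s b x
    beta_reduce
    rw [hG.genuineSign_torus_unip hp, chiPsi, weilRatio_eq]
    have : θ (torus a * unip b * x.mat) = torusChar μ a * θ x.mat := by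
      refine hθ x.mat _ _ ⟨a⁻¹, 1, one_mem _, ?_, ?_, ?_⟩
      · rw [torus_unip_row, mul_one]
      · rw [torus_unip_row, mul_one]
      · have t2 : torusChar μ a⁻¹ = (torusChar μ a)⁻¹ :=
          eq_inv_of_mul_eq_one_left (by rw [← map_mul, inv_mul_cancel, map_one])
        simp [t2, evalUnit_one]
    change _ * θ (torus a * unip b * x.mat) = _
    rw [this, torusChar_apply]
    ring

/-- The `η`-isotypic subspace of the principal series, as a space of functions on `SL₂(F)` in which
the covering group does not appear any more. -/
noncomputable def isotypicEquiv (hp : ringChar 𝓀[F] ≠ 2)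
    (hG : IsWeilFunction ((ε : ℕ) : ℤ) fun a : F => weilIndex (ψ.mulShift a)) (hη : cond η ≤ m) :
    isotypic (principalSeries ψ μ) ε m η ≃ₗ[ℂ] equivariantFunctions (OrbitRel μ η ε m) where
  toFun f := ⟨_, cochain_mul_mem_equivariantFunctions hp hG hη f.2⟩
  map_add' f f' := by
    ext g
    simp [mul_add]
  map_smul' c f := by
    ext g
    simp [mul_left_comm]
  invFun θ := ⟨_, genuineSign_mul_mem_isotypic hp hG hη θ.2⟩
  left_inv f := by
    ext x
    exact (eq_genuineSign_mul hG ((mem_isotypic_iff hη).mp f.2).1 x).symm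
  right_inv θ := by
    ext g
    simp only [genuineSign, Units.val_one, Int.cast_one, one_mul]
    rw [mul_inv_cancel_left₀ (hG.cochain_ne_zero _)]

end Reduction

/-! ### Equivariant functions counted by orbits. -/

section Abstract

/-- A relation with values in nonzero scalars that is reflexive, symmetric and transitive. -/
structure IsScalarEquivalence {X : Type*} (T : X → X → ℂ → Prop) : Prop where
  ne_zero : ∀ {x y z}, T x y z → z ≠ 0
  symm : ∀ {x y z}, T x y z → T y x z⁻¹
  trans : ∀ {x y w z z'}, T x y z → T y w z' → T x w (z' * z)

open Classical in
/-- Equivariant functions are determined by their values at representatives of those classes on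
which the stabilizers act trivially, and these values are arbitrary. -/
lemma IsScalarEquivalence.nonempty_equiv {X ι : Type*} {T : X → X → ℂ → Prop}
    (hT : IsScalarEquivalence T) {r : ι → X} (cover : ∀ x, ∃ i z, T (r i) x z)
    (sep : ∀ {i j z}, T (r i) (r j) z → i = j) :
    Nonempty (equivariantFunctions T ≃ₗ[ℂ] ({i // ∀ z, T (r i) (r i) z → z = 1} → ℂ)) := by
  choose i z hiz using cover
  let φ : equivariantFunctions T →ₗ[ℂ] ({i // ∀ z, T (r i) (r i) z → z = 1} → ℂ) :=
    { toFun := fun θ a => θ.1 (r a.1)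
      map_add' := fun _ _ => rfl
      map_smul' := fun _ _ => rfl }
  refine ⟨LinearEquiv.ofBijective φ ⟨?_, ?_⟩⟩
  · rw [← LinearMap.ker_eq_bot, LinearMap.ker_eq_bot']
    intro θ hθ
    ext x
    rw [θ.2 _ _ _ (hiz x)]
    have : θ.1 (r (i x)) = 0 := by
      by_cases h : ∀ z, T (r (i x)) (r (i x)) z → z = 1
      · exact congrFun hθ ⟨i x, h⟩
      -- A stabilizer scalar w ≠ 1 forces the value at the representative to vanish.
      · push Not at h
        obtain ⟨w, hw, hw1⟩ := h
        have h2 := θ.2 _ _ _ hw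
        have h3 : (1 - w) * θ.1 (r (i x)) = 0 := by linear_combination h2
        exact (mul_eq_zero.mp h3).resolve_left (sub_ne_zero.mpr hw1.symm)
    rw [this, mul_zero]
    rfl
  · intro a
    -- Values are transported from the representatives. Two transports to the same point differ by a
    -- stabilizer scalar, which is 1 on the classes that matter.
    refine ⟨⟨fun x => if h : ∀ z, T (r (i x)) (r (i x)) z → z = 1 then z x * a ⟨i x, h⟩ else 0,
      ?_⟩, ?_⟩
    · intro x y w hw
      have h1 := hT.trans (hT.trans (hiz x) hw) (hT.symm (hiz y))
      have hij : i x = i y := sep h1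
      have h2 : T (r (i y)) (r (i y)) ((z y)⁻¹ * (w * z x)) := by rwa [hij] at h1
      simp only [hij]
      split_ifs with h
      · have h3 := h _ h2
        have h4 := hT.ne_zero (hiz y)
        rw [inv_mul_eq_one₀ h4] at h3
        rw [h3, mul_assoc]
      · rw [mul_zero]
    · ext j
      have hij : i (r j.1) = j.1 := sep (hiz _)
      have h1 := hiz (r j.1)
      rw [hij] at h1
      have h2 := j.2 _ h1
      change dite _ _ _ = _
      have h3 : ∀ z, T (r (i (r j.1))) (r (i (r j.1))) z → z = 1 := by rw [hij]; exact j.2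
      rw [dif_pos h3, h2, one_mul]
      congr 1
      exact Subtype.ext hij

end Abstract

lemma sl_inv_mul_row {F : Type*} [Field F] {g g' k : SL(2, F)} {l : Fˣ} (h0 : g' 1 0 = l * (g * k) 1 0)
    (h1 : g' 1 1 = l * (g * k) 1 1) (j : Fin 2) :
    g 1 j = ((l⁻¹ : Fˣ) : F) * (g' * k⁻¹) 1 j := by
  have e : g 1 j = (g * k * k⁻¹) 1 j := by rw [mul_inv_cancel_right]
  rw [e, sl_mul_apply (g * k), sl_mul_apply g', h0, h1, Units.val_inv_eq_inv_val]
  have := l.ne_zero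
  field_simp

/-! ### When the stabilizer acts trivially. -/

section Stabilizer

variable {F : Type*} [Field F] [ValuativeRel F] [TopologicalSpace F]
  [IsNonarchimedeanLocalField F]

/-- The characters `χ` and `η` of the units satisfy `χ(u) η(u - w) = 1` whenever `w ∈ 𝔭 ^ i` and
`u - w ∈ u⁻¹ + 𝔭 ^ j`. -/
def StabilizerTrivial (χ η : 𝒪[F]ˣ →ₜ* ℂˣ) (i j : ℕ) : Prop :=
  ∀ u w v : F, u ≠ 0 → ord u = 0 → w ∈ fracIdeal i → v ∈ fracIdeal j → u - w = u⁻¹ + v →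
    evalUnit χ u * evalUnit η (u - w) = 1

/-- The substitution (u, w, v) ↦ (u⁻¹, -v, -w) preserves the defining relation and the element u -
w, and it exchanges i and j. -/
lemma StabilizerTrivial.symm {χ η : 𝒪[F]ˣ →ₜ* ℂˣ} {i j : ℕ} (h : StabilizerTrivial χ η i j) :
    StabilizerTrivial χ⁻¹ η j i := by
  intro u w v hu hu0 hw hv e
  have := h u⁻¹ (-v) (-w) (inv_ne_zero hu) (by rw [ord_inv, hu0, neg_zero]) (fracIdeal_neg hv)
    (fracIdeal_neg hw) (by rw [inv_inv, sub_neg_eq_add, ← e, sub_eq_add_neg])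
  rwa [sub_neg_eq_add, ← e, evalUnit_inv χ hu hu0, ← evalUnit_inv_char] at this

lemma stabilizerTrivial_symm {χ η : 𝒪[F]ˣ →ₜ* ℂˣ} {i j : ℕ} :
    StabilizerTrivial χ η i j ↔ StabilizerTrivial χ⁻¹ η j i :=
  ⟨fun h => h.symm, fun h => by have := h.symm; rwa [show χ⁻¹⁻¹ = χ from inv_inv χ] at this⟩

/-- A unit whose square is `1` modulo `𝔭 ^ j` is `1` or `-1` modulo `𝔭 ^ j`. -/
lemma sub_mem_or_add_mem (hp : ringChar 𝓀[F] ≠ 2) {u : F} {j : ℕ} (hu : u ≠ 0) (hu0 : ord u = 0)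
    (h : u - u⁻¹ ∈ fracIdeal j) : u - 1 ∈ fracIdeal j ∨ -u - 1 ∈ fracIdeal j := by
  have h2 := ord_two hp
  have u0 : u ∈ fracIdeal 0 := mem_fracIdeal_of_le hu0.ge
  have hsq : (u - 1) * (u + 1) ∈ fracIdeal j := by
    have e : (u - 1) * (u + 1) = (u - u⁻¹) * u := by field_simp; ring
    rw [e]
    exact fracIdeal_mul h u0 (by omega)
  have key : ∀ y z : F, y * z ∈ fracIdeal j → z ≠ 0 → ord z = 0 → y ∈ fracIdeal j := by
    intro y z hyz hz hz0
    rw [← mul_inv_cancel_right₀ hz y]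
    exact fracIdeal_mul hyz (mem_fracIdeal_of_le (ord_inv _).ge) (by omega)
  by_cases h1 : u - 1 ∈ fracIdeal 1
  · left
    have := ord_add_of_mem h2.1 (y := u - 1) (by rwa [h2.2])
    have e : 2 + (u - 1) = u + 1 := by ring
    rw [e, h2.2] at this
    exact key _ _ hsq this.1 this.2
  · right
    have hne : u - 1 ≠ 0 := fun h0 => h1 (h0 ▸ zero_mem_fracIdeal _)
    have hz : ord (u - 1) = 0 := by
      have a1 : u - 1 ∈ fracIdeal 0 := fracIdeal_sub u0 (mem_fracIdeal_of_le ord_one.ge)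
      have a2 := le_ord_of_mem hne a1
      have a3 : ¬ 1 ≤ ord (u - 1) := fun h => h1 (mem_fracIdeal_of_le h)
      omega
    rw [mul_comm] at hsq
    have := fracIdeal_neg (key _ _ hsq hne hz)
    rwa [neg_add'] at this

/-- For j ≤ i the relation forces u ≡ u⁻¹, hence u ≡ ±1, modulo 𝔭^j. If c(η) ≤ i then η(u - w) =
η(u), so only (ηχ)(u) matters, and `hneg` disposes of the class of -1. The conditions on the
conductors are necessary, as u = 1 and w = 0 show. -/
lemma stabilizerTrivial_iff (hp : ringChar 𝓀[F] ≠ 2) {χ η : 𝒪[F]ˣ →ₜ* ℂˣ} {i j : ℕ} (hi : 1 ≤ i)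
    (hji : j ≤ i) (hneg : evalUnit (η * χ) (-1) = 1) :
    StabilizerTrivial χ η i j ↔ cond η ≤ i ∧ cond (η * χ) ≤ j := by
  have neg1 : ord (-1 : F) = 0 := by rw [ord_neg, ord_one]
  constructor
  · intro h
    constructor
    · rw [cond_le_iff]
      intro d hd hd0 hdi
      have h1 := h 1 (1 - d) (d - 1) one_ne_zero ord_one
        (by rw [← neg_sub]; exact fracIdeal_neg hdi) (fracIdeal_mono (by omega) hdi)
        (by rw [inv_one]; ring)
      rwa [evalUnit_one, one_mul, sub_sub_cancel] at h1
    · rw [cond_le_iff]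
      intro d hd hd0 hdj
      have h1 := h d 0 (d - d⁻¹) hd hd0 (zero_mem_fracIdeal _) (by
        have e : d - d⁻¹ = (d - 1) * (1 + d⁻¹) := by field_simp; ring
        rw [e]
        refine fracIdeal_mul hdj (fracIdeal_add (n := 0) (mem_fracIdeal_of_le ord_one.ge)
          (mem_fracIdeal_of_le (by rw [ord_inv, hd0, neg_zero]))) ?_
        omega) (by ring)
      rwa [sub_zero, mul_comm, ← evalUnit_mul_char] at h1
  · rintro ⟨h1, h2⟩ u w v hu hu0 hw hv e
    have hwv : u - u⁻¹ ∈ fracIdeal j := by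
      have e' : u - u⁻¹ = w + v := by linear_combination e
      rw [e']
      exact fracIdeal_add (fracIdeal_mono (by omega) hw) hv
    have hy : -(w * u⁻¹) ∈ fracIdeal i :=
      fracIdeal_neg (fracIdeal_mul hw (mem_fracIdeal_of_le (ord_inv _).ge) (by omega))
    have hone := ord_one_add (fracIdeal_mono (by omega) hy)
    have e1 : u - w = u * (1 + -(w * u⁻¹)) := by field_simp; ring
    rw [e1, evalUnit_mul η hu hu0 hone.1 hone.2, evalUnit_eq_one h1 hone.1 hone.2
      (by rwa [add_sub_cancel_left]), mul_one, mul_comm, ← evalUnit_mul_char]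
    rcases sub_mem_or_add_mem hp hu hu0 hwv with h | h
    · exact evalUnit_eq_one h2 hu hu0 h
    · have h3 := evalUnit_eq_one h2 (neg_ne_zero.mpr hu) (by rw [ord_neg, hu0]) h
      rwa [← neg_one_mul, evalUnit_mul _ (neg_ne_zero.mpr one_ne_zero) neg1 hu hu0, hneg,
        one_mul] at h3

end Stabilizer

/-! ### Orbits of rows and the central character. -/

section Orbits

variable {F : Type*} [Field F] [ValuativeRel F] [TopologicalSpace F]
  [IsNonarchimedeanLocalField F]
  {μ : Fˣ →ₜ* ℂˣ} {η : 𝒪[F]ˣ →ₜ* ℂˣ} {ε : Fin 2} {m : ℕ}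

lemma isScalarEquivalence_orbitRel (hη : cond η ≤ m) :
    IsScalarEquivalence (OrbitRel μ η ε m) where
  ne_zero := by
    rintro x y z ⟨l, k, -, -, -, rfl⟩
    exact mul_ne_zero (inv_ne_zero (torusChar_ne_zero _ _)) (evalUnit_ne_zero _ _)
  symm := by
    rintro x y z ⟨l, k, hk, h0, h1, rfl⟩
    refine ⟨l⁻¹, k⁻¹, inv_mem hk, sl_inv_mul_row h0 h1 0, sl_inv_mul_row h0 h1 1, ?_⟩
    have e1 : torusChar μ l⁻¹ = (torusChar μ l)⁻¹ :=
      eq_inv_of_mul_eq_one_left (by rw [← map_mul, inv_mul_cancel, map_one])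
    have e2 : evalUnit η (k⁻¹ 1 1) = (evalUnit η (k 1 1))⁻¹ := by
      refine eq_inv_of_mul_eq_one_left ?_
      rw [← evalUnit_K_mul hη (inv_mem hk) hk, inv_mul_cancel]
      simpa using evalUnit_one η
    rw [e1, e2, mul_inv, inv_inv]
  trans := by
    rintro x y w z z' ⟨l, k, hk, h0, h1, rfl⟩ ⟨l', k', hk', h0', h1', rfl⟩
    have row : ∀ j, (y * k') 1 j = l * (x * (k * k')) 1 j := by
      intro j
      rw [sl_mul_apply, h0, h1, ← mul_assoc x, sl_mul_apply (x * k)]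
      ring
    refine ⟨l' * l, k * k', mul_mem hk hk', ?_, ?_, ?_⟩
    · rw [h0', row, Units.val_mul, mul_assoc]
    · rw [h1', row, Units.val_mul, mul_assoc]
    · rw [evalUnit_K_mul hη hk hk', map_mul]
      ring

/-- The matrix -1 lies both in K_m and in the torus, and the two actions scale a function by η(-1)
and by μ(-1). -/
lemma isotypic_eq_bot_of_neg_one_ne (hp : ringChar 𝓀[F] ≠ 2) {ψ : AddChar F ℂ}
    (hG : IsWeilFunction ((ε : ℕ) : ℤ) fun a : F => weilIndex (ψ.mulShift a))
    (h : η (-1) ≠ μ (-1)) (m : ℕ) : isotypic (principalSeries ψ μ) ε m η = ⊥ := by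
  by_cases hη : cond η ≤ m
  swap
  · rw [isotypic, if_neg hη]
  have key : ∀ θ ∈ equivariantFunctions (OrbitRel μ η ε m), θ = 0 := by
    intro θ hθ
    ext g
    have neg1 : (-1 : SL(2, F)) ∈ K (F := F) ε m := by
      refine mem_K.mpr ⟨?_, ?_, ?_, ?_⟩ <;> simp [zero_mem_fracIdeal, mem_fracIdeal_of_le]
    have h1 := hθ g g _ ⟨-1, -1, neg1, by simp, by simp, rfl⟩
    have h2 : torusChar μ (-1) = ((μ (-1) : ℂˣ) : ℂ) := by
      rw [torusChar_apply, normAbs_of_ord (by simp)]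
      simp
    have h3 : evalUnit η ((-1 : SL(2, F)) 1 1) = ((η (-1) : ℂˣ) : ℂ) := by
      rw [← evalUnit_neg_one]
      simp
    rw [h2, h3] at h1
    have h4 : (((μ (-1) : ℂˣ) : ℂ) - ((η (-1) : ℂˣ) : ℂ)) * θ g = 0 := by
      have := Units.ne_zero (μ (-1))
      rw [sub_mul, sub_eq_zero]
      nth_rewrite 1 [h1]
      rw [mul_assoc, mul_inv_cancel_left₀ this]
    exact (mul_eq_zero.mp h4).resolve_left
      (sub_ne_zero.mpr fun h5 => h (Units.ext h5.symm))
  have : Subsingleton (equivariantFunctions (OrbitRel μ η ε m)) :=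
    ⟨fun a b => Subtype.ext ((key _ a.2).trans (key _ b.2).symm)⟩
  have := (isotypicEquiv (μ := μ) (m := m) hp hG hη).toEquiv.subsingleton
  exact (Submodule.subsingleton_iff_eq_bot).mp this

end Orbits

lemma exists_sl {F : Type*} [Field F] {a b c d : F} (det : a * d - b * c = 1) :
    ∃ k : SL(2, F), k 0 0 = a ∧ k 0 1 = b ∧ k 1 0 = c ∧ k 1 1 = d :=
  ⟨⟨!![a, b; c, d], by rw [Matrix.det_fin_two_of, det]⟩, rfl, rfl, rfl, rfl⟩

/-! ### Invariants and stabilizers of the rows (x, 1). -/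

section Representatives

variable {F : Type*} [Field F] [ValuativeRel F] [TopologicalSpace F]
  [IsNonarchimedeanLocalField F]
  {μ : Fˣ →ₜ* ℂˣ} {η : 𝒪[F]ˣ →ₜ* ℂˣ} {ε : Fin 2} {m : ℕ} {x x' : F} {z : ℂ}

lemma ord_nonpos_of_mul_eq_one {l y : F} (hy : y ∈ fracIdeal 0) (h : 1 = l * y) : ord l ≤ 0 := by
  have hl : l ≠ 0 := left_ne_zero_of_mul_eq_one h.symm
  have hy0 : y ≠ 0 := right_ne_zero_of_mul_eq_one h.symm
  have h1 := congrArg ord h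
  rw [ord_one, ord_mul hl hy0] at h1
  have := le_ord_of_mem hy0 hy
  omega

/-- The scalar relating two primitive rows is a unit. -/
lemma exists_of_orbitRel (hx : x ∈ fracIdeal ((ε : ℕ) : ℤ)) (hx' : x' ∈ fracIdeal ((ε : ℕ) : ℤ))
    (h : OrbitRel μ η ε m (lowerUnip x) (lowerUnip x') z) :
    ∃ (l : Fˣ) (k : SL(2, F)), k ∈ K (F := F) ε m ∧ ord (l : F) = 0 ∧
      x' = l * (x * k 0 0 + k 1 0) ∧ 1 = l * (x * k 0 1 + k 1 1) ∧
      z = (evalUnit (resUnits μ) (l : F))⁻¹ * evalUnit η (k 1 1) := by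
  obtain ⟨l, k, hk, h0, h1, hz⟩ := h
  have h2 := sl_inv_mul_row h0 h1 1
  have hk' := inv_mem hk
  have aux : ∀ {y : F} {k : SL(2, F)}, y ∈ fracIdeal ((ε : ℕ) : ℤ) → k ∈ K (F := F) ε m →
      (lowerUnip y * k) 1 1 ∈ fracIdeal 0 := by
    intro y k hy hk
    rw [sl_mul_apply, lowerUnip_10, lowerUnip_11, one_mul]
    exact fracIdeal_add (fracIdeal_mul hy hk.2.1 (by omega)) hk.2.2.2
  -- The relation and its inverse give ord l ≤ 0 and ord l⁻¹ ≤ 0.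
  have o1 := ord_nonpos_of_mul_eq_one (aux hx hk) h1
  have o2 := ord_nonpos_of_mul_eq_one (aux hx' hk') h2
  rw [Units.val_inv_eq_inv_val, ord_inv] at o2
  have ho : ord (l : F) = 0 := by omega
  rw [torusChar_of_ord μ ho] at hz
  refine ⟨l, k, hk, ho, ?_, ?_, hz⟩
  · simpa [sl_mul_apply] using h0
  · simpa [sl_mul_apply] using h1

/-- Up to a unit x' is xa + c with c ∈ 𝔭^(m+ε). So the order of x, cut off at m + ε, cannot drop; by
symmetry it is an invariant of the orbit. -/
lemma mem_of_orbitRel (hx : x ∈ fracIdeal ((ε : ℕ) : ℤ)) (hx' : x' ∈ fracIdeal ((ε : ℕ) : ℤ))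
    (h : OrbitRel μ η ε m (lowerUnip x) (lowerUnip x') z) {n : ℤ} (hn : n ≤ m + ((ε : ℕ) : ℤ))
    (hxn : x ∈ fracIdeal n) : x' ∈ fracIdeal n := by
  obtain ⟨l, k, hk, ho, h0, -, -⟩ := exists_of_orbitRel hx hx' h
  rw [h0]
  exact fracIdeal_mul (mem_fracIdeal_of_le ho.ge) (fracIdeal_add
    (fracIdeal_mul hxn hk.1 (by omega)) (fracIdeal_mono hn hk.2.2.1)) (by omega)

/-- One has x'/x = l²(xb + d)(a + c/x). The product of the brackets is 1 + bc + xab + (c/x)(xb + d),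
a principal unit because 0 < i < m. -/
lemma isSquare_div_of_orbitRel (hp : ringChar 𝓀[F] ≠ 2) {i : ℕ} (hx0 : x ≠ 0)
    (hxi : ord x = ((ε : ℕ) : ℤ) + i) (hi : 0 < i) (him : i < m)
    (h : OrbitRel μ η ε m (lowerUnip x) (lowerUnip x') z) : IsSquare (x' / x) := by
  obtain ⟨l, k, hk, h0, h1, -⟩ := h
  simp only [sl_mul_apply, lowerUnip_10, lowerUnip_11, one_mul] at h0 h1
  obtain ⟨ha, hb, hc, hd⟩ := mem_K.mp hk
  have det := sl_det k
  have hx : x ∈ fracIdeal (((ε : ℕ) : ℤ) + i) := mem_fracIdeal_of_le hxi.ge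
  have hxb : x * k 0 1 ∈ fracIdeal i := fracIdeal_mul hx hb (by omega)
  have hy : k 0 1 * k 1 0 + x * k 0 1 * k 0 0 + k 1 0 * x⁻¹ * (x * k 0 1 + k 1 1) ∈
      fracIdeal 1 := by
    refine fracIdeal_add (fracIdeal_add (fracIdeal_mul hb hc (by omega))
      (fracIdeal_mul hxb ha (by omega))) ?_
    refine fracIdeal_mul (fracIdeal_mul hc (mem_fracIdeal_of_le (ord_inv x).ge) le_rfl)
      (fracIdeal_add (fracIdeal_mono (by omega) hxb) hd) ?_
    omega
  obtain ⟨s, -, -, hs⟩ := isSquare_one_add hp hy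
  refine ⟨l * s, ?_⟩
  have e : (l : F) * s * (l * s) = l ^ 2 * s ^ 2 := by ring
  rw [e, hs, h0, div_eq_iff hx0]
  field_simp
  linear_combination (x * k 0 0 + k 1 0) * h1 + (l : F) * x * det

/-- The stabilizer of the row `(x, 1)`. -/
lemma orbitRel_self_iff (hm : m ≠ 0) (hη : cond η ≤ m) {i : ℕ} (him : i ≤ m)
    (hx : if i = m then x = 0 else x ≠ 0 ∧ ord x = ((ε : ℕ) : ℤ) + i) :
    (∀ z, OrbitRel μ η ε m (lowerUnip x) (lowerUnip x) z → z = 1) ↔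
      StabilizerTrivial (resUnits μ) η i (m - i) := by
  have hxi : x ∈ fracIdeal (((ε : ℕ) : ℤ) + i) := by
    split_ifs at hx with h
    · rw [hx]; exact zero_mem_fracIdeal _
    · exact mem_fracIdeal_of_le hx.2.ge
  have hxε : x ∈ fracIdeal ((ε : ℕ) : ℤ) := fracIdeal_mono (by omega) hxi
  constructor
  · intro h u w v hu hu0 hw hv e
    have hui : u⁻¹ ∈ fracIdeal 0 := mem_fracIdeal_of_le (by rw [ord_inv]; omega)
    have hu' : u ∈ fracIdeal 0 := mem_fracIdeal_of_le hu0.ge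
    have fin : ∀ (b a d c : F) (det : a * d - b * c = 1), a ∈ fracIdeal 0 →
        b ∈ fracIdeal (-((ε : ℕ) : ℤ)) → c ∈ fracIdeal ((m : ℤ) + ((ε : ℕ) : ℤ)) →
        d ∈ fracIdeal 0 → u * x = x * a + c → u = x * b + d →
        evalUnit (resUnits μ) u * evalUnit η d = 1 := by
      intro b a d c det ha hb hc hd h1 h2
      obtain ⟨k, rfl, rfl, rfl, rfl⟩ := exists_sl det
      refine h _ ⟨(Units.mk0 u hu)⁻¹, k, mem_K.mpr ⟨ha, hb, hc, hd⟩, ?_, ?_, ?_⟩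
      · have : x = u⁻¹ * (x * k 0 0 + k 1 0) := by rw [← h1, inv_mul_cancel_left₀ hu]
        simpa [sl_mul_apply] using this
      · have : 1 = u⁻¹ * (x * k 0 1 + k 1 1) := by rw [← h2, inv_mul_cancel₀ hu]
        simpa [sl_mul_apply] using this
      · rw [torusChar_of_ord μ (by rw [Units.val_inv_eq_inv_val, Units.val_mk0, ord_inv]; omega),
          Units.val_inv_eq_inv_val, Units.val_mk0, evalUnit_inv _ hu hu0, inv_inv]
    split_ifs at hx with him'
    -- For x = 0 the matrix diag(u⁻¹, u) does it, and w ∈ 𝔭^m is invisible to η.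
    · have h1 := fin 0 u⁻¹ u 0 (by field_simp; ring) hui (zero_mem_fracIdeal _)
        (zero_mem_fracIdeal _) hu' (by rw [hx]; ring) (by ring)
      have hy : -(w * u⁻¹) ∈ fracIdeal m := by
        rw [him'] at hw
        exact fracIdeal_neg (fracIdeal_mul hw hui (by omega))
      have hone := ord_one_add (fracIdeal_mono (by omega) hy)
      have e1 : u - w = u * (1 + -(w * u⁻¹)) := by field_simp; ring
      rw [e1, evalUnit_mul η hu hu0 hone.1 hone.2, evalUnit_eq_one hη hone.1 hone.2
        (by rwa [add_sub_cancel_left]), mul_one]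
      exact h1
    · obtain ⟨hx0, hxo⟩ := hx
      -- The entries are solved from w = xb and v = c/x; the determinant is 1 by the relation
      -- between u, w and v.
      refine fin (w / x) (u⁻¹ + w) (u - w) (x * v) ?_ ?_ ?_ ?_ ?_ ?_ ?_
      · have : w / x * (x * v) = w * v := by field_simp
        rw [this]
        have h3 : u * u⁻¹ = 1 := mul_inv_cancel₀ hu
        linear_combination h3 + w * e
      · exact fracIdeal_add hui (fracIdeal_mono (by omega) hw)
      · rw [div_eq_mul_inv]
        exact fracIdeal_mul hw (mem_fracIdeal_of_le (ord_inv x).ge) (by omega)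
      · refine fracIdeal_mul hxi hv ?_
        omega
      · exact fracIdeal_sub hu' (fracIdeal_mono (by omega) hw)
      · linear_combination x * e
      · rw [mul_div_cancel₀ _ hx0]; ring
  · intro h z hz
    obtain ⟨l, k, hk, ho, h0, h1, rfl⟩ := exists_of_orbitRel hxε hxε hz
    obtain ⟨ha, hb, hc, hd⟩ := mem_K.mp hk
    have det := sl_det k
    have hl := l.ne_zero
    have hu0 : ord (l : F)⁻¹ = 0 := by rw [ord_inv]; omega
    have e1 : (l : F)⁻¹ = x * k 0 1 + k 1 1 := inv_eq_of_mul_eq_one_right h1.symm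
    rw [← evalUnit_inv _ hl ho]
    have ed : k 1 1 = (l : F)⁻¹ - x * k 0 1 := by rw [e1]; ring
    have hw : x * k 0 1 ∈ fracIdeal i := fracIdeal_mul hxi hb (by omega)
    rw [ed]
    -- In the other direction v = d - l, which equals c/x if x ≠ 0. At i = m the exponent m - i is
    -- 0, and v only has to be integral.
    refine h (l : F)⁻¹ (x * k 0 1) (k 1 1 - l) (inv_ne_zero hl) hu0 hw ?_ ?_
    · split_ifs at hx with him'
      · rw [him', Nat.sub_self]
        exact fracIdeal_sub hd (mem_fracIdeal_of_le (by simp [ho]))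
      · obtain ⟨hx0, hxo⟩ := hx
        have : k 1 1 - l = k 1 0 * x⁻¹ := by
          field_simp
          linear_combination k 1 1 * h0 + l * x * det - k 1 0 * h1
        rw [this]
        exact fracIdeal_mul hc (mem_fracIdeal_of_le (ord_inv x).ge) (by omega)
    · rw [inv_inv, ← ed]; ring

end Representatives

/-! ### Classification of the double cosets. -/

section Classification

variable {F : Type*} [Field F] [ValuativeRel F] [TopologicalSpace F]
  [IsNonarchimedeanLocalField F]
  {μ : Fˣ →ₜ* ℂˣ} {η : 𝒪[F]ˣ →ₜ* ℂˣ} {ε : Fin 2} {m : ℕ}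

lemma exists_orbitRel_of_row {x : F} {g : SL(2, F)} {l a b c d : F} (hl : l ≠ 0)
    (det : a * d - b * c = 1) (ha : a ∈ fracIdeal 0) (hb : b ∈ fracIdeal (-((ε : ℕ) : ℤ)))
    (hc : c ∈ fracIdeal ((m : ℤ) + ((ε : ℕ) : ℤ))) (hd : d ∈ fracIdeal 0)
    (h0 : g 1 0 = l * (x * a + c)) (h1 : g 1 1 = l * (x * b + d)) :
    ∃ z, OrbitRel μ η ε m (lowerUnip x) g z := by
  obtain ⟨k, rfl, rfl, rfl, rfl⟩ := exists_sl det
  refine ⟨_, Units.mk0 l hl, k, mem_K.mpr ⟨ha, hb, hc, hd⟩, ?_, ?_, rfl⟩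
  · rw [h0]; simp [sl_mul_apply]
  · rw [h1]; simp [sl_mul_apply]

/-- If ord x = ε, then xb + 1 runs through all of 𝒪 as b runs through 𝔭^(-ε). Hence square classes
play no role at the position i = 0. -/
lemma exists_orbitRel_of_isUpper {x : F} {g : SL(2, F)} (hx : x ≠ 0)
    (hxo : ord x = ((ε : ℕ) : ℤ)) (hu : IsUpper ((ε : ℕ) : ℤ) (g 1 0) (g 1 1)) :
    ∃ z, OrbitRel μ η ε m (lowerUnip x) g z := by
  obtain ⟨hc, hd⟩ := hu
  have one0 : (1 : F) ∈ fracIdeal 0 := mem_fracIdeal_of_le ord_one.ge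
  have hl : g 1 0 / x ≠ 0 := div_ne_zero hc hx
  have hlo : ord (g 1 0 / x) = ord (g 1 0) - ((ε : ℕ) : ℤ) := by rw [ord_div hc hx, hxo]
  have hq : g 1 1 * (g 1 0 / x)⁻¹ ∈ fracIdeal 0 :=
    fracIdeal_mul hd (mem_fracIdeal_of_le (ord_inv _).ge) (by omega)
  refine exists_orbitRel_of_row (a := 1) (b := (g 1 1 * (g 1 0 / x)⁻¹ - 1) * x⁻¹) (c := 0)
    (d := 1) hl (by ring) one0 (fracIdeal_mul (fracIdeal_sub hq one0)
      (mem_fracIdeal_of_le (ord_inv _).ge) (by omega)) (zero_mem_fracIdeal _) one0 ?_ ?_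
  · field_simp
    ring
  · field_simp
    ring

lemma exists_orbitRel_zero {g : SL(2, F)} (hd : g 1 1 ≠ 0)
    (hc : g 1 0 ∈ fracIdeal (ord (g 1 1) + (m + ((ε : ℕ) : ℤ)))) :
    ∃ z, OrbitRel μ η ε m (lowerUnip 0) g z := by
  have one0 : (1 : F) ∈ fracIdeal 0 := mem_fracIdeal_of_le ord_one.ge
  refine exists_orbitRel_of_row (a := 1) (b := 0) (c := g 1 0 * (g 1 1)⁻¹) (d := 1) hd (by ring)
    one0 (zero_mem_fracIdeal _) (fracIdeal_mul hc (mem_fracIdeal_of_le (ord_inv _).ge) (by omega))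
    one0 ?_ ?_
  · field_simp
    ring
  · ring

/-- The matrix diag(s, s⁻¹) of K_m multiplies x by s², so two representatives suffice at each inner
position. -/
lemma exists_orbitRel_of_sq {x s : F} {g : SL(2, F)} (hd : g 1 1 ≠ 0) (hs : s ≠ 0)
    (hs0 : ord s = 0) (h : g 1 0 = g 1 1 * (x * s ^ 2)) :
    ∃ z, OrbitRel μ η ε m (lowerUnip x) g z := by
  refine exists_orbitRel_of_row (l := g 1 1 * s) (a := s) (b := 0) (c := 0) (d := s⁻¹)
    (mul_ne_zero hd hs) (by field_simp; ring) (mem_fracIdeal_of_le hs0.ge) (zero_mem_fracIdeal _)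
    (zero_mem_fracIdeal _) (mem_fracIdeal_of_le (by rw [ord_inv, hs0, neg_zero])) ?_ ?_
  · rw [h]; ring
  · field_simp
    ring

/-- Representatives for the orbits of `K_m` on primitive rows up to scalars: one for
`i = 0` and `i = m`, and two for each `0 < i < m`. -/
lemma exists_representatives (hp : ringChar 𝓀[F] ≠ 2) (μ : Fˣ →ₜ* ℂˣ) (η : 𝒪[F]ˣ →ₜ* ℂˣ)
    (ε : Fin 2) (hm : m ≠ 0) :
    ∃ r : Finset.range (m + 1) ⊕ Finset.Ioo 0 m → F,
      (∀ g, ∃ p z, OrbitRel μ η ε m (lowerUnip (r p)) g z) ∧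
      (∀ {p q z}, OrbitRel μ η ε m (lowerUnip (r p)) (lowerUnip (r q)) z → p = q) ∧
      ∀ p, if Sum.elim Subtype.val Subtype.val p = m then r p = 0 else
        r p ≠ 0 ∧ ord (r p) = ((ε : ℕ) : ℤ) + Sum.elim Subtype.val Subtype.val p := by
  classical
  obtain ⟨ν, hν, hν0, hνs⟩ := exists_unit_not_isSquare hp
  choose t ht hto using fun i : ℕ => exists_ord_eq (F := F) (((ε : ℕ) : ℤ) + i)
  set pos : Finset.range (m + 1) ⊕ Finset.Ioo 0 m → ℕ := Sum.elim Subtype.val Subtype.val with hpos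
  set r : Finset.range (m + 1) ⊕ Finset.Ioo 0 m → F :=
    Sum.elim (fun i => if i.1 = m then 0 else t i) (fun i => ν * t i) with hr
  have hrp : ∀ p, if pos p = m then r p = 0 else r p ≠ 0 ∧ ord (r p) = ((ε : ℕ) : ℤ) + pos p := by
    rintro (i | ⟨i, hi⟩)
    · simp only [hpos, hr, Sum.elim_inl]
      split_ifs
      · rfl
      · exact ⟨ht _, hto _⟩
    · have := Finset.mem_Ioo.mp hi
      simp only [hpos, hr, Sum.elim_inr]
      rw [if_neg (by omega)]
      exact ⟨mul_ne_zero hν (ht _), by rw [ord_mul hν (ht _), hν0, hto, zero_add]⟩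
  refine ⟨r, ?_, ?_, hrp⟩
  · intro g
    by_cases hu : IsUpper ((ε : ℕ) : ℤ) (g 1 0) (g 1 1)
    · refine ⟨Sum.inl ⟨0, by simp⟩, ?_⟩
      have := hrp (Sum.inl ⟨0, by simp⟩)
      rw [if_neg (by simpa [hpos] using hm.symm)] at this
      exact exists_orbitRel_of_isUpper this.1 (by rw [this.2]; simp [hpos]) hu
    obtain ⟨hd, hc1⟩ := (not_isUpper_iff (sl_row_ne_zero g)).mp hu
    by_cases hc : g 1 0 ∈ fracIdeal (ord (g 1 1) + (m + ((ε : ℕ) : ℤ)))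
    · refine ⟨Sum.inl ⟨m, by simp⟩, ?_⟩
      have : r (Sum.inl ⟨m, by simp⟩) = 0 := by simp [hr]
      rw [this]
      exact exists_orbitRel_zero hd hc
    have hc0 : g 1 0 ≠ 0 := fun h => hc (h ▸ zero_mem_fracIdeal _)
    have h1 := le_ord_of_mem hc0 hc1
    have h2 : ¬ ord (g 1 1) + (m + ((ε : ℕ) : ℤ)) ≤ ord (g 1 0) :=
      fun h => hc (mem_fracIdeal_of_le h)
    obtain ⟨i, hi⟩ : ∃ i : ℕ, ord (g 1 0) = ord (g 1 1) + ((ε : ℕ) : ℤ) + i :=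
      ⟨(ord (g 1 0) - ord (g 1 1) - ((ε : ℕ) : ℤ)).toNat, by omega⟩
    have hdt := mul_ne_zero hd (ht i)
    have hu0 : g 1 0 / (g 1 1 * t i) ≠ 0 := div_ne_zero hc0 hdt
    have huo : ord (g 1 0 / (g 1 1 * t i)) = 0 := by
      rw [ord_div hc0 hdt, ord_mul hd (ht i), hto]; omega
    have sq_unit : ∀ {s y : F}, y ≠ 0 → ord y = 0 → y = s * s → s ≠ 0 ∧ ord s = 0 := by
      rintro s y hy hyo rfl
      have hs := left_ne_zero_of_mul hy
      rw [ord_mul hs hs] at hyo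
      exact ⟨hs, by omega⟩
    by_cases hsq : IsSquare (g 1 0 / (g 1 1 * t i))
    · obtain ⟨s, hs⟩ := hsq
      obtain ⟨s0, so⟩ := sq_unit hu0 huo hs
      refine ⟨Sum.inl ⟨i, Finset.mem_range.mpr (by omega)⟩, exists_orbitRel_of_sq hd s0 so ?_⟩
      have : r (Sum.inl ⟨i, Finset.mem_range.mpr (by omega)⟩) = t i := by
        simp only [hr, Sum.elim_inl]
        rw [if_neg (by omega)]
      rw [this]
      rw [div_eq_iff hdt] at hs
      rw [hs]
      ring
    · have hνi : ν⁻¹ ≠ 0 := inv_ne_zero hν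
      have hνio : ord ν⁻¹ = 0 := by rw [ord_inv, hν0, neg_zero]
      -- A nonsquare unit is ν times a square, so the second representative νt takes over.
      obtain ⟨s, hs⟩ := isSquare_mul_of_not_isSquare hp hu0 huo hνi hνio hsq
        (fun h => hνs (by simpa using h.inv))
      obtain ⟨s0, so⟩ := sq_unit (mul_ne_zero hu0 hνi)
        (by rw [ord_mul hu0 hνi, huo, hνio, add_zero]) hs
      refine ⟨Sum.inr ⟨i, Finset.mem_Ioo.mpr (by omega)⟩, exists_orbitRel_of_sq hd s0 so ?_⟩
      change _ = g 1 1 * (ν * t i * s ^ 2)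
      rw [pow_two, ← hs]
      have := ht i
      field_simp
  · intro p q z hT
    have hle : ∀ p, pos p ≤ m := by
      rintro (⟨i, hi⟩ | ⟨i, hi⟩)
      · exact Nat.lt_succ_iff.mp (Finset.mem_range.mp hi)
      · exact (Finset.mem_Ioo.mp hi).2.le
    have hmem : ∀ p, ∀ n : ℤ, n ≤ m + ((ε : ℕ) : ℤ) →
        (r p ∈ fracIdeal n ↔ n ≤ ((ε : ℕ) : ℤ) + pos p) := by
      intro p n hn
      have := hrp p
      split_ifs at this with h
      · rw [this, h]
        exact ⟨fun _ => by omega, fun _ => zero_mem_fracIdeal _⟩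
      · rw [mem_fracIdeal_iff_of_ne this.1, this.2]
    have hε : ∀ p, r p ∈ fracIdeal ((ε : ℕ) : ℤ) := fun p => (hmem p _ (by omega)).mpr (by omega)
    have hpq : pos p ≤ pos q := by
      have := mem_of_orbitRel (hε p) (hε q) hT (n := ((ε : ℕ) : ℤ) + pos p)
        (by have := hle p; omega) ((hmem p _ (by have := hle p; omega)).mpr le_rfl)
      have := (hmem q _ (by have := hle p; omega)).mp this
      omega
    have hqp : pos q ≤ pos p := by
      obtain ⟨l, k, hk, h0, h1, -⟩ := hT
      have hT' : OrbitRel μ η ε m (lowerUnip (r q)) (lowerUnip (r p)) _ :=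
        ⟨l⁻¹, k⁻¹, inv_mem hk, sl_inv_mul_row h0 h1 0, sl_inv_mul_row h0 h1 1, rfl⟩
      have := mem_of_orbitRel (hε q) (hε p) hT' (n := ((ε : ℕ) : ℤ) + pos q)
        (by have := hle q; omega) ((hmem q _ (by have := hle q; omega)).mpr le_rfl)
      have := (hmem p _ (by have := hle q; omega)).mp this
      omega
    have heq : pos p = pos q := le_antisymm hpq hqp
    have sq : 0 < pos p → pos p < m → IsSquare (r q / r p) := by
      intro h0 h1
      have := hrp p
      rw [if_neg h1.ne] at this
      exact isSquare_div_of_orbitRel hp this.1 this.2 h0 h1 hT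
    rcases p with ⟨i, hi⟩ | ⟨i, hi⟩ <;> rcases q with ⟨j, hj⟩ | ⟨j, hj⟩ <;>
      obtain rfl : i = j := heq
    · rfl
    · have hj' := Finset.mem_Ioo.mp hj
      have h := sq hj'.1 hj'.2
      simp only [hr, Sum.elim_inl, Sum.elim_inr] at h
      rw [if_neg (by omega), mul_div_cancel_right₀ _ (ht _)] at h
      exact absurd h hνs
    · have hi' := Finset.mem_Ioo.mp hi
      have h := sq hi'.1 hi'.2
      simp only [hr, Sum.elim_inl, Sum.elim_inr] at h
      rw [if_neg (by omega), div_mul_cancel_right₀ (ht _)] at h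
      exact absurd (by simpa using h.inv) hνs
    · rfl

end Classification

/-! ### The number of admissible positions. -/

section Count

/-- The number of pairs of a position `i` and a sign on which the stabilizers act trivially. -/
lemma card_admissible {P : ℕ → Prop} [DecidablePred P] {m a c c₁ c₂ : ℕ} (hm : m ≠ 0) (ha : a ≤ m)
    (hlt : a < c → c₁ = c ∧ c₂ = c) (hgt : c < a → c₁ = a ∧ c₂ = a)
    (heq : a = c → c₁ ≤ c ∧ c₂ ≤ c)
    (hP : ∀ i ≤ m, P i ↔ (m ≤ 2 * i ∧ a ≤ i ∧ c₁ ≤ m - i) ∨ (2 * i ≤ m ∧ a ≤ m - i ∧ c₂ ≤ i)) :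
    ((((Finset.range (m + 1)).filter P).card + ((Finset.Ioo 0 m).filter P).card : ℕ) : ℤ) =
      if (m : ℤ) < c then 0
      else if (m : ℤ) < 2 * c then
        2 * (max 0 ((m : ℤ) - c - c₁ + 1) + max 0 ((m : ℤ) - c - c₂ + 1))
          - (if (c₁ : ℤ) = 0 then 1 else 0) - (if (c₂ : ℤ) = 0 then 1 else 0)
      else
        2 * max 0 ((m : ℤ) - c₁ - c₂ + 1)
          - (if (c₁ : ℤ) = 0 then 1 else 0) - (if (c₂ : ℤ) = 0 then 1 else 0) := by
  -- In the application a, c, c₁, c₂ are the conductors of η, μ, ημ, ημ⁻¹. The admissible positions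
  -- in [0, m] form one interval, except that they form two disjoint ones (possibly empty) if a = c
  -- and m < 2c.
  have hfull : (((Finset.range (m + 1)).filter P).card : ℤ) =
      if (m : ℤ) < 2 * c then max 0 ((m : ℤ) - c - c₁ + 1) + max 0 ((m : ℤ) - c - c₂ + 1)
      else max 0 ((m : ℤ) - c₁ - c₂ + 1) := by
    rcases lt_trichotomy a c with h | h | h
    · obtain ⟨h1, h2⟩ := hlt h
      have : (Finset.range (m + 1)).filter P = Finset.Icc c (m - c) := by
        ext i
        rw [Finset.mem_filter, Finset.mem_range, Finset.mem_Icc]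
        constructor
        · rintro ⟨hi, hPi⟩
          rw [hP i (by omega)] at hPi
          omega
        · intro hi
          refine ⟨by omega, ?_⟩
          rw [hP i (by omega)]
          omega
      rw [this, Nat.card_Icc]
      split_ifs <;> omega
    · obtain ⟨h1, h2⟩ := heq h
      by_cases h2m : 2 * c ≤ m
      · have : (Finset.range (m + 1)).filter P = Finset.Icc c₂ (m - c₁) := by
          ext i
          rw [Finset.mem_filter, Finset.mem_range, Finset.mem_Icc]
          constructor
          · rintro ⟨hi, hPi⟩
            rw [hP i (by omega)] at hPi
            omega
          · intro hi
            refine ⟨by omega, ?_⟩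
            rw [hP i (by omega)]
            omega
        rw [this, Nat.card_Icc]
        split_ifs <;> omega
      · have : (Finset.range (m + 1)).filter P =
            Finset.Icc c (m - c₁) ∪ Finset.Icc c₂ (m - c) := by
          ext i
          rw [Finset.mem_filter, Finset.mem_range, Finset.mem_union, Finset.mem_Icc,
            Finset.mem_Icc]
          constructor
          · rintro ⟨hi, hPi⟩
            rw [hP i (by omega)] at hPi
            omega
          · intro hi
            refine ⟨by omega, ?_⟩
            rw [hP i (by omega)]
            omega
        have hd : Disjoint (Finset.Icc c (m - c₁)) (Finset.Icc c₂ (m - c)) := by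
          rw [Finset.disjoint_left]
          intro i hi hi'
          rw [Finset.mem_Icc] at hi hi'
          omega
        rw [this, Finset.card_union_of_disjoint hd, Nat.card_Icc, Nat.card_Icc]
        split_ifs <;> omega
    · obtain ⟨h1, h2⟩ := hgt h
      have : (Finset.range (m + 1)).filter P = Finset.Icc a (m - a) := by
        ext i
        rw [Finset.mem_filter, Finset.mem_range, Finset.mem_Icc]
        constructor
        · rintro ⟨hi, hPi⟩
          rw [hP i (by omega)] at hPi
          omega
        · intro hi
          refine ⟨by omega, ?_⟩
          rw [hP i (by omega)]
          omega
      rw [this, Nat.card_Icc]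
      split_ifs <;> omega
  -- The endpoints are the positions with a single class; their admissibility produces the δ terms.
  have h0 : P 0 ↔ c₂ = 0 := by rw [hP 0 (by omega)]; omega
  have h1 : P m ↔ c₁ = 0 := by rw [hP m le_rfl]; omega
  have hsplit : Finset.range (m + 1) = insert 0 (insert m (Finset.Ioo 0 m)) := by
    ext i
    simp only [Finset.mem_range, Finset.mem_insert, Finset.mem_Ioo]
    omega
  have hinner : (((Finset.range (m + 1)).filter P).card : ℤ) = ((Finset.Ioo 0 m).filter P).card +
      (if c₁ = 0 then 1 else 0) + (if c₂ = 0 then 1 else 0) := by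
    rw [hsplit, Finset.filter_insert, Finset.filter_insert]
    have n1 : m ∉ (Finset.Ioo 0 m).filter P := by simp
    have n2 : 0 ∉ (Finset.Ioo 0 m).filter P := by simp
    have n3 : 0 ∉ insert m ((Finset.Ioo 0 m).filter P) := by simp [hm.symm]
    simp only [h0, h1]
    split_ifs
    · rw [Finset.card_insert_of_notMem n3, Finset.card_insert_of_notMem n1]
      push_cast
      ring
    · rw [Finset.card_insert_of_notMem n2]
      push_cast
      ring
    · rw [Finset.card_insert_of_notMem n1]
      push_cast
      ring
    · ring
  have hc : (m : ℤ) < c → c₁ = c ∧ c₂ = c := fun h => hlt (by omega)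
  push_cast
  rw [eq_sub_of_add_eq (eq_sub_of_add_eq hinner.symm), hfull]
  simp only [Nat.cast_eq_zero]
  split_ifs <;> omega

open Classical in
/-- The space of equivariant functions has as many dimensions as there are classes on which the
stabilizers act trivially. -/
lemma IsScalarEquivalence.finrank_eq {X : Type*} {T : X → X → ℂ → Prop}
    (hT : IsScalarEquivalence T) {s t : Finset ℕ} {r : s ⊕ t → X}
    (cover : ∀ x, ∃ i z, T (r i) x z) (sep : ∀ {i j z}, T (r i) (r j) z → i = j) {P : ℕ → Prop}
    (hP : ∀ i, (∀ z, T (r i) (r i) z → z = 1) ↔ P (Sum.elim Subtype.val Subtype.val i)) :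
    FiniteDimensional ℂ (equivariantFunctions T) ∧
      Module.finrank ℂ (equivariantFunctions T) = (s.filter P).card + (t.filter P).card := by
  obtain ⟨e⟩ := hT.nonempty_equiv cover sep
  refine ⟨Module.Finite.equiv e.symm, ?_⟩
  rw [e.finrank_eq, Module.finrank_fintype_fun_eq_card]
  have card : ∀ s : Finset ℕ, Fintype.card {i : s // P i} = (s.filter P).card := by
    intro s
    rw [Fintype.card_subtype, ← Finset.card_map (Function.Embedding.subtype (· ∈ s))]
    congr 1
    ext i
    simp
    tauto
  rw [← card s, ← card t, ← Fintype.card_sum]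
  exact Fintype.card_congr ((Equiv.subtypeEquivRight hP).trans Equiv.subtypeSum)

end Count

lemma resUnits_neg_one {F : Type*} [Field F] [ValuativeRel F] [TopologicalSpace F]
    (μ : Fˣ →ₜ* ℂˣ) : resUnits μ (-1) = μ (-1) := by
  change μ (Units.map (𝒪[F].subtype : 𝒪[F] →* F) (-1)) = _
  congr 1

/-! ### The dimension formula. -/

section Dimension

variable {F : Type*} [Field F] [ValuativeRel F] [TopologicalSpace F]
  [IsNonarchimedeanLocalField F]
  {ψ : AddChar F ℂ} {μ : Fˣ →ₜ* ℂˣ} {η : 𝒪[F]ˣ →ₜ* ℂˣ} {ε : Fin 2} {m : ℕ}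

/-- `stabilizerTrivial_iff` wants the larger exponent first, so for 2i ≤ m the symmetry is applied,
which turns μ into μ⁻¹. At 2i = m both descriptions are valid. -/
lemma stabilizerTrivial_resUnits_iff (hp : ringChar 𝓀[F] ≠ 2) (hm : m ≠ 0)
    (h : η (-1) = μ (-1)) {i : ℕ} (hi : i ≤ m) :
    StabilizerTrivial (resUnits μ) η i (m - i) ↔
      (m ≤ 2 * i ∧ cond η ≤ i ∧ cond (η * resUnits μ) ≤ m - i) ∨
      (2 * i ≤ m ∧ cond η ≤ m - i ∧ cond (η * (resUnits μ)⁻¹) ≤ i) := by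
  have hsq : μ (-1) * μ (-1) = 1 := by rw [← map_mul, neg_mul_neg, one_mul, map_one]
  have n1 : evalUnit (η * resUnits μ) (-1) = 1 := by
    rw [evalUnit_neg_one]
    change ((η (-1) * resUnits μ (-1) : ℂˣ) : ℂ) = 1
    rw [resUnits_neg_one, h, hsq, Units.val_one]
  have n2 : evalUnit (η * (resUnits μ)⁻¹) (-1) = 1 := by
    rw [evalUnit_neg_one]
    change ((η (-1) * (resUnits μ (-1))⁻¹ : ℂˣ) : ℂ) = 1
    rw [resUnits_neg_one, h, mul_inv_cancel, Units.val_one]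
  have i1 : m ≤ 2 * i → (StabilizerTrivial (resUnits μ) η i (m - i) ↔ _) := fun h =>
    stabilizerTrivial_iff hp (by omega) (by omega) n1
  have i2 : 2 * i ≤ m → (StabilizerTrivial (resUnits μ) η i (m - i) ↔ _) := fun h =>
    stabilizerTrivial_symm.trans (stabilizerTrivial_iff hp (by omega) (by omega) n2)
  constructor
  · intro hs
    rcases le_total m (2 * i) with h3 | h3
    · exact Or.inl ⟨h3, (i1 h3).mp hs⟩
    · exact Or.inr ⟨h3, (i2 h3).mp hs⟩
  · rintro (⟨h3, h4⟩ | ⟨h3, h4⟩)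
    · exact (i1 h3).mpr h4
    · exact (i2 h3).mpr h4

lemma cond_relations (χ η : 𝒪[F]ˣ →ₜ* ℂˣ) :
    (cond η < cond χ → cond (η * χ) = cond χ) ∧ (cond χ < cond η → cond (η * χ) = cond η) ∧
      (cond η = cond χ → cond (η * χ) ≤ cond χ) := by
  refine ⟨cond_mul_of_lt, fun h => ?_, fun h => ?_⟩
  · rw [show η * χ = χ * η from mul_comm η χ]
    exact cond_mul_of_lt h
  · have := cond_mul_le η χ
    rwa [h, max_self] at this

/-- The dimension of the isotypic subspaces for `m ≠ 0`. -/
lemma finrank_isotypic_of_ne_zero (hp : ringChar 𝓀[F] ≠ 2)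
    (hG : IsWeilFunction ((ε : ℕ) : ℤ) fun a : F => weilIndex (ψ.mulShift a))
    (h : η (-1) = μ (-1)) (hm : m ≠ 0) (hη : cond η ≤ m) :
    FiniteDimensional ℂ (isotypic (principalSeries ψ μ) ε m η) ∧
    (Module.finrank ℂ (isotypic (principalSeries ψ μ) ε m η) : ℤ) =
      if (m : ℤ) < cond (resUnits μ) then 0
      else if (m : ℤ) < 2 * cond (resUnits μ) then
        2 * (max 0 ((m : ℤ) - cond (resUnits μ) - cond (η * resUnits μ) + 1) +
            max 0 ((m : ℤ) - cond (resUnits μ) - cond (η * (resUnits μ)⁻¹) + 1))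
          - (if (cond (η * resUnits μ) : ℤ) = 0 then 1 else 0)
          - (if (cond (η * (resUnits μ)⁻¹) : ℤ) = 0 then 1 else 0)
      else
        2 * max 0 ((m : ℤ) - cond (η * resUnits μ) - cond (η * (resUnits μ)⁻¹) + 1)
          - (if (cond (η * resUnits μ) : ℤ) = 0 then 1 else 0)
          - (if (cond (η * (resUnits μ)⁻¹) : ℤ) = 0 then 1 else 0) := by
  classical
  obtain ⟨r, cover, sep, hr⟩ := exists_representatives hp μ η ε hm
  have hle : ∀ p : Finset.range (m + 1) ⊕ Finset.Ioo 0 m,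
      Sum.elim Subtype.val Subtype.val p ≤ m := by
    rintro (⟨i, hi⟩ | ⟨i, hi⟩)
    · exact Nat.lt_succ_iff.mp (Finset.mem_range.mp hi)
    · exact (Finset.mem_Ioo.mp hi).2.le
  obtain ⟨hfin, hrank⟩ := (isScalarEquivalence_orbitRel (μ := μ) (ε := ε) hη).finrank_eq
    (r := fun p => lowerUnip (r p)) cover sep
    (P := fun i => StabilizerTrivial (resUnits μ) η i (m - i))
    (fun p => orbitRel_self_iff hm hη (hle p) (hr p))
  have e := isotypicEquiv (μ := μ) (m := m) hp hG hη
  refine ⟨Module.Finite.equiv e.symm, ?_⟩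
  rw [e.finrank_eq, hrank]
  have r1 := cond_relations (resUnits μ) η
  have r2 := cond_relations (resUnits μ)⁻¹ η
  rw [cond_inv] at r2
  exact card_admissible hm hη (fun h => ⟨r1.1 h, r2.1 h⟩) (fun h => ⟨r1.2.1 h, r2.2.1 h⟩)
    (fun h => ⟨r1.2.2 h, r2.2.2 h⟩) (fun i hi => stabilizerTrivial_resUnits_iff hp hm h hi)

/-- The torus over 𝒪ˣ fixes the line of the row (0, 1), and at level 0 the character η is trivial,
so only μ on units is seen. -/
lemma orbitRel_zero_self_iff :
    (∀ z, OrbitRel μ (1 : 𝒪[F]ˣ →ₜ* ℂˣ) ε 0 (lowerUnip 0) (lowerUnip 0) z → z = 1) ↔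
      cond (resUnits μ) = 0 := by
  constructor
  · intro h
    refine Nat.le_zero.mp (cond_le_iff.mpr fun d hd hd0 _ => ?_)
    have h1 := h _ ⟨Units.mk0 d hd, torus (Units.mk0 d hd), mem_K.mpr ⟨?_, ?_, ?_, ?_⟩, ?_, ?_, rfl⟩
    · rw [torusChar_of_ord μ (by simpa using hd0), evalUnit_trivial, mul_one, inv_eq_one] at h1
      exact h1
    · exact mem_fracIdeal_of_le (by simp [hd0])
    · exact zero_mem_fracIdeal _
    · exact zero_mem_fracIdeal _
    · exact mem_fracIdeal_of_le (by simp [ord_inv, hd0])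
    · simp [sl_mul_apply]
    · simp [sl_mul_apply, hd]
  · intro h z hz
    obtain ⟨l, k, -, -, -, -, rfl⟩ :=
      exists_of_orbitRel (zero_mem_fracIdeal _) (zero_mem_fracIdeal _) hz
    rw [cond_eq_zero_iff.mp h, evalUnit_trivial, evalUnit_trivial, inv_one, mul_one]

/-- This is the Iwasawa decomposition for K^ε_0: a Weyl element rescaled by t of order ε handles the
upper rows. -/
lemma exists_orbitRel_level_zero (g : SL(2, F)) : ∃ z, OrbitRel μ η ε 0 (lowerUnip 0) g z := by
  by_cases hu : IsUpper ((ε : ℕ) : ℤ) (g 1 0) (g 1 1)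
  · obtain ⟨hc, hd⟩ := hu
    obtain ⟨t, ht, hto⟩ := exists_ord_eq (F := F) ((ε : ℕ) : ℤ)
    refine exists_orbitRel_of_row (l := g 1 0 / t) (a := 0) (b := -t⁻¹) (c := t)
      (d := g 1 1 * (g 1 0 / t)⁻¹) (div_ne_zero hc ht) (by field_simp; ring)
      (zero_mem_fracIdeal _) (fracIdeal_neg (mem_fracIdeal_of_le (by rw [ord_inv, hto])))
      (mem_fracIdeal_of_le (by rw [hto]; simp)) (fracIdeal_mul hd
        (mem_fracIdeal_of_le (ord_inv _).ge) (by rw [ord_div hc ht, hto]; omega)) ?_ ?_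
    · field_simp
      ring
    · field_simp
      ring
  · obtain ⟨hd, hc⟩ := (not_isUpper_iff (sl_row_ne_zero g)).mp hu
    exact exists_orbitRel_zero hd (fracIdeal_mono (by push_cast; omega) hc)

/-- The dimension of the spherical subspace. -/
lemma finrank_isotypic_zero (hp : ringChar 𝓀[F] ≠ 2)
    (hG : IsWeilFunction ((ε : ℕ) : ℤ) fun a : F => weilIndex (ψ.mulShift a)) :
    FiniteDimensional ℂ (isotypic (principalSeries ψ μ) ε 0 (1 : 𝒪[F]ˣ →ₜ* ℂˣ)) ∧
    Module.finrank ℂ (isotypic (principalSeries ψ μ) ε 0 (1 : 𝒪[F]ˣ →ₜ* ℂˣ)) =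
      if cond (resUnits μ) = 0 then 1 else 0 := by
  have hη : cond (1 : 𝒪[F]ˣ →ₜ* ℂˣ) ≤ 0 := (cond_eq_zero_iff.mpr rfl).le
  have hsub : ∀ p q : ({0} : Finset ℕ) ⊕ (∅ : Finset ℕ), p = q := by
    rintro (⟨p, hp⟩ | ⟨p, hp⟩) (⟨q, hq⟩ | ⟨q, hq⟩)
    · rw [Finset.mem_singleton] at hp hq
      subst hp hq
      rfl
    · exact absurd hq (Finset.notMem_empty _)
    · exact absurd hp (Finset.notMem_empty _)
    · exact absurd hp (Finset.notMem_empty _)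
  obtain ⟨hfin, hrank⟩ := (isScalarEquivalence_orbitRel (μ := μ) (ε := ε) hη).finrank_eq
    (s := {0}) (t := ∅) (r := fun _ => lowerUnip 0)
    (fun g => ⟨Sum.inl ⟨0, Finset.mem_singleton_self 0⟩, exists_orbitRel_level_zero g⟩)
    (fun _ => hsub _ _) (P := fun _ => cond (resUnits μ) = 0) (fun _ => orbitRel_zero_self_iff)
  have e := isotypicEquiv (μ := μ) hp hG hη
  refine ⟨Module.Finite.equiv e.symm, ?_⟩
  rw [e.finrank_eq, hrank]
  by_cases h : cond (resUnits μ) = 0 <;> simp [h]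

end Dimension

/-! ### Conductors of the principal series. -/

section Conductors

variable {F : Type*} [Field F] [ValuativeRel F] [TopologicalSpace F]
  [IsNonarchimedeanLocalField F]
  {ψ : AddChar F ℂ} {μ : Fˣ →ₜ* ℂˣ} {η : 𝒪[F]ˣ →ₜ* ℂˣ} {ε : Fin 2} {m : ℕ}

/-- The dimension of the isotypic subspaces, except for the case where they consist of spherical
vectors of an unramified representation. -/
lemma finrank_isotypic (hp : ringChar 𝓀[F] ≠ 2)
    (hG : IsWeilFunction ((ε : ℕ) : ℤ) fun a : F => weilIndex (ψ.mulShift a))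
    (h : η (-1) = μ (-1)) (h0 : ¬ (cond (resUnits μ) = 0 ∧ cond η = 0 ∧ m = 0)) :
    FiniteDimensional ℂ (isotypic (principalSeries ψ μ) ε m η) ∧
    (Module.finrank ℂ (isotypic (principalSeries ψ μ) ε m η) : ℤ) =
      if (m : ℤ) < cond (resUnits μ) then 0
      else if (m : ℤ) < 2 * cond (resUnits μ) then
        2 * (max 0 ((m : ℤ) - cond (resUnits μ) - cond (η * resUnits μ) + 1) +
            max 0 ((m : ℤ) - cond (resUnits μ) - cond (η * (resUnits μ)⁻¹) + 1))
          - (if (cond (η * resUnits μ) : ℤ) = 0 then 1 else 0)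
          - (if (cond (η * (resUnits μ)⁻¹) : ℤ) = 0 then 1 else 0)
      else
        2 * max 0 ((m : ℤ) - cond (η * resUnits μ) - cond (η * (resUnits μ)⁻¹) + 1)
          - (if (cond (η * resUnits μ) : ℤ) = 0 then 1 else 0)
          - (if (cond (η * (resUnits μ)⁻¹) : ℤ) = 0 then 1 else 0) := by
  by_cases hη : cond η ≤ m
  swap
  -- For m < c(η) the space is zero by definition. The formula agrees: either c(η) ≤ c(μ), so m <
  -- c(μ), or both products have conductor c(η) > m.
  · have hbot : isotypic (principalSeries ψ μ) ε m η = ⊥ := by rw [isotypic, if_neg hη]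
    have r1 := (cond_relations (resUnits μ) η).2.1
    have r2 := (cond_relations (resUnits μ)⁻¹ η).2.1
    rw [cond_inv] at r2
    rw [hbot]
    refine ⟨inferInstance, ?_⟩
    rw [finrank_bot]
    split_ifs <;> omega
  by_cases hm : m = 0
  · subst hm
    have h1 : η = 1 := cond_eq_zero_iff.mp (by omega)
    have h2 : cond (resUnits μ) ≠ 0 := fun h2 => h0 ⟨h2, by omega, rfl⟩
    subst h1
    obtain ⟨hf, hr⟩ := finrank_isotypic_zero (μ := μ) hp hG
    refine ⟨hf, ?_⟩
    rw [hr, if_neg h2, if_pos (by omega)]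
    rfl
  · exact finrank_isotypic_of_ne_zero hp hG h hm hη

lemma isotypic_eq_bot_of_lt (hp : ringChar 𝓀[F] ≠ 2)
    (hG : IsWeilFunction ((ε : ℕ) : ℤ) fun a : F => weilIndex (ψ.mulShift a))
    (hm : m < cond (resUnits μ)) : isotypic (principalSeries ψ μ) ε m η = ⊥ := by
  by_cases h : η (-1) = μ (-1)
  · obtain ⟨hf, hr⟩ := finrank_isotypic (m := m) hp hG h (by omega)
    rw [if_pos (by omega)] at hr
    exact Submodule.finrank_eq_zero.mp (by exact_mod_cast hr)
  · exact isotypic_eq_bot_of_neg_one_ne hp hG h m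

/-- The characters which occur at the minimal level. -/
lemma isotypic_cond_ne_bot_iff (hp : ringChar 𝓀[F] ≠ 2)
    (hG : IsWeilFunction ((ε : ℕ) : ℤ) fun a : F => weilIndex (ψ.mulShift a)) :
    isotypic (principalSeries ψ μ) ε (cond (resUnits μ)) η ≠ ⊥ ↔
      η = resUnits μ ∨ η = (resUnits μ)⁻¹ := by
  have e1 : cond (η * resUnits μ) = 0 ↔ η = (resUnits μ)⁻¹ :=
    cond_eq_zero_iff.trans mul_eq_one_iff_eq_inv
  have e2 : cond (η * (resUnits μ)⁻¹) = 0 ↔ η = resUnits μ :=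
    cond_eq_zero_iff.trans mul_inv_eq_one
  by_cases h : η (-1) = μ (-1)
  swap
  · have hbot := isotypic_eq_bot_of_neg_one_ne hp hG h (cond (resUnits μ))
    refine ⟨fun h1 => absurd hbot h1, ?_⟩
    have hsq : μ (-1) * μ (-1) = 1 := by rw [← map_mul, neg_mul_neg, one_mul, map_one]
    rintro (rfl | rfl)
    · exact absurd (resUnits_neg_one μ) h
    · refine absurd ?_ h
      change (resUnits μ (-1))⁻¹ = _
      rw [resUnits_neg_one]
      exact inv_eq_of_mul_eq_one_right hsq
  by_cases h0 : cond (resUnits μ) = 0 ∧ cond η = 0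
  · have h1 := cond_eq_zero_iff.mp h0.1
    obtain rfl := cond_eq_zero_iff.mp h0.2
    obtain ⟨hf, hr⟩ := finrank_isotypic_zero (μ := μ) hp hG
    rw [if_pos h0.1] at hr
    refine ⟨fun _ => Or.inl h1.symm, fun _ hbot => ?_⟩
    rw [h0.1] at hbot
    rw [hbot, finrank_bot] at hr
    omega
  · obtain ⟨hf, hr⟩ := finrank_isotypic (m := cond (resUnits μ)) hp hG h (by tauto)
    rw [← e1, ← e2, ne_eq, ← Submodule.finrank_eq_zero (R := ℂ)]
    -- At m = c(μ) > 0 the dimension is the sum of the two δ terms. If c(μ) = 0 < c(η), both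
    -- products are ramified and the dimension is 0.
    have r1 := cond_relations (resUnits μ) η
    rw [if_neg (by omega)] at hr
    have hz : cond (resUnits μ) = 0 → cond (η * resUnits μ) ≠ 0 := by
      intro hz
      have := r1.2.1
      omega
    split_ifs at hr <;> omega

lemma weilRatio_neg_one (hG : IsWeilFunction ((ε : ℕ) : ℤ) fun a : F => weilIndex (ψ.mulShift a)) :
    weilRatio (-1) ψ = 1 ∨ weilRatio (-1) ψ = -1 := by
  rw [weilRatio_eq]
  have h1 := hG.ne_zero one_ne_zero
  have := hG.mul_unit_eq_or (neg_ne_zero.mpr one_ne_zero) (by rw [ord_neg, ord_one]) one_ne_zero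
  simp only [mul_one] at this h1
  rcases this with h | h
  · left
    rw [h, div_self h1]
  · right
    rw [h, neg_div, div_self h1]

lemma negOne_sgn (hG : IsWeilFunction ((ε : ℕ) : ℤ) fun a : F => weilIndex (ψ.mulShift a)) :
    (((negOne ψ : Mp F).sgn : ℤ) : ℂ) = weilRatio (-1) ψ := by
  have h : (-1 : ℂ) ≠ 1 := by norm_num
  rcases weilRatio_neg_one hG with h1 | h1 <;> simp [negOne, h1, h]

/-- The matrix -1 is central and the cocycle values agree by symmetry of the Hilbert symbol. Thus
right translation by `negOne` becomes a left action of the torus. -/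
lemma mul_negOne (x : Mp F) : x * negOne ψ =
    ⟨torus (-1), (negOne ψ : Mp F).sgn⟩ * ⟨unip 0, 1⟩ * x := by
  have hX := kubotaX_ne_zero x.mat
  have t1 : (torus (-1) * unip 0 : SL(2, F)) = -1 := by
    apply sl_ext <;> simp [sl_mul_apply]
  have k1 : kubotaX (-1 : SL(2, F)) = -1 := by simp [kubotaX]
  have k2 : kubotaX (x.mat * -1) = -kubotaX x.mat := by
    have := lead_smul (neg_ne_zero.mpr (one_ne_zero (α := F))) (x.mat 1 0) (x.mat 1 1)
    rw [neg_one_mul, neg_one_mul, neg_one_mul] at this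
    rw [kubotaX_eq_lead, kubotaX_eq_lead, ← this]
    simp
  rw [torus_unip_mul, t1]
  refine Mp.ext ?_ ?_
  · change x.mat * -1 = _
    rw [mul_neg, neg_mul, mul_one, one_mul]
  · change x.sgn * (negOne ψ).sgn * kubota x.mat (-1) = _
    rw [mul_comm x.sgn]
    congr 1
    rw [kubota, k1, k2, hilbert_symm]
    congr 1
    · rw [neg_div_neg_eq, one_div]
    · rw [div_neg, div_self hX]
      simp

/-- The sign γ_F(-1, ψ) built into `negOne` cancels the factor γ_F(-1, ψ)⁻¹ of the principal series.
-/
lemma hasCentralSign_principalSeries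
    (hG : IsWeilFunction ((ε : ℕ) : ℤ) fun a : F => weilIndex (ψ.mulShift a)) :
    HasCentralSign ψ (principalSeries ψ μ) ((μ (-1) : ℂˣ) : ℂ) := by
  intro f hf
  ext x
  change f (x * negOne ψ) = _
  have h1 : weilRatio ((-1 : Fˣ) : F) ψ = weilRatio (-1) ψ := by simp
  have h2 : weilRatio (-1) ψ ≠ 0 := by
    rcases weilRatio_neg_one hG with h | h <;> rw [h] <;> norm_num
  rw [mul_negOne, hf.2, chiPsi, negOne_sgn hG, h1, mul_inv_cancel₀ h2, normAbs_of_ord (by simp)]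
  simp

/-- All spaces below level c(μ) vanish, so the question is only whether the one at level c(μ) is
nonzero. -/
lemma condEta_eq_iff (hp : ringChar 𝓀[F] ≠ 2)
    (hG : IsWeilFunction ((ε : ℕ) : ℤ) fun a : F => weilIndex (ψ.mulShift a)) :
    condEta (principalSeries ψ μ) ε η = cond (resUnits μ) ↔
      η = resUnits μ ∨ η = (resUnits μ)⁻¹ := by
  rw [← isotypic_cond_ne_bot_iff (ψ := ψ) (ε := ε) hp hG]
  constructor
  · intro h hbot
    have : ((cond (resUnits μ) + 1 : ℕ) : ℕ∞) ≤ condEta (principalSeries ψ μ) ε η := by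
      refine le_iInf₂ fun m hm => ?_
      have h1 : ¬ m < cond (resUnits μ) := fun h1 => hm (isotypic_eq_bot_of_lt hp hG h1)
      have h2 : m ≠ cond (resUnits μ) := fun h2 => hm (h2 ▸ hbot)
      exact_mod_cast (show cond (resUnits μ) + 1 ≤ m by omega)
    rw [h] at this
    have : cond (resUnits μ) + 1 ≤ cond (resUnits μ) := by exact_mod_cast this
    omega
  · intro h
    refine le_antisymm (iInf_le_of_le _ (iInf_le_of_le h le_rfl)) (le_iInf₂ fun m hm => ?_)
    have h1 : ¬ m < cond (resUnits μ) := fun h1 => hm (isotypic_eq_bot_of_lt hp hG h1)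
    exact_mod_cast not_lt.mp h1

/-- The level c(μ) bounds every conductor from below. It is attained by the restriction of μ, whose
value at -1 is the central sign. -/
lemma condMin_eq (hp : ringChar 𝓀[F] ≠ 2)
    (hG : IsWeilFunction ((ε : ℕ) : ℤ) fun a : F => weilIndex (ψ.mulShift a)) :
    condMin ψ (principalSeries ψ μ) ε = cond (resUnits μ) := by
  refine le_antisymm ?_ (le_iInf₂ fun η _ => le_iInf₂ fun m hm => ?_)
  · have h1 : HasCentralSign ψ (principalSeries ψ μ) ((resUnits μ (-1) : ℂˣ) : ℂ) := by
      rw [resUnits_neg_one]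
      exact hasCentralSign_principalSeries hG
    exact iInf_le_of_le _ (iInf_le_of_le h1 ((condEta_eq_iff hp hG).mpr (Or.inl rfl)).le)
  · have h1 : ¬ m < cond (resUnits μ) := fun h1 => hm (isotypic_eq_bot_of_lt hp hG h1)
    exact_mod_cast not_lt.mp h1

end Conductors

end Metaplectic

theorem mainTheorem2 {F : Type*} [Field F] [ValuativeRel F] [TopologicalSpace F]
    [IsNonarchimedeanLocalField F] [CharZero F] (hp : ringChar 𝓀[F] ≠ 2)
    (ε : Fin 2) (ψ : AddChar F ℂ) (hψ : Continuous ψ)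
    (hψε : Metaplectic.HasConductor ψ (-((ε : ℕ) : ℤ))) (μ : Fˣ →ₜ* ℂˣ) :
    (∀ η : 𝒪[F]ˣ →ₜ* ℂˣ, η (-1) ≠ μ (-1) →
      ∀ m : ℕ, Metaplectic.isotypic (Metaplectic.principalSeries ψ μ) ε m η = ⊥) ∧
    (∀ η : 𝒪[F]ˣ →ₜ* ℂˣ, η (-1) = μ (-1) → ∀ (m : ℕ) (c c₁ c₂ : ℤ),
      c = Metaplectic.cond (Metaplectic.resUnits μ) →
      c₁ = Metaplectic.cond (η * Metaplectic.resUnits μ) →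
      c₂ = Metaplectic.cond (η * (Metaplectic.resUnits μ)⁻¹) →
      (c = 0 ∧ Metaplectic.cond η = 0 ∧ m = 0 →
        Metaplectic.isotypic (Metaplectic.principalSeries ψ μ) ε m η =
          Metaplectic.isotypic (Metaplectic.principalSeries ψ μ) ε 0 1 ∧
        Module.finrank ℂ (Metaplectic.isotypic (Metaplectic.principalSeries ψ μ) ε m η) = 1) ∧
      (¬ (c = 0 ∧ Metaplectic.cond η = 0 ∧ m = 0) →
        FiniteDimensional ℂ (Metaplectic.isotypic (Metaplectic.principalSeries ψ μ) ε m η) ∧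
        (Module.finrank ℂ (Metaplectic.isotypic (Metaplectic.principalSeries ψ μ) ε m η) : ℤ) =
          if (m : ℤ) < c then 0
          else if (m : ℤ) < 2 * c then
            2 * (max 0 (m - c - c₁ + 1) + max 0 (m - c - c₂ + 1))
              - (if c₁ = 0 then 1 else 0) - (if c₂ = 0 then 1 else 0)
          else
            2 * max 0 (m - c₁ - c₂ + 1)
              - (if c₁ = 0 then 1 else 0) - (if c₂ = 0 then 1 else 0))) ∧
    Metaplectic.condMin ψ (Metaplectic.principalSeries ψ μ) ε =
      Metaplectic.cond (Metaplectic.resUnits μ) ∧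
    (∀ η : 𝒪[F]ˣ →ₜ* ℂˣ,
      Metaplectic.condMin ψ (Metaplectic.principalSeries ψ μ) ε =
          Metaplectic.condEta (Metaplectic.principalSeries ψ μ) ε η ↔
        η = Metaplectic.resUnits μ ∨ η = (Metaplectic.resUnits μ)⁻¹) := by
  have hG := Metaplectic.isWeilFunction_weilIndex hp hψ hψε
  have hc := Metaplectic.condMin_eq (μ := μ) hp hG
  refine ⟨fun η hη m => Metaplectic.isotypic_eq_bot_of_neg_one_ne hp hG hη m,
    fun η hη m c c₁ c₂ hcμ hc₁ hc₂ => ⟨?_, ?_⟩, hc, fun η => ?_⟩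
  · rintro ⟨h0, h1, rfl⟩
    obtain rfl := Metaplectic.cond_eq_zero_iff.mp h1
    have := (Metaplectic.finrank_isotypic_zero (μ := μ) hp hG).2
    rw [if_pos (by omega)] at this
    exact ⟨rfl, this⟩
  · intro h0
    subst hcμ hc₁ hc₂
    exact Metaplectic.finrank_isotypic hp hG hη (by exact_mod_cast h0)
  · rw [hc, eq_comm]
    exact Metaplectic.condEta_eq_iff hp hG
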